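/- **Theorem (complexity of Choice).** Fix a dimension $d\ge 1$ and a norm $\|\cdot\|$ on $\mathbb R^d$; $B(q,\rho)$ and $\overline B(q,\rho)$ denote open and closed $\|\cdot\|$-balls. *Setting.* Computations are done by deterministic multi-tape Turing machines $M^\varphi$ with a function oracle $\varphi:\{0,1\}^*\to\{0,1\}^*$; a query is answered in one step. Let $0^n$ be the unary code of $n\in\mathbb Z$ (through an embedding of $\mathbb Z$ into $\mathbb N$), and let points $q\in\mathbb D^d$ with dyadic coordinates $a/2^m$ be coded by the tuples of codes of $a$ (binary) and $m$ (unary). * A *$\delta_{\mathrm{set}}$-name* of $S\subseteq\mathbb R^d$ is a $\varphi$ with values in $\{0,1\}$ such that, for all $q\in\mathbb D^d$ and $n\in\mathbb Z$, $\varphi(q,0^n)=1$ if $B(q,2^{-n})\cap S\ne\emptyset$, and $\varphi(q,0^n)=0$ if $\overline B(q,2^{-n+1})\cap S=\emptyset$. * A *$\delta_{\mathrm{wmem}}$-name* of $S$ is a $\varphi$ with values in $\{0,1\}$ such that $\varphi(q,0^n)=1$ if $\overline B(q,2^{-n})\subseteq S$, and $\varphi(q,0^n)=0$ if $\overline B(q,2^{-n})\cap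 S=\emptyset$. * A name is enriched with an *outer radius parameter* $b\in\mathbb Z$, $S\subseteq\overline B(0,2^b)$, respectively an *inner radius parameter* $r\in\mathbb Z$, $\overline B(x,2^{-r})\subseteq S$ for some $x$ in the interior of $S$, by pairing it with the constant function of value $0^b$, respectively $0^r$. * A *$\rho^d$-name* of $x\in\mathbb R^d$ is a function that maps every word of length $n$ to a code of some $q\in\mathbb D^d$ with coordinates in $2^{-n}\mathbb Z$ and $|q_i-x_i|\le 2^{-n}$ for all $i$. $\mathsf{Choice}$ is the multi-valued operator that maps a non-empty set $S$ to any point of $S$. A machine *computes* $\mathsf{Choice}$ from a class of names if for every such name $\varphi$ of $S$ the function $s\mapsto M^\varphi(s)$ is a $\rho^d$-name of a point $x\in S$. It *computes approximations* to $\mathsf{Choice}$ if for every such $\varphi$ and every input $s$, $|s|=n$, it outputs a code of some $q$ with coordinates in $2^{-n}\mathbb Z$ such that $|q_i-x_i|\le 2^{-n}$ for all $i$ and some $x\in S$, where $x$ may depend on $s$. 1. On non-empty compact sets, $\mathsf{Choice}$ is computable from $\delta_{\mathrm{set}}$-names enriched with an outer radius parameter $b$ in fully polynomial time: the number of steps on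 input $s$ is at most $p_1(|b|)\,p_2(|s|)$ for some polynomials $p_1,p_2$. 2. On bounded bodies (non-empty compact sets that are the closure of their interior), consider $\delta_{\mathrm{wmem}}$-names enriched with an inner radius parameter $r$ and an outer radius parameter $b$. $\mathsf{Choice}$ is computable from these names. Approximations to $\mathsf{Choice}$ are computable from them in time exponential in $|b|+|r|$ and polynomial in the output precision: in at most $2^{c(|b|+|r|+1)}\,p(|s|)$ steps for some constant $c$ and polynomial $p$. This is sharp in the sense that no fully polynomial bound is possible: there are no polynomials $p_1,p_2$ such that some machine computes approximations to $\mathsf{Choice}$ (in particular, no machine computes $\mathsf{Choice}$) from these names in at most $p_1(|b|+|r|)\,p_2(|s|)$ steps. -/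

import Mathlib

/-! ### Words, string functions and encodings -/

/-- Finite binary words. -/
abbrev Word := List Bool

/-- Baire space: total functions from words to words. They serve as names and as oracles. -/
abbrev StrFun := Word → Word

/-- Pairing of string functions: `⟨φ,ψ⟩(ε) = ε`, `⟨φ,ψ⟩(0s) = 0^|ψ(s)| 1 φ(s)` and
`⟨φ,ψ⟩(1s) = 0^|φ(s)| 1 ψ(s)`. -/
def pairFun (φ ψ : StrFun) : StrFun
  | [] => []
  | false :: s => List.replicate (ψ s).length false ++ true :: φ s
  | true :: s => List.replicate (φ s).length false ++ true :: ψ s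

/-- An injective pairing of words, computable and invertible in linear time:
`⟨s,t⟩ = 0^|s| 1 s t`. -/
def pairWord (s t : Word) : Word :=
  List.replicate s.length false ++ true :: (s ++ t)

/-- Unary code of an integer; the integers are embedded into the naturals by
`0, -1, 1, -2, 2, … ↦ 0, 1, 2, 3, 4, …`. -/
def unaryInt (n : ℤ) : Word := List.replicate (Equiv.intEquivNat n) false

/-- Binary code of an integer, through the same embedding into the naturals
(least significant bit first). -/
def binaryInt (a : ℤ) : Word := (Equiv.intEquivNat a).bits

/-- Code of the dyadic rational `a / 2 ^ m`, given by the pair `(a, m)`. -/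
def dyadicCode (q : ℤ × ℤ) : Word := pairWord (binaryInt q.1) (unaryInt q.2)

/-- Code of a tuple of dyadic rationals, by iterated pairing. -/
def dyadicListCode : List (ℤ × ℤ) → Word
  | [] => []
  | [q] => dyadicCode q
  | q :: r :: l => pairWord (dyadicCode q) (dyadicListCode (r :: l))

/-- Code of the point of `ℝ^d` whose `i`-th coordinate is the dyadic rational given by `c i`. -/
def pointCode {d : ℕ} (c : Fin d → ℤ × ℤ) : Word := dyadicListCode (List.ofFn c)

/-- The point with `i`-th coordinate `a / 2 ^ m`, where `c i = (a, m)`. -/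
noncomputable def dyadicPoint {d : ℕ} (c : Fin d → ℤ × ℤ) : Fin d → ℝ :=
  fun i => ((c i).1 : ℝ) / (2 : ℝ) ^ (c i).2

/-- The query `⟨q, 0^n⟩` for a dyadic point `q` and an integer precision `n`. -/
def queryWord {d : ℕ} (c : Fin d → ℤ × ℤ) (n : ℤ) : Word :=
  pairWord (pointCode c) (unaryInt n)

/-! ### Oracle Turing machines -/

/-- What a state of an oracle machine with tapes indexed by `K` does: it halts; or it queries the
oracle and goes on in the state `next`; or it reads all tapes and, depending on the symbols read,
enters a state and on each tape writes a symbol and moves the head (`none`: no move). -/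
inductive OTMInstr (K Q : Type) where
  | halt : OTMInstr K Q
  | query (next : Q) : OTMInstr K Q
  | act (δ : (K → Option Bool) → Q × (K → Option Bool × Option Turing.Dir)) : OTMInstr K Q

/-- A deterministic multi-tape Turing machine with a function oracle. Tape `0` is the input tape,
tape `1` the query tape, tape `2` the output tape; there are `workTapes` further tapes. The tape
alphabet consists of the two letters and the blank `none`. -/
structure OTM where
  workTapes : ℕ
  State : Type
  finite_state : Finite State
  start : State
  instr : State → OTMInstr (Fin (workTapes + 3)) State

/-- The word on a one-sided tape, up to the first blank. -/
def wordOfListBlank (l : Turing.ListBlank (Option Bool)) : Word :=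
  l.liftOn (fun l => (l.takeWhile Option.isSome).reduceOption) (by
    rintro a b ⟨n, rfl⟩
    have h : ∀ l : List (Option Bool),
        (l ++ List.replicate n default).takeWhile Option.isSome = l.takeWhile Option.isSome := by
      intro l
      induction l with
      | nil => cases n <;> simp [List.replicate_succ, default]
      | cons x l ih => cases x <;> simp_all
    simp only [h])

/-- The word that starts at the head and extends to the right up to the first blank. -/
def tapeWord (T : Turing.Tape (Option Bool)) : Word := wordOfListBlank T.right₀

/-- The tape that holds the word `w`, with the head on its first letter. -/
def wordTape (w : Word) : Turing.Tape (Option Bool) := Turing.Tape.mk₁ (w.map some)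

/-- Write a symbol and then move the head. -/
def tapeAct (T : Turing.Tape (Option Bool)) (a : Option Bool × Option Turing.Dir) :
    Turing.Tape (Option Bool) :=
  match a.2 with
  | none => T.write a.1
  | some dir => (T.write a.1).move dir

namespace OTM

/-- A configuration: the state and the tapes with their heads. -/
structure Cfg (M : OTM) where
  state : M.State
  tapes : Fin (M.workTapes + 3) → Turing.Tape (Option Bool)

/-- The initial configuration on input `s`. -/
def startCfg (M : OTM) (s : Word) : M.Cfg where
  state := M.start
  tapes := fun i => if i = 0 then wordTape s else wordTape []

/-- One step with oracle `φ`. A query replaces the word on the query tape by the oracle's answer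
to it in a single step. A halting configuration stays as it is. -/
def step (M : OTM) (φ : StrFun) (c : M.Cfg) : M.Cfg :=
  match M.instr c.state with
  | .halt => c
  | .query next =>
      { state := next
        tapes := Function.update c.tapes 1 (wordTape (φ (tapeWord (c.tapes 1)))) }
  | .act δ =>
      let r := δ fun i => (c.tapes i).head
      { state := r.1
        tapes := fun i => tapeAct (c.tapes i) (r.2 i) }

/-- With oracle `φ` and input `s`, the machine halts within `T` steps with output `w`. -/
def OutputsWithin (M : OTM) (φ : StrFun) (s w : Word) (T : ℕ) : Prop :=
  ∃ n ≤ T, M.instr (((M.step φ)^[n] (M.startCfg s)).state) = OTMInstr.halt ∧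
    tapeWord (((M.step φ)^[n] (M.startCfg s)).tapes 2) = w

end OTM

/-! ### Representations, enrichments, computability, complexity -/

/-- A (second-order) representation of elements of `X`: `δ φ x` says that `φ` is a name of `x`. -/
abbrev SecondOrderRep (X : Type) := StrFun → X → Prop

/-- A representation with advice parameters: `δ φ x k` says that `φ` is a name of `x` and that
the advice words in `φ` have total length `k`. -/
abbrev ParamRep (X : Type) := StrFun → X → ℕ → Prop

/-- A representation, restricted to the elements of a class, without advice parameters. -/
def SecondOrderRep.restrict {X : Type} (δ : SecondOrderRep X) (A : Set X) : ParamRep X :=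
  fun φ x k => x ∈ A ∧ δ φ x ∧ k = 0

/-- The representation `δ` enriched with `E`: names are the `⟨φ₁,φ₂⟩` with `φ₁` a `δ`-name of `x`
and `φ₂` the constant function whose value is a word of `E x`. -/
def ParamRep.enrich {X : Type} (δ : ParamRep X) (E : X → Set Word) : ParamRep X :=
  fun φ x k => ∃ (φ₁ : StrFun) (w : Word) (j : ℕ),
    φ = pairFun φ₁ (fun _ => w) ∧ δ φ₁ x j ∧ w ∈ E x ∧ k = j + w.length

/-- `f` is a multi-valued function. Some oracle machine `M` turns every `δ`-name `φ` of an `x`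
in the domain of `f` into a `δ'`-name `s ↦ M^φ(s)` of an element of `f x`. -/
def IsComputableMV {X Y : Type} (δ : ParamRep X) (δ' : SecondOrderRep Y) (f : X → Set Y) : Prop :=
  ∃ M : OTM, ∀ φ x k, δ φ x k → (f x).Nonempty →
    ∃ y ∈ f x, ∃ ψ : StrFun, δ' ψ y ∧ ∀ s, ∃ T, M.OutputsWithin φ s (ψ s) T

/-- As `IsComputableMV`, with running time at most `τ k * t |s|` on a name with advice words of
total length `k` and on input `s`. -/
def IsComputableInTime {X Y : Type} (δ : ParamRep X) (δ' : SecondOrderRep Y) (f : X → Set Y)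
    (τ t : ℕ → ℕ) : Prop :=
  ∃ M : OTM, ∀ φ x k, δ φ x k → (f x).Nonempty →
    ∃ y ∈ f x, ∃ ψ : StrFun, δ' ψ y ∧ ∀ s, M.OutputsWithin φ s (ψ s) (τ k * t s.length)

/-- Fully polynomial-time computability: `τ` and `t` are polynomials. -/
def IsFullyPolyTime {X Y : Type} (δ : ParamRep X) (δ' : SecondOrderRep Y) (f : X → Set Y) : Prop :=
  ∃ p q : Polynomial ℕ, IsComputableInTime δ δ' f (fun k => p.eval k) (fun n => q.eval n)

/-- Approximate computability in time `τ k * t |s|`: on every input `s` the machine outputs the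
value at `s` of a `δ'`-name of some element of `f x`, which may depend on `s`. -/
def IsApproxComputableInTime {X Y : Type} (δ : ParamRep X) (δ' : SecondOrderRep Y) (f : X → Set Y)
    (τ t : ℕ → ℕ) : Prop :=
  ∃ M : OTM, ∀ φ x k, δ φ x k → (f x).Nonempty →
    ∀ s, ∃ y ∈ f x, ∃ ψ : StrFun, δ' ψ y ∧ M.OutputsWithin φ s (ψ s) (τ k * t s.length)

/-- Approximate computability in fully polynomial time. -/
def IsApproxFullyPolyTime {X Y : Type} (δ : ParamRep X) (δ' : SecondOrderRep Y) (f : X → Set Y) : Prop :=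
  ∃ p q : Polynomial ℕ, IsApproxComputableInTime δ δ' f (fun k => p.eval k) (fun n => q.eval n)

/-! ### Points and subsets of `ℝ^d` -/

/-- Names of points: on a word of length `n` a name returns (a code of) a point `q` with
coordinates in `{a / 2 ^ n | a ∈ ℤ}` that satisfies `|q i - x i| ≤ 2 ^ (-n)` for all `i`. -/
def realRep (d : ℕ) : SecondOrderRep (Fin d → ℝ) :=
  fun ψ x => ∀ s : Word, ∃ c : Fin d → ℤ × ℤ, ψ s = pointCode c ∧
    ∀ i, (∃ a : ℤ, dyadicPoint c i = (a : ℝ) / (2 : ℝ) ^ s.length) ∧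
      |dyadicPoint c i - x i| ≤ 1 / (2 : ℝ) ^ s.length

/-- String functions with values in `{0, 1}`. -/
def IsPredicate (φ : StrFun) : Prop := ∀ s, φ s = [false] ∨ φ s = [true]

/-- The representation of sets by local information, with integer precisions, in the norm `N`:
answer `1` on `⟨q, 0^n⟩` if the open ball `B(q, 2^(-n))` meets `S`, answer `0` if the closed ball
`B(q, 2^(-n+1))` does not meet `S`. -/
def setRep {d : ℕ} (N : Seminorm ℝ (Fin d → ℝ)) : SecondOrderRep (Set (Fin d → ℝ)) :=
  fun φ S => IsPredicate φ ∧ ∀ (c : Fin d → ℤ × ℤ) (n : ℤ),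
    ((N.ball (dyadicPoint c) ((2 : ℝ) ^ (-n)) ∩ S).Nonempty → φ (queryWord c n) = [true]) ∧
    (N.closedBall (dyadicPoint c) ((2 : ℝ) ^ (-n + 1)) ∩ S = ∅ → φ (queryWord c n) = [false])

/-- The weak-membership representation, with integer precisions, in the norm `N`: answer `1` on
`⟨q, 0^n⟩` if the closed ball `B(q, 2^(-n))` is contained in `S`, answer `0` if it does not
meet `S`. -/
def wmemRep {d : ℕ} (N : Seminorm ℝ (Fin d → ℝ)) : SecondOrderRep (Set (Fin d → ℝ)) :=
  fun φ S => IsPredicate φ ∧ ∀ (c : Fin d → ℤ × ℤ) (n : ℤ),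
    (N.closedBall (dyadicPoint c) ((2 : ℝ) ^ (-n)) ⊆ S → φ (queryWord c n) = [true]) ∧
    (N.closedBall (dyadicPoint c) ((2 : ℝ) ^ (-n)) ∩ S = ∅ → φ (queryWord c n) = [false])

/-- Non-empty compact sets. -/
def compactSets (d : ℕ) : Set (Set (Fin d → ℝ)) := {S | S.Nonempty ∧ IsCompact S}

/-- Bounded bodies: non-empty compact sets that are the closure of their interior. -/
def boundedBodies (d : ℕ) : Set (Set (Fin d → ℝ)) :=
  {S | S.Nonempty ∧ IsCompact S ∧ closure (interior S) = S}

/-- Outer radius parameters `b ∈ ℤ`, in unary: `S` lies in the closed ball `B(0, 2^b)`. -/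
def outerRadius {d : ℕ} (N : Seminorm ℝ (Fin d → ℝ)) (S : Set (Fin d → ℝ)) : Set Word :=
  {w | ∃ b : ℤ, w = unaryInt b ∧ S ⊆ N.closedBall 0 ((2 : ℝ) ^ b)}

/-- Inner radius parameters `r ∈ ℤ`, in unary: some closed ball `B(x, 2^(-r))` lies in `S`. -/
def innerRadius {d : ℕ} (N : Seminorm ℝ (Fin d → ℝ)) (S : Set (Fin d → ℝ)) : Set Word :=
  {w | ∃ r : ℤ, w = unaryInt r ∧ ∃ x ∈ interior S, N.closedBall x ((2 : ℝ) ^ (-r)) ⊆ S}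

/-- The multi-valued operator that maps a set to any of its points. -/
def Choice {d : ℕ} (S : Set (Fin d → ℝ)) : Set (Fin d → ℝ) := S

/-- `setRep` on compact sets, enriched with outer radius parameters. -/
def setRepB {d : ℕ} (N : Seminorm ℝ (Fin d → ℝ)) : ParamRep (Set (Fin d → ℝ)) :=
  ((setRep N).restrict (compactSets d)).enrich (outerRadius N)

/-- `wmemRep` on bounded bodies, enriched with inner and outer radius parameters. -/
def wmemRepRB {d : ℕ} (N : Seminorm ℝ (Fin d → ℝ)) : ParamRep (Set (Fin d → ℝ)) :=
  (((wmemRep N).restrict (boundedBodies d)).enrich (innerRadius N)).enrich (outerRadius N)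

/-! ### Stack machines -/

/-! Upper bounds. A path is a word of symbols, each symbol giving every coordinate a signed digit
between `-D` and `D`. With `β` the length of the code of the outer radius parameter, a path of
length `l` denotes a point of the grid of width `w = 2 ^ (β - l)`, and all its extensions stay
within `D * w` of that point. The oracle is asked about the ball of radius `2 ^ e * w` around the
point, in the given norm. Comparison with the sup norm (`exists_pow_two_mul_norm_bound`) fixes `e`
and `D`. The digits are so redundant that an accepted path can be extended towards every point of
the set that its acceptance allows.

The invariant is `NearSet`: some point of `S` lies within `2 * 2 ^ e * w` of the end of the path.
Acceptance implies it. For `setRep`, `NearSet` makes some extension by one symbol accepted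
(`exists_accepts_of_nearSet`), so each digit costs a bounded number of queries and the search is
fully polynomial. For `wmemRep` on a body, the density of interior points only gives an accepted
extension of unknown length (`exists_append_accepts_of_nearSet`), so the search runs through all
extensions in length-lexicographic order and always succeeds, but without a time bound. In both
cases the successive accepted paths depend on the oracle alone and not on the required precision.
They converge to one point, which lies in `S` since `S` is closed, and a long enough path is rounded
to give the output (`exists_OTM_choice`).

For approximations the limit may vary with the input. An extension is padded with enough digits `0`
before it is tested, so that a single acceptance already gives the required precision. A ball of
radius `2 ^ (-r)` inside `S` guarantees an accepted word of length `O(|b| + |r|)`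
(`exists_accepts_padded`), and exponentially many words precede it (`exists_OTM_approxChoice`).

The programs are written for stack machines and composed through `Exec`, which bounds time.
`Frag.exists_OTM` turns them into oracle Turing machines at twice the cost.

Lower bound. Take `2 ^ m` disjoint unit balls, far apart in every coordinate, inside a ball of
radius `2 ^ (m + g)`, with names that answer `1` only when forced to. At every query at most one of
these names differs from the name that always answers `0`. A run of `T` steps against the latter
thus eliminates at most `T` balls (`OTM.exists_ne_iterate_step_eq`). If `T + 2 ≤ 2 ^ m`, two balls
receive the same output, which cannot be close to both. The advice has length linear in `m`, so a
polynomial time bound is eventually below `2 ^ m`. -/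

/-- The registers of a stack machine; each holds a word, used as a stack. -/
inductive Reg where
  | inp | qry | out | pos | neg | aux | wk | len | row | rev | pnt | num | ext | cnt | rem
  | drp | drs | pad | pds
  deriving DecidableEq

instance : Fintype Reg where
  elems := {.inp, .qry, .out, .pos, .neg, .aux, .wk, .len, .row, .rev, .pnt, .num, .ext, .cnt,
    .rem, .drp, .drs, .pad, .pds}
  complete k := by cases k <;> decide

/-- The contents of a stack machine: a word in each register and two stacks of symbols. A symbol
is a tuple of letters indexed by `J`. -/
@[ext]
structure Store (J : Type) where
  reg : Reg → Word
  path : List (J → Bool)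
  tmp : List (J → Bool)

/-- An operation on a stack: possibly pop, then possibly push. -/
abbrev StackOp (α : Type) := Bool × Option α

/-- The effect of an operation on a stack. -/
def runOp {α : Type} (o : StackOp α) (l : List α) : List α :=
  o.2.toList ++ (if o.1 then l.tail else l)

@[simp] lemma runOp_keep {α : Type} (l : List α) : runOp (false, none) l = l := rfl
@[simp] lemma runOp_pop {α : Type} (l : List α) : runOp (true, none) l = l.tail := rfl
@[simp] lemma runOp_push {α : Type} (a : α) (l : List α) : runOp (false, some a) l = a :: l := rfl
@[simp] lemma runOp_repl {α : Type} (a : α) (l : List α) :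
    runOp (true, some a) l = a :: l.tail := rfl

/-- The top letters and symbols of the stacks. -/
@[ext]
structure Tops (J : Type) where
  reg : Reg → Option Bool
  path : Option (J → Bool)
  tmp : Option (J → Bool)

/-- Simultaneous operations on all stacks. -/
structure StackOps (J : Type) where
  reg : Reg → StackOp Bool
  path : StackOp (J → Bool) := (false, none)
  tmp : StackOp (J → Bool) := (false, none)

namespace Store

variable {J : Type}

def tops (σ : Store J) : Tops J where
  reg k := (σ.reg k).head?
  path := σ.path.head?
  tmp := σ.tmp.head?

def apply (σ : Store J) (o : StackOps J) : Store J where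
  reg k := runOp (o.reg k) (σ.reg k)
  path := runOp o.path σ.path
  tmp := runOp o.tmp σ.tmp

/-- Overwrite a register. -/
def set (σ : Store J) (k : Reg) (w : Word) : Store J :=
  { σ with reg := Function.update σ.reg k w }

end Store

/-- An instruction of a stack machine. -/
inductive StackInstr (J Q : Type) where
  | exit : StackInstr J Q
  | query (next : Q) : StackInstr J Q
  | act (f : Tops J → Q × StackOps J) : StackInstr J Q

/-- A stack machine. -/
structure Frag (J : Type) where
  Q : Type
  finite : Finite Q
  start : Q
  instr : Q → StackInstr J Q

namespace Frag

variable {J : Type}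

/-- `F.Runs φ q σ t σ'`: from state `q` and store `σ`, the machine reaches an exit with store `σ'`
after `t` steps. -/
inductive Runs (F : Frag J) (φ : StrFun) : F.Q → Store J → ℕ → Store J → Prop
  | exit {q σ} : F.instr q = .exit → Runs F φ q σ 0 σ
  | query {q q' σ t σ'} : F.instr q = .query q' →
      Runs F φ q' (σ.set .qry (φ (σ.reg .qry))) t σ' → Runs F φ q σ (t + 1) σ'
  | act {q f σ t σ'} : F.instr q = .act f →
      Runs F φ (f σ.tops).1 (σ.apply (f σ.tops).2) t σ' → Runs F φ q σ (t + 1) σ'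

/-- From the start state and store `σ`, the machine exits with store `σ'` within `T` steps. -/
def Exec (F : Frag J) (φ : StrFun) (σ : Store J) (T : ℕ) (σ' : Store J) : Prop :=
  ∃ t ≤ T, F.Runs φ F.start σ t σ'

lemma Exec.mono {F : Frag J} {φ : StrFun} {σ σ' : Store J} {T T' : ℕ} (h : F.Exec φ σ T σ')
    (hT : T ≤ T') : F.Exec φ σ T' σ' := by
  obtain ⟨t, ht, h⟩ := h
  exact ⟨t, ht.trans hT, h⟩

lemma Exec.of_eq {F : Frag J} {φ : StrFun} {σ σ₁ σ' : Store J} {T T' : ℕ} (h : F.Exec φ σ T σ₁)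
    (hσ : σ₁ = σ') (hT : T ≤ T') : F.Exec φ σ T' σ' := hσ ▸ h.mono hT

/-- A finite automaton that reads and operates on the stacks. -/
def auto (V : Type) [Finite V] (v₀ : V) (f : V → Tops J → Option (V × StackOps J)) : Frag J where
  Q := Option V
  finite := inferInstance
  start := some v₀
  instr
    | none => .exit
    | some v => .act fun o =>
        match f v o with
        | none => (none, ⟨fun _ => (false, none), (false, none), (false, none)⟩)
        | some (v', ops) => (some v', ops)

lemma auto_stop {V : Type} [Finite V] {v₀ v : V} {f : V → Tops J → Option (V × StackOps J)}
    {φ : StrFun} {σ : Store J} (h : f v σ.tops = none) :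
    (auto V v₀ f).Runs φ (some v) σ 1 σ := by
  refine Runs.act (f := fun o => match f v o with
        | none => (none, ⟨fun _ => (false, none), (false, none), (false, none)⟩)
        | some (v', ops) => (some v', ops)) rfl ?_
  simp only [h]
  exact Runs.exit rfl

lemma auto_next {V : Type} [Finite V] {v₀ v v' : V} {f : V → Tops J → Option (V × StackOps J)}
    {φ : StrFun} {σ σ₁ σ' : Store J} {o : StackOps J} {t : ℕ} (h : f v σ.tops = some (v', o))
    (hσ : σ.apply o = σ₁) (h' : (auto V v₀ f).Runs φ (some v') σ₁ t σ') :
    (auto V v₀ f).Runs φ (some v) σ (t + 1) σ' := by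
  subst hσ
  refine Runs.act (f := fun o => match f v o with
        | none => (none, ⟨fun _ => (false, none), (false, none), (false, none)⟩)
        | some (v', ops) => (some v', ops)) rfl ?_
  simpa only [h] using h'

lemma Exec.of_auto {V : Type} [Finite V] {v₀ : V} {f : V → Tops J → Option (V × StackOps J)}
    {φ : StrFun} {σ σ' : Store J} {t T : ℕ} (h : (auto V v₀ f).Runs φ (some v₀) σ t σ')
    (hT : t ≤ T) : (auto V v₀ f).Exec φ σ T σ' := ⟨t, hT, h⟩

/-- Operate once on the stacks. -/
def once (f : Tops J → StackOps J) : Frag J where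
  Q := Bool
  finite := inferInstance
  start := false
  instr
    | true => .exit
    | false => .act fun o => (true, f o)

lemma exec_once (f : Tops J → StackOps J) (φ : StrFun) (σ : Store J) :
    (once f).Exec φ σ 1 (σ.apply (f σ.tops)) :=
  ⟨1, le_rfl, Runs.act (f := fun o => (true, f o)) rfl (Runs.exit rfl)⟩

/-- Query the oracle once. -/
def ask : Frag J where
  Q := Bool
  finite := inferInstance
  start := false
  instr
    | true => .exit
    | false => .query true

lemma exec_ask (φ : StrFun) (σ : Store J) :
    (ask (J := J)).Exec φ σ 1 (σ.set .qry (φ (σ.reg .qry))) :=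
  ⟨1, le_rfl, Runs.query rfl (Runs.exit rfl)⟩

def keepAll : StackOps J := ⟨fun _ => (false, none), (false, none), (false, none)⟩

@[simp] lemma apply_keepAll (σ : Store J) : σ.apply keepAll = σ := rfl

/-- Sequential composition. -/
def seq (F G : Frag J) : Frag J where
  Q := F.Q ⊕ G.Q
  finite := by have := F.finite; have := G.finite; infer_instance
  start := Sum.inl F.start
  instr
    | Sum.inl q =>
        match F.instr q with
        | .exit => .act fun _ => (Sum.inr G.start, keepAll)
        | .query q' => .query (Sum.inl q')
        | .act f => .act fun o => (Sum.inl (f o).1, (f o).2)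
    | Sum.inr q =>
        match G.instr q with
        | .exit => .exit
        | .query q' => .query (Sum.inr q')
        | .act f => .act fun o => (Sum.inr (f o).1, (f o).2)

lemma seq_right {F G : Frag J} {φ : StrFun} {q σ t σ'} (h : G.Runs φ q σ t σ') :
    (seq F G).Runs φ (Sum.inr q) σ t σ' := by
  induction h with
  | exit h => exact Runs.exit (by simp [seq, h])
  | query h _ ih => exact Runs.query (by simp only [seq, h]) ih
  | @act q f σ t σ' h _ ih =>
    exact Runs.act (f := fun o => (Sum.inr (f o).1, (f o).2)) (by simp only [seq, h]) ih

lemma seq_left {F G : Frag J} {φ : StrFun} {q σ t σ₁ t' σ'} (h : F.Runs φ q σ t σ₁)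
    (h' : G.Runs φ G.start σ₁ t' σ') : (seq F G).Runs φ (Sum.inl q) σ (t + 1 + t') σ' := by
  induction h with
  | exit h =>
    rw [show 0 + 1 + t' = t' + 1 by ring]
    exact Runs.act (f := fun _ => (Sum.inr G.start, keepAll)) (by simp only [seq, h]) (seq_right h')
  | @query q q' σ t σ' h _ ih =>
    rw [show t + 1 + 1 + t' = t + 1 + t' + 1 by ring]
    exact Runs.query (by simp only [seq, h]) (ih h')
  | @act q f σ t σ' h _ ih =>
    rw [show t + 1 + 1 + t' = t + 1 + t' + 1 by ring]
    exact Runs.act (f := fun o => (Sum.inl (f o).1, (f o).2)) (by simp only [seq, h]) (ih h')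

lemma Exec.seq {F G : Frag J} {φ : StrFun} {σ σ₁ σ' : Store J} {t t' : ℕ} (h : F.Exec φ σ t σ₁)
    (h' : G.Exec φ σ₁ t' σ') : (seq F G).Exec φ σ (t + 1 + t') σ' := by
  obtain ⟨a, ha, h⟩ := h
  obtain ⟨b, hb, h'⟩ := h'
  exact ⟨a + 1 + b, by omega, seq_left h h'⟩

/-- Conditional execution. -/
def cond (c : Tops J → Bool) (F G : Frag J) : Frag J where
  Q := (F.Q ⊕ G.Q) ⊕ Unit
  finite := by have := F.finite; have := G.finite; infer_instance
  start := Sum.inr ()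
  instr
    | Sum.inr _ => .act fun o => (Sum.inl (if c o then Sum.inl F.start else Sum.inr G.start), keepAll)
    | Sum.inl (Sum.inl q) =>
        match F.instr q with
        | .exit => .exit
        | .query q' => .query (Sum.inl (Sum.inl q'))
        | .act f => .act fun o => (Sum.inl (Sum.inl (f o).1), (f o).2)
    | Sum.inl (Sum.inr q) =>
        match G.instr q with
        | .exit => .exit
        | .query q' => .query (Sum.inl (Sum.inr q'))
        | .act f => .act fun o => (Sum.inl (Sum.inr (f o).1), (f o).2)

lemma cond_left {c : Tops J → Bool} {F G : Frag J} {φ : StrFun} {q σ t σ'}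
    (h : F.Runs φ q σ t σ') : (cond c F G).Runs φ (Sum.inl (Sum.inl q)) σ t σ' := by
  induction h with
  | exit h => exact Runs.exit (by simp [cond, h])
  | query h _ ih => exact Runs.query (by simp only [cond, h]) ih
  | @act q f σ t σ' h _ ih =>
    exact Runs.act (f := fun o => (Sum.inl (Sum.inl (f o).1), (f o).2)) (by simp only [cond, h]) ih

lemma cond_right {c : Tops J → Bool} {F G : Frag J} {φ : StrFun} {q σ t σ'}
    (h : G.Runs φ q σ t σ') : (cond c F G).Runs φ (Sum.inl (Sum.inr q)) σ t σ' := by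
  induction h with
  | exit h => exact Runs.exit (by simp [cond, h])
  | query h _ ih => exact Runs.query (by simp only [cond, h]) ih
  | @act q f σ t σ' h _ ih =>
    exact Runs.act (f := fun o => (Sum.inl (Sum.inr (f o).1), (f o).2)) (by simp only [cond, h]) ih

lemma Exec.cond_true {c : Tops J → Bool} {F G : Frag J} {φ : StrFun} {σ σ' : Store J} {t : ℕ}
    (hc : c σ.tops = true) (h : F.Exec φ σ t σ') : (cond c F G).Exec φ σ (t + 1) σ' := by
  obtain ⟨a, ha, h⟩ := h
  refine ⟨a + 1, by omega, Runs.act (f := fun o =>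
    (Sum.inl (if c o then Sum.inl F.start else Sum.inr G.start), keepAll)) rfl ?_⟩
  simpa [hc] using cond_left h

lemma Exec.cond_false {c : Tops J → Bool} {F G : Frag J} {φ : StrFun} {σ σ' : Store J} {t : ℕ}
    (hc : c σ.tops = false) (h : G.Exec φ σ t σ') : (cond c F G).Exec φ σ (t + 1) σ' := by
  obtain ⟨a, ha, h⟩ := h
  refine ⟨a + 1, by omega, Runs.act (f := fun o =>
    (Sum.inl (if c o then Sum.inl F.start else Sum.inr G.start), keepAll)) rfl ?_⟩
  simpa [hc] using cond_right h

/-- Repetition as long as the tops of the stacks satisfy a condition. -/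
def loop (c : Tops J → Bool) (F : Frag J) : Frag J where
  Q := F.Q ⊕ Bool
  finite := by have := F.finite; infer_instance
  start := Sum.inr true
  instr
    | Sum.inr true => .act fun o => (if c o then Sum.inl F.start else Sum.inr false, keepAll)
    | Sum.inr false => .exit
    | Sum.inl q =>
        match F.instr q with
        | .exit => .act fun _ => (Sum.inr true, keepAll)
        | .query q' => .query (Sum.inl q')
        | .act f => .act fun o => (Sum.inl (f o).1, (f o).2)

lemma loop_body {c : Tops J → Bool} {F : Frag J} {φ : StrFun} {q σ t σ₁ t' σ'}
    (h : F.Runs φ q σ t σ₁) (h' : (loop c F).Runs φ (loop c F).start σ₁ t' σ') :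
    (loop c F).Runs φ (Sum.inl q) σ (t + 1 + t') σ' := by
  induction h with
  | exit h =>
    rw [show 0 + 1 + t' = t' + 1 by ring]
    exact Runs.act (f := fun _ => (Sum.inr true, keepAll)) (by simp only [loop, h]) h'
  | @query q q' σ t σ' h _ ih =>
    rw [show t + 1 + 1 + t' = t + 1 + t' + 1 by ring]
    exact Runs.query (by simp only [loop, h]) (ih h')
  | @act q f σ t σ' h _ ih =>
    rw [show t + 1 + 1 + t' = t + 1 + t' + 1 by ring]
    exact Runs.act (f := fun o => (Sum.inl (f o).1, (f o).2)) (by simp only [loop, h]) (ih h')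

lemma exec_loop_stop {c : Tops J → Bool} {F : Frag J} {φ : StrFun} {σ : Store J}
    (hc : c σ.tops = false) : (loop c F).Exec φ σ 1 σ := by
  refine ⟨1, le_rfl, Runs.act (f := fun o =>
    (if c o then Sum.inl F.start else Sum.inr false, keepAll)) rfl ?_⟩
  simpa [hc] using Runs.exit rfl

/-- The `2` pays for the test of the condition and for the jump from an exit of the body back to
that test. -/
lemma Exec.loop_next {c : Tops J → Bool} {F : Frag J} {φ : StrFun} {σ σ₁ σ' : Store J} {t t' : ℕ}
    (hc : c σ.tops = true) (h : F.Exec φ σ t σ₁) (h' : (loop c F).Exec φ σ₁ t' σ') :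
    (loop c F).Exec φ σ (t + 2 + t') σ' := by
  obtain ⟨a, ha, h⟩ := h
  obtain ⟨b, hb, h'⟩ := h'
  refine ⟨a + 1 + b + 1, by omega, Runs.act (f := fun o =>
    (if c o then Sum.inl F.start else Sum.inr false, keepAll)) rfl ?_⟩
  simpa [hc] using loop_body h h'

/-! ### Simulation of stack machines by oracle machines -/

/-- The tapes: one for each register and one for each component of the two symbol stacks. -/
abbrev TapeIx (J : Type) := Reg ⊕ J ⊕ J

/-- The word on a tape. -/
def tapeContent (σ : Store J) : TapeIx J → Word
  | Sum.inl k => σ.reg k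
  | Sum.inr (Sum.inl j) => σ.path.map (· j)
  | Sum.inr (Sum.inr j) => σ.tmp.map (· j)

open Classical in
/-- The top symbol, from its components. -/
noncomputable def topOfHeads (h : J → Option Bool) : Option (J → Bool) :=
  if ∃ j, h j ≠ none then some fun j => (h j).getD false else none

noncomputable def topsOfHeads (h : TapeIx J → Option Bool) : Tops J where
  reg k := h (Sum.inl k)
  path := topOfHeads fun j => h (Sum.inr (Sum.inl j))
  tmp := topOfHeads fun j => h (Sum.inr (Sum.inr j))

/-- The operation on each tape. -/
def tapeOp (o : StackOps J) : TapeIx J → StackOp Bool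
  | Sum.inl k => o.reg k
  | Sum.inr (Sum.inl j) => (o.path.1, o.path.2.map (· j))
  | Sum.inr (Sum.inr j) => (o.tmp.1, o.tmp.2.map (· j))

/-- All component tapes of a symbol stack carry words of the same length, so the stack is empty
exactly when they show a blank. Without any component, an empty stack could not be recognized. -/
lemma topOfHeads_map [Nonempty J] (l : List (J → Bool)) :
    topOfHeads (fun j => (l.map (· j)).head?) = l.head? := by
  obtain ⟨j⟩ := ‹Nonempty J›
  cases l with
  | nil => simp [topOfHeads]
  | cons a l => simp [topOfHeads]

lemma topsOfHeads_content [Nonempty J] (σ : Store J) :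
    topsOfHeads (fun i => (tapeContent σ i).head?) = σ.tops := by
  ext1
  · rfl
  · exact topOfHeads_map σ.path
  · exact topOfHeads_map σ.tmp

lemma tapeContent_apply (σ : Store J) (o : StackOps J) (i : TapeIx J) :
    tapeContent (σ.apply o) i = runOp (tapeOp o i) (tapeContent σ i) := by
  have key : ∀ (o : StackOp (J → Bool)) (l : List (J → Bool)) (j : J),
      (runOp o l).map (· j) = runOp (o.1, o.2.map (· j)) (l.map (· j)) := by
    rintro ⟨_ | _, _ | a⟩ l j <;> simp [runOp]
  rcases i with k | j | j
  · rfl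
  · exact key _ _ _
  · exact key _ _ _

/-- The first of the two steps that carry out an operation on a tape. -/
def firstAct (h : Option Bool) : StackOp Bool → Option Bool × Option Turing.Dir
  | (false, none) => (h, none)
  | (true, none) => (none, some .right)
  | (false, some _) => (h, some .left)
  | (true, some a) => (some a, none)

/-- The second of the two steps that carry out an operation on a tape. -/
def secondAct (h : Option Bool) : StackOp Bool → Option Bool × Option Turing.Dir
  | (false, some a) => (some a, none)
  | _ => (h, none)

lemma head_wordTape (w : Word) : (wordTape w).head = w.head? := by
  cases w <;> rfl

lemma tapeWord_wordTape (w : Word) : tapeWord (wordTape w) = w := by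
  have h : wordOfListBlank (Turing.ListBlank.mk (w.map some)) = w := by
    show ((w.map some).takeWhile Option.isSome).reduceOption = w
    induction w with
    | nil => rfl
    | cons a w ih => simpa [List.reduceOption] using ih
  rw [tapeWord, wordTape, Turing.Tape.mk₁, Turing.Tape.mk₂, Turing.Tape.mk'_right₀]
  exact h

lemma mk_nil_eq : Turing.ListBlank.mk ([] : List (Option Bool)) =
    (Turing.ListBlank.mk []).cons none := by
  rw [Turing.ListBlank.cons_mk]
  exact Quotient.sound' (Or.inl ⟨1, rfl⟩)

lemma wordTape_eq (w : Word) : wordTape w =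
    Turing.Tape.mk' (Turing.ListBlank.mk []) (Turing.ListBlank.mk (w.map some)) := rfl

lemma wordTape_write_right (w : Word) :
    ((wordTape w).write none).move .right = wordTape w.tail := by
  cases w with
  | nil =>
    rw [wordTape_eq, List.tail_nil, wordTape_eq, List.map_nil]
    conv_lhs => rw [show Turing.Tape.mk' (Turing.ListBlank.mk ([] : List (Option Bool)))
      (Turing.ListBlank.mk []) = Turing.Tape.mk' (Turing.ListBlank.mk [])
        ((Turing.ListBlank.mk []).cons none) by rw [← mk_nil_eq]]
    rw [Turing.Tape.write_mk', Turing.Tape.move_right_mk', Turing.ListBlank.head_cons,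
      Turing.ListBlank.tail_cons, Turing.ListBlank.tail_cons, ← mk_nil_eq]
  | cons b w =>
    rw [wordTape_eq, List.tail_cons, wordTape_eq, List.map_cons, ← Turing.ListBlank.cons_mk,
      Turing.Tape.write_mk', Turing.Tape.move_right_mk', Turing.ListBlank.head_cons,
      Turing.ListBlank.tail_cons, Turing.ListBlank.tail_cons, ← mk_nil_eq]

lemma wordTape_write (w : Word) (a : Bool) :
    (wordTape w).write (some a) = wordTape (a :: w.tail) := by
  cases w with
  | nil =>
    rw [wordTape_eq, List.tail_nil, wordTape_eq, List.map_nil]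
    conv_lhs => rw [show Turing.Tape.mk' (Turing.ListBlank.mk ([] : List (Option Bool)))
      (Turing.ListBlank.mk []) = Turing.Tape.mk' (Turing.ListBlank.mk [])
        ((Turing.ListBlank.mk []).cons none) by rw [← mk_nil_eq]]
    rw [Turing.Tape.write_mk', Turing.ListBlank.tail_cons]
    rfl
  | cons b w =>
    rw [wordTape_eq, List.tail_cons, wordTape_eq, List.map_cons, ← Turing.ListBlank.cons_mk,
      Turing.Tape.write_mk', Turing.ListBlank.tail_cons]
    rfl

/-- The head stands on the top of the stack and everything to its left is blank. A pop blanks the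
cell before moving right, which keeps this true. A push has to move left before it writes, but a
machine writes before it moves; hence two steps for every operation. -/
lemma wordTape_op (o : StackOp Bool) (w : Word) :
    tapeAct (tapeAct (wordTape w) (firstAct (wordTape w).head o))
      (secondAct (tapeAct (wordTape w) (firstAct (wordTape w).head o)).head o) =
    wordTape (runOp o w) := by
  rcases o with ⟨_ | _, _ | a⟩
  · simp [tapeAct, firstAct, secondAct]
  · simp only [tapeAct, firstAct, secondAct, Turing.Tape.write_self, runOp_push]
    rw [wordTape_eq, wordTape_eq, Turing.Tape.move_left_mk', Turing.Tape.write_mk']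
    simp [Turing.ListBlank.cons_mk]
  · simp only [tapeAct, firstAct, secondAct, Turing.Tape.write_self, runOp_pop]
    exact wordTape_write_right w
  · simp only [tapeAct, firstAct, secondAct, Turing.Tape.write_self, runOp_repl]
    exact wordTape_write w a

/-- The oracle machine that simulates a stack machine; its tapes are indexed through `τ`. -/
noncomputable def toOTM [Finite J] (F : Frag J) (w : ℕ) (τ : Fin (w + 3) ≃ TapeIx J) : OTM where
  workTapes := w
  State := F.Q ⊕ (F.Q × (Fin (w + 3) → StackOp Bool))
  finite_state := by have := F.finite; infer_instance
  start := Sum.inl F.start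
  instr
    | Sum.inl q =>
        match F.instr q with
        | .exit => .halt
        | .query q' => .query (Sum.inl q')
        | .act f => .act fun h =>
            let r := f (topsOfHeads fun i => h (τ.symm i))
            (Sum.inr (r.1, fun i => tapeOp r.2 (τ i)), fun i => firstAct (h i) (tapeOp r.2 (τ i)))
    | Sum.inr (q, o) => .act fun h => (Sum.inl q, fun i => secondAct (h i) (o i))

/-- The configuration that represents a state and a store. -/
noncomputable def toCfg [Finite J] (F : Frag J) (w : ℕ) (τ : Fin (w + 3) ≃ TapeIx J) (q : F.Q)
    (σ : Store J) : (F.toOTM w τ).Cfg where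
  state := Sum.inl q
  tapes i := wordTape (tapeContent σ (τ i))

lemma toOTM_act [Finite J] [Nonempty J] (F : Frag J) (w : ℕ) (τ : Fin (w + 3) ≃ TapeIx J)
    (φ : StrFun) {q : F.Q} {f} (h : F.instr q = .act f) (σ : Store J) :
    ((F.toOTM w τ).step φ)^[2] (F.toCfg w τ q σ) =
      F.toCfg w τ (f σ.tops).1 (σ.apply (f σ.tops).2) := by
  have e1 : (F.toOTM w τ).step φ (F.toCfg w τ q σ) =
      { state := Sum.inr ((f σ.tops).1, fun i => tapeOp (f σ.tops).2 (τ i))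
        tapes := fun i => tapeAct (wordTape (tapeContent σ (τ i)))
          (firstAct (wordTape (tapeContent σ (τ i))).head (tapeOp (f σ.tops).2 (τ i))) } := by
    have ht : topsOfHeads (fun i => (wordTape (tapeContent σ (τ (τ.symm i)))).head) = σ.tops := by
      simp only [Equiv.apply_symm_apply, head_wordTape]
      exact topsOfHeads_content σ
    have hi : (F.toOTM w τ).instr (F.toCfg w τ q σ).state = .act fun h =>
            let r := f (topsOfHeads fun i => h (τ.symm i))
            (Sum.inr (r.1, fun i => tapeOp r.2 (τ i)),
              fun i => firstAct (h i) (tapeOp r.2 (τ i))) := by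
      simp only [toOTM, toCfg, h]
    simp only [OTM.step, hi]
    simp only [toCfg, ht]
  rw [Function.iterate_succ_apply, Function.iterate_one, e1]
  simp only [OTM.step, toCfg]
  simp only [toOTM, wordTape_op, tapeContent_apply]

lemma toOTM_query [Finite J] (F : Frag J) (w : ℕ) (τ : Fin (w + 3) ≃ TapeIx J)
    (h1 : τ 1 = Sum.inl .qry) (φ : StrFun) {q q' : F.Q} (h : F.instr q = .query q') (σ : Store J) :
    (F.toOTM w τ).step φ (F.toCfg w τ q σ) =
      F.toCfg w τ q' (σ.set .qry (φ (σ.reg .qry))) := by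
  have hi : (F.toOTM w τ).instr (F.toCfg w τ q σ).state = .query (Sum.inl q') := by
    simp only [toOTM, toCfg, h]
  simp only [OTM.step, hi]
  simp only [toCfg]
  congr 1
  funext i
  by_cases hi1 : i = 1
  · subst hi1
    refine (Function.update_self _ _ _).trans ?_
    show wordTape (φ (tapeWord (wordTape (tapeContent σ (τ (1 : Fin (w + 3))))))) =
      wordTape (tapeContent _ (τ (1 : Fin (w + 3))))
    rw [h1]
    simp [tapeContent, Store.set, tapeWord_wordTape]
  · rw [Function.update_of_ne hi1]
    have hne : τ i ≠ Sum.inl .qry := fun hc => hi1 (τ.injective (hc.trans h1.symm))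
    congr 1
    rcases hτ : τ i with k | j | j
    · have : k ≠ .qry := by rintro rfl; exact hne hτ
      simp [tapeContent, Store.set, this]
    · rfl
    · rfl

lemma toOTM_runs [Finite J] [Nonempty J] (F : Frag J) (w : ℕ) (τ : Fin (w + 3) ≃ TapeIx J)
    (h1 : τ 1 = Sum.inl .qry) (φ : StrFun) {q σ t σ'} (h : F.Runs φ q σ t σ') :
    ∃ n ≤ 2 * t, ∃ q', F.instr q' = .exit ∧
      ((F.toOTM w τ).step φ)^[n] (F.toCfg w τ q σ) = F.toCfg w τ q' σ' := by
  induction h with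
  | exit h => exact ⟨0, le_rfl, _, h, rfl⟩
  | query h _ ih =>
    obtain ⟨n, hn, q', hq', e⟩ := ih
    refine ⟨n + 1, by omega, q', hq', ?_⟩
    rw [Function.iterate_succ_apply, toOTM_query F w τ h1 φ h, e]
  | act h _ ih =>
    obtain ⟨n, hn, q', hq', e⟩ := ih
    refine ⟨n + 2, by omega, q', hq', ?_⟩
    rw [Function.iterate_add_apply, toOTM_act F w τ φ h, e]

/-- The store that holds only an input word. -/
def inputStore (s : Word) : Store J := ⟨fun k => if k = .inp then s else [], [], []⟩

/-- An arbitrary bijection is corrected by three transpositions. Each of them moves only values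
other than those already put in place. -/
lemma exists_tapes (J : Type) [Finite J] : ∃ (w : ℕ) (τ : Fin (w + 3) ≃ TapeIx J),
    τ 0 = Sum.inl .inp ∧ τ 1 = Sum.inl .qry ∧ τ 2 = Sum.inl .out := by
  have := Fintype.ofFinite J
  have hc : 3 ≤ Fintype.card (TapeIx J) := by
    have : Fintype.card Reg = 19 := rfl
    rw [Fintype.card_sum]
    omega
  obtain ⟨w, hw⟩ := Nat.exists_eq_add_of_le' hc
  classical
  let τ₀ : Fin (w + 3) ≃ TapeIx J := (finCongr hw.symm).trans (Fintype.equivFin _).symm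
  let τ₁ := τ₀.trans (Equiv.swap (τ₀ 0) (Sum.inl .inp))
  have a₁ : τ₁ 0 = Sum.inl .inp := by simp [τ₁]
  let τ₂ := τ₁.trans (Equiv.swap (τ₁ 1) (Sum.inl .qry))
  have a₂ : τ₂ 1 = Sum.inl .qry := by simp [τ₂]
  have b₂ : τ₂ 0 = Sum.inl .inp := by
    show Equiv.swap (τ₁ 1) (Sum.inl .qry) (τ₁ 0) = _
    rw [Equiv.swap_apply_of_ne_of_ne, a₁]
    · exact τ₁.injective.ne (by simp)
    · rw [a₁]; simp
  let τ₃ := τ₂.trans (Equiv.swap (τ₂ 2) (Sum.inl .out))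
  refine ⟨w, τ₃, ?_, ?_, by simp [τ₃]⟩
  · show Equiv.swap (τ₂ 2) (Sum.inl .out) (τ₂ 0) = _
    rw [Equiv.swap_apply_of_ne_of_ne, b₂]
    · exact τ₂.injective.ne (by simp [Fin.ext_iff, Nat.mod_eq_of_lt])
    · rw [b₂]; simp
  · show Equiv.swap (τ₂ 2) (Sum.inl .out) (τ₂ 1) = _
    rw [Equiv.swap_apply_of_ne_of_ne, a₂]
    · exact τ₂.injective.ne (by simp [Fin.ext_iff, Nat.mod_eq_of_lt])
    · rw [a₂]; simp

/-- Every stack machine is simulated by an oracle machine in twice the time. -/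
theorem exists_OTM [Finite J] [Nonempty J] (F : Frag J) : ∃ M : OTM, ∀ φ s T σ',
    F.Exec φ (inputStore s) T σ' → M.OutputsWithin φ s (σ'.reg .out) (2 * T) := by
  obtain ⟨w, τ, h0, h1, h2⟩ := exists_tapes J
  refine ⟨F.toOTM w τ, fun φ s T σ' ⟨t, ht, h⟩ => ?_⟩
  obtain ⟨n, hn, q', hq', e⟩ := toOTM_runs F w τ h1 φ h
  have hs : (F.toOTM w τ).startCfg s = F.toCfg w τ F.start (inputStore s) := by
    have ht : ∀ i : Fin (w + 3), (if i = 0 then wordTape s else wordTape []) =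
        wordTape (tapeContent (inputStore s : Store J) (τ i)) := by
      intro i
      by_cases hi : i = 0
      · subst hi
        rw [if_pos rfl, h0]
        rfl
      · rw [if_neg hi]
        have hne : τ i ≠ Sum.inl .inp := fun hc => hi (τ.injective (hc.trans h0.symm))
        congr 1
        rcases hτ : τ i with k | j | j
        · have : k ≠ .inp := by rintro rfl; exact hne hτ
          simp [tapeContent, inputStore, this]
        · rfl
        · rfl
    simp only [OTM.startCfg, toCfg]
    congr 1
    funext i
    exact ht i
  refine ⟨n, hn.trans (by omega), ?_, ?_⟩
  · rw [hs, e]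
    simp only [toOTM, toCfg, hq']
  · rw [hs, e]
    show tapeWord (wordTape (tapeContent σ' (τ 2))) = _
    rw [h2, tapeWord_wordTape]
    rfl

end Frag

/-! ### Codes of integers -/

/-- The word of `n` zeros. -/
def zeros (n : ℕ) : Word := List.replicate n false

@[simp] lemma length_zeros (n : ℕ) : (zeros n).length = n := List.length_replicate

@[simp] lemma zeros_zero : zeros 0 = [] := rfl

lemma zeros_succ (n : ℕ) : zeros (n + 1) = false :: zeros n := rfl

@[simp] lemma zeros_append (m n : ℕ) : zeros m ++ zeros n = zeros (m + n) := by
  simp [zeros]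

@[simp] lemma reverse_zeros (n : ℕ) : (zeros n).reverse = zeros n := by simp [zeros]

lemma zeros_append_cons (n : ℕ) (w : Word) : zeros n ++ false :: w = zeros (n + 1) ++ w := by
  rw [show false :: w = zeros 1 ++ w from rfl, ← List.append_assoc, zeros_append]

lemma intEquivNat_natCast (n : ℕ) : Equiv.intEquivNat (n : ℤ) = 2 * n := rfl

lemma intEquivNat_negSucc (n : ℕ) : Equiv.intEquivNat (Int.negSucc n) = 2 * n + 1 := rfl

/-- For either sign one of the two summands vanishes, thanks to truncated subtraction. This form
matches the two registers that hold the positive and the negative part of an integer. -/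
lemma unaryInt_eq (n : ℤ) : unaryInt n = zeros (2 * n.toNat + (2 * (-n).toNat - 1)) := by
  rcases n with n | n
  · simp [unaryInt, zeros, intEquivNat_natCast]
  · simp only [unaryInt, zeros, intEquivNat_negSucc]
    congr 1
    rw [Int.neg_negSucc, Int.negSucc_eq]
    omega

lemma length_unaryInt_le (n : ℤ) : (unaryInt n).length ≤ 2 * n.natAbs := by
  rw [unaryInt_eq, length_zeros]
  omega

lemma le_length_unaryInt (n : ℤ) : n ≤ (unaryInt n).length := by
  rw [unaryInt_eq, length_zeros]
  omega

/-- The magnitude in the code of an integer. -/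
def magnitude : ℤ → ℕ
  | .ofNat n => n
  | .negSucc n => n

/-- `Equiv.intEquivNat` doubles the magnitude and adds the sign as the lowest bit. Only zero has
neither a sign letter nor bits. -/
lemma binaryInt_eq (z : ℤ) : binaryInt z =
    (if z < 0 ∨ (magnitude z).bits ≠ [] then [decide (z < 0)] else []) ++ (magnitude z).bits := by
  rcases z with n | n
  · rcases Nat.eq_zero_or_pos n with rfl | hn
    · simp only [binaryInt, magnitude, Int.ofNat_eq_natCast, intEquivNat_natCast]
      simp
    · have h1 : binaryInt (Int.ofNat n) = false :: n.bits := Nat.bit0_bits n hn.ne'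
      have h2 : n.bits ≠ [] := by
        intro h
        have := congrArg List.length h
        rw [Nat.size_eq_bits_len, List.length_nil, Nat.size_eq_zero] at this
        omega
      have h3 : ¬ (Int.ofNat n < 0) := by simp
      simp only [h1, magnitude, h2, ne_eq, not_false_eq_true, or_true, if_true, h3, decide_false]
      rfl
  · have h1 : binaryInt (Int.negSucc n) = true :: n.bits := Nat.bit1_bits n
    have h3 : Int.negSucc n < 0 := Int.negSucc_lt_zero n
    simp only [h1, magnitude, h3, true_or, if_true, decide_true]
    rfl

/-- The magnitude of a negative number is its bitwise complement, so the bits of the magnitude are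
the letters of the two's complement, each combined with the sign by exclusive or. -/
lemma magnitude_bit (z : ℤ) (b : Bool) :
    magnitude (2 * z + b.toNat) = Nat.bit (b ^^ decide (z < 0)) (magnitude z) := by
  rcases z with n | n
  · have h3 : ¬ (Int.ofNat n < 0) := by simp
    simp only [h3, decide_false, Bool.xor_false, magnitude, Nat.bit_val]
    rw [show (2 * Int.ofNat n + (b.toNat : ℤ)) = Int.ofNat (2 * n + b.toNat) by simp]
  · have h3 : Int.negSucc n < 0 := Int.negSucc_lt_zero n
    simp only [h3, decide_true, Bool.xor_true, magnitude, Nat.bit_val]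
    rw [show (2 * Int.negSucc n + (b.toNat : ℤ)) = Int.negSucc (2 * n + (!b).toNat) by
      rw [Int.negSucc_eq, Int.negSucc_eq]; cases b <;> simp <;> ring]

lemma neg_bit (z : ℤ) (b : Bool) : 2 * z + b.toNat < 0 ↔ z < 0 := by
  cases b <;> simp only [Bool.toNat_false, Bool.toNat_true] <;> omega

/-- `l` is the code of `z` in two's complement, most significant letter first. -/
inductive TwosComplement : Word → ℤ → Prop
  | sign (s : Bool) : TwosComplement [s] (if s then -1 else 0)
  | snoc {l : Word} {z : ℤ} (b : Bool) :
      TwosComplement l z → TwosComplement (l ++ [b]) (2 * z + b.toNat)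

/-! ### Points with coordinates given by signed digits -/

/-- The number of letters `1` of a symbol in row `i`. -/
def rowSum {d D : ℕ} (i : Fin d) (γ : Fin d × Fin (2 * D) → Bool) : ℕ :=
  ∑ j, (γ (i, j)).toNat

lemma rowSum_le {d D : ℕ} (i : Fin d) (γ : Fin d × Fin (2 * D) → Bool) : rowSum i γ ≤ 2 * D := by
  refine (Finset.sum_le_card_nsmul _ _ 1 fun j _ => Bool.toNat_le _).trans ?_
  simp

/-- The integer with the signed digits in row `i` of the symbols, the last digit first. -/
def digitSum {d D : ℕ} (i : Fin d) : List (Fin d × Fin (2 * D) → Bool) → ℤ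
  | [] => 0
  | γ :: p => 2 * digitSum i p + (rowSum i γ - D)

namespace Store

variable {J : Type}

@[simp] lemma set_reg (σ : Store J) (k k' : Reg) (w : Word) :
    (σ.set k w).reg k' = if k' = k then w else σ.reg k' := by
  simp [set, Function.update_apply]

@[simp] lemma set_path (σ : Store J) (k : Reg) (w : Word) : (σ.set k w).path = σ.path := rfl

@[simp] lemma set_tmp (σ : Store J) (k : Reg) (w : Word) : (σ.set k w).tmp = σ.tmp := rfl

/-- Overwrite the symbol stacks. -/
def setPaths (σ : Store J) (p t : List (J → Bool)) : Store J := { σ with path := p, tmp := t }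

@[simp] lemma setPaths_reg (σ : Store J) (p t : List (J → Bool)) (k : Reg) :
    (σ.setPaths p t).reg k = σ.reg k := rfl

@[simp] lemma setPaths_path (σ : Store J) (p t : List (J → Bool)) :
    (σ.setPaths p t).path = p := rfl

@[simp] lemma setPaths_tmp (σ : Store J) (p t : List (J → Bool)) : (σ.setPaths p t).tmp = t := rfl

@[simp] lemma apply_reg (σ : Store J) (o : StackOps J) (k : Reg) :
    (σ.apply o).reg k = runOp (o.reg k) (σ.reg k) := rfl

@[simp] lemma apply_path (σ : Store J) (o : StackOps J) :
    (σ.apply o).path = runOp o.path σ.path := rfl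

@[simp] lemma apply_tmp (σ : Store J) (o : StackOps J) :
    (σ.apply o).tmp = runOp o.tmp σ.tmp := rfl

@[simp] lemma tops_reg (σ : Store J) (k : Reg) : σ.tops.reg k = (σ.reg k).head? := rfl

@[simp] lemma tops_path (σ : Store J) : σ.tops.path = σ.path.head? := rfl

@[simp] lemma tops_tmp (σ : Store J) : σ.tops.tmp = σ.tmp.head? := rfl

end Store

namespace Frag

variable {J : Type}

/-! ### Basic programs -/

/-- Move a word letter by letter to other registers; `f k` tells how the letters are translated
on their way to the register `k`. -/
def mv (a : Reg) (f : Reg → Option (Bool → Bool)) : Frag J :=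
  auto Unit () fun _ o => (o.reg a).map fun b =>
    ((), { reg := fun k => if k = a then (true, none) else (false, (f k).map fun g => g b) })

/-- The effect of `mv`. -/
def mvStore (a : Reg) (f : Reg → Option (Bool → Bool)) (σ : Store J) : Store J :=
  { σ with reg := fun k => if k = a then [] else
      (f k).elim (σ.reg k) fun g => (σ.reg a).reverse.map g ++ σ.reg k }

lemma exec_mv (a : Reg) (f : Reg → Option (Bool → Bool)) (φ : StrFun) (σ : Store J) :
    (mv a f).Exec φ σ ((σ.reg a).length + 1) (mvStore a f σ) := by
  refine Exec.of_auto ?_ le_rfl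
  generalize hw : σ.reg a = w
  induction w generalizing σ with
  | nil =>
    have : mvStore a f σ = σ := by
      ext1
      · funext k
        by_cases hk : k = a
        · subst hk; simp [mvStore, hw]
        · cases h : f k <;> simp [mvStore, hk, hw, h]
      · rfl
      · rfl
    rw [this]
    exact auto_stop (by simp [hw])
  | cons b w ih =>
    refine auto_next (v' := ()) (o := { reg := fun k => if k = a then (true, none) else
      (false, (f k).map fun g => g b) }) (by simp [hw]) rfl ?_
    set τ := σ.apply { reg := fun k => if k = a then (true, none) else
      (false, (f k).map fun g => g b) } with hτ
    have hτa : τ.reg a = w := by simp [hτ, hw]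
    have : mvStore a f σ = mvStore a f τ := by
      ext1
      · funext k
        by_cases hk : k = a
        · subst hk; simp [mvStore]
        · cases h : f k <;> simp [mvStore, hk, hw, h, hτa] <;> simp [hτ, hk, h]
      · rfl
      · rfl
    rw [this]
    exact ih τ hτa

/-- Send letters unchanged to `b`. -/
def toReg (b : Reg) : Reg → Option (Bool → Bool) := fun k => if k = b then some id else none

/-- Send zeros to the registers in a list. -/
def zerosTo (l : List Reg) : Reg → Option (Bool → Bool) :=
  fun k => if k ∈ l then some fun _ => false else none

/-- Push a letter. -/
def pushLetter (a : Reg) (b : Bool) : Frag J :=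
  once fun _ => { reg := fun k => if k = a then (false, some b) else (false, none) }

lemma exec_pushLetter (a : Reg) (b : Bool) (φ : StrFun) (σ : Store J) :
    (pushLetter a b).Exec φ σ 1 (σ.set a (b :: σ.reg a)) := by
  refine (exec_once _ φ σ).of_eq ?_ le_rfl
  ext1
  · funext k
    by_cases hk : k = a
    · subst hk; simp
    · simp [hk]
  · rfl
  · rfl

/-- Do nothing. -/
def skip : Frag J := once fun _ => keepAll

lemma exec_skip (φ : StrFun) (σ : Store J) : (skip (J := J)).Exec φ σ 1 σ :=
  exec_once (fun _ => keepAll) φ σ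

/-! ### The level -/

/-- The registers `pos` and `neg` hold the integer `n`. -/
def HasLevel (σ : Store J) (n : ℤ) : Prop :=
  σ.reg .pos = zeros n.toNat ∧ σ.reg .neg = zeros (-n).toNat

/-- Write the unary code of the level into `row`. -/
def emitLevel : Frag J :=
  (((mv .pos (zerosTo [.aux, .row])).seq (mv .aux (zerosTo [.pos, .row]))).seq
    ((mv .neg (zerosTo [.aux, .row])).seq (mv .aux (zerosTo [.neg, .row])))).seq
    (once fun o => { reg := fun k =>
      if k = .row ∧ (o.reg .neg).isSome then (true, none) else (false, none) })

/-- Moving a register to `aux` and back writes each of its letters to `row` twice and restores it. A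
negative level then loses one letter, as in `unaryInt_eq`. -/
lemma exec_emitLevel (φ : StrFun) {σ : Store J} {n : ℤ} (hn : HasLevel σ n)
    (haux : σ.reg .aux = []) (hrow : σ.reg .row = []) :
    (emitLevel (J := J)).Exec φ σ (2 * n.natAbs + 9) (σ.set .row (unaryInt n)) := by
  obtain ⟨hp, hq⟩ := hn
  refine (((((exec_mv .pos (zerosTo [.aux, .row]) φ σ).seq
    (exec_mv .aux (zerosTo [.pos, .row]) φ _)).seq
    ((exec_mv .neg (zerosTo [.aux, .row]) φ _).seq
    (exec_mv .aux (zerosTo [.neg, .row]) φ _))).seq (exec_once _ φ _))).of_eq ?_ ?_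
  · rw [unaryInt_eq]
    ext1
    · funext k
      cases k <;> simp [mvStore, zerosTo, hp, hq, haux, hrow, zeros]
      split_ifs with h
      · rw [runOp_pop, List.tail_replicate]
        congr 1
        omega
      · rw [runOp_keep]
        congr 1
        omega
    · rfl
    · rfl
  · simp [mvStore, zerosTo, hp, hq, haux]
    omega

end Frag

namespace Frag

variable {d D : ℕ}

/-! ### From signed digits to two's complement -/

/-- A carry, shifted by `D`. -/
def mkCarry (D n : ℕ) : Fin (2 * D + 1) := ⟨min n (2 * D), by omega⟩

lemma mkCarry_val {D n : ℕ} (h : n ≤ 2 * D) : (mkCarry D n : ℕ) = n := min_eq_left h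

/-- The automaton that converts the number in row `i` to two's complement. The state consists of
a flag and a carry. As long as the flag is not set, it drops as many digits as `drp` holds letters;
then it adds `1`, drops one more digit and sets the flag. -/
def convertStep (i : Fin d) : Option (Bool × Fin (2 * D + 1)) → Tops (Fin d × Fin (2 * D)) →
    Option (Option (Bool × Fin (2 * D + 1)) × StackOps (Fin d × Fin (2 * D)))
  | none, _ => none
  | some (false, C), o =>
    o.path.map fun γ => if (o.reg .drp).isSome then
        (some (false, mkCarry D ((C + rowSum i γ) / 2)),
          { reg := fun k => if k = .drp then (true, none) else
              if k = .drs then (false, some false) else (false, none)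
            path := (true, none)
            tmp := (false, some γ) })
      else (some (true, mkCarry D ((C + 1 + rowSum i γ) / 2)),
          { reg := fun _ => (false, none)
            path := (true, none)
            tmp := (false, some γ) })
  | some (true, C), o => some <| match o.path with
    | some γ => (some (true, mkCarry D ((C + rowSum i γ) / 2)),
          { reg := fun k => if k = .wk then
              (false, some (decide ((C + rowSum i γ) % 2 = 1))) else (false, none)
            path := (true, none)
            tmp := (false, some γ) })
    | none => if (C : ℕ) = D ∨ (C : ℕ) + 1 = D then
          (none, { reg := fun k => if k = .wk then
              (false, some (decide ((C : ℕ) + 1 = D))) else (false, none) })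
        else (some (true, mkCarry D ((C + D) / 2)), { reg := fun k => if k = .wk then
              (false, some (decide ((C + D) % 2 = 1))) else (false, none) })

def convert (i : Fin d) (flag : Bool) : Frag (Fin d × Fin (2 * D)) :=
  auto _ (some (flag, mkCarry D D)) (convertStep i)

lemma toNat_decide_mod (n : ℕ) : (decide (n % 2 = 1)).toNat = n % 2 := by
  rcases Nat.mod_two_eq_zero_or_one n with h | h <;> simp [h]

/-- Beyond the leading digit only the carry is left. Each step replaces `C - D` by its half, rounded
down, until it is `0` or `-1` and can be written as a sign. -/
lemma runs_convert_tail (i : Fin d) (flag : Bool) (φ : StrFun) (m C : ℕ) (hC : C ≤ 2 * D)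
    (hm : ((C : ℤ) - D).natAbs ≤ m) (σ : Store (Fin d × Fin (2 * D))) (hσ : σ.path = []) :
    ∃ l t, TwosComplement l (C - D) ∧ l.length ≤ m + 1 ∧ t ≤ m + 2 ∧
      (convert i flag).Runs φ (some (some (true, mkCarry D C))) σ t
        (σ.set .wk (l ++ σ.reg .wk)) := by
  induction m generalizing C σ with
  | zero =>
    refine ⟨[false], 2, ?_, le_rfl, le_rfl, ?_⟩
    · have := TwosComplement.sign false
      rwa [if_neg (by simp), show (0 : ℤ) = C - D by omega] at this
    · refine auto_next (v' := none) (o := { reg := fun k => if k = .wk then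
        (false, some false) else (false, none) }) ?_ ?_ (auto_stop rfl)
      · simp only [convertStep, Store.tops_path, hσ, List.head?_nil, mkCarry_val hC]
        rw [if_pos (by omega)]
        simp only [show ¬ C + 1 = D by omega, decide_false]
      · ext1
        · funext k
          cases k <;> simp
        · rfl
        · rfl
  | succ m ih =>
    by_cases h : C = D ∨ C + 1 = D
    · refine ⟨[decide (C + 1 = D)], 2, ?_, by simp, by omega, ?_⟩
      · have := TwosComplement.sign (decide (C + 1 = D))
        rcases h with h | h
        · simpa [h] using this
        · rw [decide_eq_true h] at this ⊢
          rwa [if_pos rfl, show (-1 : ℤ) = C - D by omega] at this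
      · refine auto_next (v' := none) (o := { reg := fun k => if k = .wk then
          (false, some (decide (C + 1 = D))) else (false, none) }) ?_ ?_ (auto_stop rfl)
        · simp only [convertStep, Store.tops_path, hσ, List.head?_nil, mkCarry_val hC]
          rw [if_pos h]
        · ext1
          · funext k
            cases k <;> simp
          · rfl
          · rfl
    · have hC' : (C + D) / 2 ≤ 2 * D := by omega
      let σ₁ := σ.set .wk (decide ((C + D) % 2 = 1) :: σ.reg .wk)
      obtain ⟨l, t, h1, h2, h3, h4⟩ := ih ((C + D) / 2) hC' (by omega) σ₁ (by simpa [σ₁])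
      refine ⟨l ++ [decide ((C + D) % 2 = 1)], t + 1, ?_, by simp; omega, by omega, ?_⟩
      · have := h1.snoc (decide ((C + D) % 2 = 1))
        rw [toNat_decide_mod] at this
        convert this using 1
        omega
      · have hfin : σ.set .wk (l ++ [decide ((C + D) % 2 = 1)] ++ σ.reg .wk) =
            σ₁.set .wk (l ++ σ₁.reg .wk) := by
          ext1
          · funext k
            cases k <;> simp [σ₁]
          · rfl
          · rfl
        rw [hfin]
        refine auto_next (o := { reg := fun k => if k = .wk then
          (false, some (decide ((C + D) % 2 = 1))) else (false, none) }) ?_ ?_ h4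
        · simp only [convertStep, Store.tops_path, hσ, List.head?_nil, mkCarry_val hC]
          rw [if_neg h]
        · ext1
          · funext k
            cases k <;> simp [σ₁]
          · rfl
          · rfl

/-- Let `C'` and `b` be the quotient and the remainder of `C + rowSum i γ` by `2`. Then `2 *
(digitSum i p + C' - D) + b = digitSum i (γ :: p) + C - D`. The shift of the carry by `D` cancels
the shift of the digits, and the carry stays at most `2 * D`. -/
lemma runs_convert (i : Fin d) (flag : Bool) (φ : StrFun) (p) (C : ℕ) (hC : C ≤ 2 * D)
    (σ : Store (Fin d × Fin (2 * D))) (hσ : σ.path = p) :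
    ∃ l t, TwosComplement l (digitSum i p + C - D) ∧ l.length ≤ p.length + D + 1 ∧
      t ≤ p.length + D + 2 ∧
      (convert i flag).Runs φ (some (some (true, mkCarry D C))) σ t
        ((σ.set .wk (l ++ σ.reg .wk)).setPaths [] (p.reverse ++ σ.tmp)) := by
  induction p generalizing C σ with
  | nil =>
    obtain ⟨l, t, h1, h2, h3, h4⟩ := runs_convert_tail i flag φ D C hC (by omega) σ hσ
    refine ⟨l, t, by simpa [digitSum] using h1, by simpa using h2, by simpa using h3, ?_⟩
    convert h4 using 1
    ext1
    · rfl
    · simp [hσ]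
    · simp
  | cons γ p ih =>
    have hγ := rowSum_le i γ
    have hC' : (C + rowSum i γ) / 2 ≤ 2 * D := by omega
    let b := decide ((C + rowSum i γ) % 2 = 1)
    let σ₁ := (σ.set .wk (b :: σ.reg .wk)).setPaths p (γ :: σ.tmp)
    obtain ⟨l, t, h1, h2, h3, h4⟩ := ih _ hC' σ₁ rfl
    refine ⟨l ++ [b], t + 1, ?_, by simp; omega, by simp; omega, ?_⟩
    · have := h1.snoc b
      rw [toNat_decide_mod] at this
      convert this using 1
      simp only [digitSum]
      omega
    · have hfin : (σ.set .wk (l ++ [b] ++ σ.reg .wk)).setPaths [] ((γ :: p).reverse ++ σ.tmp) =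
          (σ₁.set .wk (l ++ σ₁.reg .wk)).setPaths [] (p.reverse ++ σ₁.tmp) := by
        ext1
        · funext k
          cases k <;> simp [σ₁]
        · rfl
        · simp [σ₁]
      rw [hfin]
      refine auto_next (o := { reg := fun k => if k = .wk then
          (false, some b) else (false, none), path := (true, none), tmp := (false, some γ) })
          ?_ ?_ h4
      · simp only [convertStep, Store.tops_path, hσ, List.head?_cons, mkCarry_val hC]
        rfl
      · ext1
        · funext k
          cases k <;> simp [σ₁]
        · simp [σ₁, hσ]
        · rfl

/-- Dropped digits act on the rest only through the carry. The `1` added at the last of the `E + 1`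
dropped digits has the weight `2 ^ E`, which turns rounding down into rounding to a nearest integer.
-/
lemma runs_convert_drop (i : Fin d) (flag : Bool) (φ : StrFun) (E : ℕ) (p) (C : ℕ)
    (hC : C ≤ 2 * D) (σ : Store (Fin d × Fin (2 * D))) (hσ : σ.path = p)
    (hE : σ.reg .drp = zeros E) (hp : E + 1 ≤ p.length) :
    ∃ l t, TwosComplement l ((digitSum i p + (C - D) + 2 ^ E) / 2 ^ (E + 1)) ∧
      l.length ≤ p.length + D + 1 ∧ t ≤ p.length + D + 2 ∧
      (convert i flag).Runs φ (some (some (false, mkCarry D C))) σ t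
        ((((σ.set .wk (l ++ σ.reg .wk)).set .drp []).set .drs
          (zeros E ++ σ.reg .drs)).setPaths [] (p.reverse ++ σ.tmp)) := by
  induction E generalizing p C σ with
  | zero =>
    obtain ⟨γ, p, rfl⟩ : ∃ γ p', p = γ :: p' := by
      cases p with
      | nil => simp at hp
      | cons γ p => exact ⟨γ, p, rfl⟩
    have hγ := rowSum_le i γ
    have hC' : (C + 1 + rowSum i γ) / 2 ≤ 2 * D := by omega
    let σ₁ := σ.setPaths p (γ :: σ.tmp)
    obtain ⟨l, t, h1, h2, h3, h4⟩ := runs_convert i flag φ p _ hC' σ₁ rfl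
    refine ⟨l, t + 1, ?_, by simp; omega, by simp; omega, ?_⟩
    · convert h1 using 1
      simp only [digitSum]
      omega
    · have hfin : (((σ.set .wk (l ++ σ.reg .wk)).set .drp []).set .drs
          (zeros 0 ++ σ.reg .drs)).setPaths [] ((γ :: p).reverse ++ σ.tmp) =
          (σ₁.set .wk (l ++ σ₁.reg .wk)).setPaths [] (p.reverse ++ σ₁.tmp) := by
        ext1
        · funext k
          cases k <;> simp [σ₁, hE]
        · rfl
        · simp [σ₁]
      rw [hfin]
      refine auto_next (o := ⟨fun _ => (false, none), (true, none), (false, some γ)⟩) ?_ ?_ h4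
      · simp only [convertStep, Store.tops_path, hσ, List.head?_cons, mkCarry_val hC,
          Store.tops_reg, hE]
        rfl
      · ext1
        · funext k
          cases k <;> simp [σ₁]
        · simp [σ₁, hσ]
        · rfl
  | succ E ih =>
    obtain ⟨γ, p, rfl⟩ : ∃ γ p', p = γ :: p' := by
      cases p with
      | nil => simp at hp
      | cons γ p => exact ⟨γ, p, rfl⟩
    have hγ := rowSum_le i γ
    have hC' : (C + rowSum i γ) / 2 ≤ 2 * D := by omega
    let σ₁ := ((σ.set .drp (zeros E)).set .drs (false :: σ.reg .drs)).setPaths p (γ :: σ.tmp)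
    obtain ⟨l, t, h1, h2, h3, h4⟩ := ih p _ hC' σ₁ rfl (by simp [σ₁]) (by simpa using hp)
    refine ⟨l, t + 1, ?_, by simp; omega, by simp; omega, ?_⟩
    · convert h1 using 1
      have e1 : digitSum i (γ :: p) + ((C : ℤ) - D) + 2 ^ (E + 1) =
          (C + rowSum i γ : ℕ) + 2 * (digitSum i p - D + 2 ^ E) := by
        simp only [digitSum]; push_cast; ring
      rw [pow_succ' 2 (E + 1), ← Int.ediv_ediv_of_nonneg (by norm_num), e1,
        Int.add_mul_ediv_left _ _ (by norm_num)]
      congr 1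
      push_cast
      ring
    · have hfin : (((σ.set .wk (l ++ σ.reg .wk)).set .drp []).set .drs
          (zeros (E + 1) ++ σ.reg .drs)).setPaths [] ((γ :: p).reverse ++ σ.tmp) =
          (((σ₁.set .wk (l ++ σ₁.reg .wk)).set .drp []).set .drs
          (zeros E ++ σ₁.reg .drs)).setPaths [] (p.reverse ++ σ₁.tmp) := by
        ext1
        · funext k
          cases k <;> simp [σ₁, zeros_append_cons]
        · rfl
        · simp [σ₁]
      rw [hfin]
      refine auto_next (o := ⟨fun k => if k = .drp then (true, none) else
              if k = .drs then (false, some false) else (false, none),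
                (true, none), (false, some γ)⟩) ?_ ?_ h4
      · simp only [convertStep, Store.tops_path, hσ, List.head?_cons, mkCarry_val hC,
          Store.tops_reg, hE]
        rfl
      · ext1
        · funext k
          cases k <;> simp [σ₁, hE, zeros_succ]
        · simp [σ₁, hσ]
        · rfl

/-- The number that `convert i flag` computes from the digits `p` when `drp` holds `E` letters. -/
def convertValue (i : Fin d) (flag : Bool) (E : ℕ) (p : List (Fin d × Fin (2 * D) → Bool)) : ℤ :=
  if flag then digitSum i p else (digitSum i p + 2 ^ E) / 2 ^ (E + 1)

lemma exec_convert (i : Fin d) (flag : Bool) (φ : StrFun) (E : ℕ) (p)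
    (σ : Store (Fin d × Fin (2 * D))) (hσ : σ.path = p) (ht : σ.tmp = [])
    (hE : σ.reg .drp = zeros E) (hs : σ.reg .drs = []) (hw : σ.reg .wk = [])
    (hp : flag = false → E + 1 ≤ p.length) :
    ∃ l, TwosComplement l (convertValue i flag E p) ∧ l.length ≤ p.length + D + 1 ∧
      (convert i flag).Exec φ σ (p.length + D + 2)
        (((σ.set .wk l).set .drp (if flag then zeros E else [])).set .drs
          (if flag then [] else zeros E) |>.setPaths [] p.reverse) := by
  cases flag with
  | true =>
    obtain ⟨l, t, h1, h2, h3, h4⟩ := runs_convert i true φ p D (by omega) σ hσ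
    refine ⟨l, by simpa [convertValue] using h1, h2,
      (Exec.of_auto h4 h3).of_eq ?_ le_rfl⟩
    ext1
    · funext k
      cases k <;> simp [hE, hs, hw]
    · rfl
    · simp [ht]
  | false =>
    obtain ⟨l, t, h1, h2, h3, h4⟩ :=
      runs_convert_drop i false φ E p D (by omega) σ hσ hE (hp rfl)
    refine ⟨l, by simpa [convertValue] using h1, h2,
      (Exec.of_auto h4 h3).of_eq ?_ le_rfl⟩
    ext1
    · funext k
      cases k <;> simp [hs, hw]
    · rfl
    · simp [ht]

/-! ### From two's complement to codes of integers -/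

variable {J : Type}

/-- The automaton that writes a number in two's complement on `wk` as its code onto `row` and the
length of the code onto `len`. Its state consists of the sign and of a flag for the end of the
leading letters that are equal to the sign. -/
def encodeStep : Option (Option (Bool × Bool)) → Tops J →
    Option (Option (Option (Bool × Bool)) × StackOps J)
  | none, o => (o.reg .wk).map fun b => (some (some (b, false)),
      { reg := fun k => if k = .wk then (true, none) else (false, none) })
  | some none, _ => none
  | some (some (s, e)), o => match o.reg .wk with
    | some b => some <| if (b ^^ s) = false ∧ e = false then
          (some (some (s, false)),
            { reg := fun k => if k = .wk then (true, none) else (false, none) })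
        else
          (some (some (s, true)),
            { reg := fun k => if k = .wk then (true, none) else if k = .row then
                (false, some (b ^^ s)) else if k = .len then (false, some false) else
                (false, none) })
    | none => if s = true ∨ e = true then some (some none,
            { reg := fun k => if k = .row then
                (false, some s) else if k = .len then (false, some false) else
                (false, none) })
        else none

def encode : Frag J := auto _ none encodeStep

/-- `TwosComplement` grows at the end of the word while the automaton reads from its front, so the
rest `r` of the word and the remainder of the run are carried along as data. After reading `l`, the
state is determined by `z`: its sign, and whether a letter of the magnitude has already been
written. -/
lemma runs_encode (φ : StrFun) {l : Word} {z : ℤ} (hl : TwosComplement l z) (r : Word)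
    (σ σ' : Store J) (hσ : σ.reg .wk = l ++ r) (t : ℕ)
    (h : (encode (J := J)).Runs φ
      (some (some (some (decide (z < 0), decide ((magnitude z).bits ≠ [])))))
      (((σ.set .wk r).set .row ((magnitude z).bits ++ σ.reg .row)).set .len
        (zeros (magnitude z).bits.length ++ σ.reg .len)) t σ') :
    (encode (J := J)).Runs φ (some none) σ (t + l.length) σ' := by
  induction hl generalizing r t with
  | sign s =>
    have e1 : magnitude (if s then -1 else 0) = 0 := by cases s <;> rfl
    have e2 : decide ((if s then (-1 : ℤ) else 0) < 0) = s := by cases s <;> rfl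
    simp only [e1, e2, Nat.zero_bits] at h
    refine auto_next (o := { reg := fun k => if k = .wk then (true, none) else (false, none) })
      (v' := some (some (s, false))) ?_ ?_ h
    · simp [encodeStep, hσ]
    · ext1
      · funext k
        cases k <;> simp [hσ]
      · rfl
      · rfl
  | @snoc l z b hl ih =>
    rw [List.length_append, List.length_singleton, add_comm l.length, ← add_assoc]
    refine ih (b :: r) (by simpa using hσ) _ ?_
    rw [magnitude_bit] at h
    simp only [neg_bit] at h
    by_cases h0 : (b ^^ decide (z < 0)) = false ∧ magnitude z = 0
    · refine auto_next (o := { reg := fun k => if k = .wk then (true, none) else (false, none) })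
        ?_ ?_ h
      · simp [encodeStep, h0]
      · ext1
        · funext k
          cases k <;> simp [h0]
        · rfl
        · rfl
    · have hb : (Nat.bit (b ^^ decide (z < 0)) (magnitude z)).bits =
          (b ^^ decide (z < 0)) :: (magnitude z).bits := by
        refine Nat.bits_append_bit _ _ fun h1 => ?_
        by_contra h2
        exact h0 ⟨by simpa using h2, h1⟩
      rw [hb] at h
      refine auto_next (o := { reg := fun k => if k = .wk then (true, none) else if k = .row then
                (false, some (b ^^ decide (z < 0))) else if k = .len then (false, some false) else
                (false, none) }) ?_ ?_ h
      · have h1 : (magnitude z).bits = [] ↔ magnitude z = 0 := by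
          rw [← List.length_eq_zero_iff, Nat.size_eq_bits_len, Nat.size_eq_zero]
        simp only [encodeStep, Store.tops_reg, Store.set_reg]
        simp only [reduceCtorEq, if_false, if_true, List.head?_cons]
        rw [if_neg]
        · simp
        · simpa [h1] using h0
      · ext1
        · funext k
          cases k <;> simp [zeros_succ]
        · rfl
        · rfl

lemma exec_encode (φ : StrFun) {l : Word} {z : ℤ} (hl : TwosComplement l z)
    (σ : Store J) (hσ : σ.reg .wk = l) :
    (encode (J := J)).Exec φ σ (l.length + 2) (((σ.set .wk []).set .row
      (binaryInt z ++ σ.reg .row)).set .len (zeros (binaryInt z).length ++ σ.reg .len)) := by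
  by_cases h : z < 0 ∨ (magnitude z).bits ≠ []
  · refine Exec.of_auto (t := 2 + l.length)
      (runs_encode φ hl [] σ _ (by simpa using hσ) 2 ?_) (by omega)
    refine auto_next (v' := some none) (o := { reg := fun k => if k = .row then
                (false, some (decide (z < 0))) else if k = .len then (false, some false) else
                (false, none) }) ?_ ?_ (auto_stop rfl)
    · simp only [encodeStep, Store.tops_reg, Store.set_reg]
      simp only [reduceCtorEq, if_false, if_true, List.head?_nil]
      rw [if_pos (by simpa using h)]
    · rw [binaryInt_eq, if_pos h]
      ext1
      · funext k
        cases k <;> simp [zeros_succ]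
      · rfl
      · rfl
  · refine Exec.of_auto (t := 1 + l.length)
      (runs_encode φ hl [] σ _ (by simpa using hσ) 1 ?_) (by omega)
    rw [binaryInt_eq, if_neg h, List.nil_append]
    refine auto_stop ?_
    simp only [encodeStep, Store.tops_reg, Store.set_reg]
    simp only [reduceCtorEq, if_false, if_true, List.head?_nil]
    rw [if_neg (by simpa using h)]

lemma _root_.TwosComplement.magnitude_length {l : Word} {z : ℤ} (hl : TwosComplement l z) :
    (magnitude z).bits.length + 1 ≤ l.length := by
  induction hl with
  | sign s => cases s <;> decide
  | @snoc l z b _ ih =>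
    rw [magnitude_bit, List.length_append, List.length_singleton]
    rw [Nat.size_eq_bits_len] at ih ⊢
    have h := (Nat.size_le (m := magnitude z)).1 le_rfl
    refine Nat.succ_le_succ ((Nat.size_le.2 ?_).trans ih)
    rw [Nat.bit_val, pow_succ]
    have := Bool.toNat_le (b ^^ decide (z < 0))
    omega

lemma _root_.TwosComplement.length_binaryInt {l : Word} {z : ℤ} (hl : TwosComplement l z) :
    (binaryInt z).length ≤ l.length := by
  rw [binaryInt_eq, List.length_append]
  have := TwosComplement.magnitude_length hl
  split_ifs <;> simp <;> omega

end Frag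

namespace Frag

/-! ### Codes of points -/

variable {J : Type}

/-- Move the symbols on `tmp` back to `path`. -/
def restorePath : Frag J :=
  auto Unit () fun _ o => o.tmp.map fun γ => ((), ⟨fun _ => (false, none), (false, some γ),
    (true, none)⟩)

lemma exec_restorePath (φ : StrFun) (σ : Store J) : (restorePath (J := J)).Exec φ σ
    (σ.tmp.length + 1) (σ.setPaths (σ.tmp.reverse ++ σ.path) []) := by
  refine Exec.of_auto ?_ le_rfl
  generalize hw : σ.tmp = w
  induction w generalizing σ with
  | nil =>
    have : σ.setPaths (List.reverse [] ++ σ.path) [] = σ := by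
      ext1
      · rfl
      · rfl
      · simp [hw]
    rw [this]
    exact auto_stop (by simp [hw])
  | cons γ w ih =>
    refine auto_next (v' := ()) (o := ⟨fun _ => (false, none), (false, some γ),
      (true, none)⟩) (σ₁ := σ.setPaths (γ :: σ.path) w) (by simp [hw]) ?_ ?_
    · ext1
      · rfl
      · rfl
      · simp [hw]
    · have := ih (σ.setPaths (γ :: σ.path) w) rfl
      have e : σ.setPaths ((γ :: w).reverse ++ σ.path) [] = (σ.setPaths (γ :: σ.path) w).setPaths
          (w.reverse ++ (σ.setPaths (γ :: σ.path) w).path) [] := by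
        ext1
        · rfl
        · simp
        · rfl
      rw [e]
      exact this

/-- The scratch registers are empty. -/
structure Idle (σ : Store J) : Prop where
  aux : σ.reg .aux = []
  wk : σ.reg .wk = []
  len : σ.reg .len = []
  row : σ.reg .row = []
  rev : σ.reg .rev = []
  drs : σ.reg .drs = []
  tmp : σ.tmp = []

/-- Turn the content `t` of `b` into `⟨s, t⟩`, where the letters of `s` have been pushed to `b`
and `len` holds the length of `s`. -/
def closePair (b : Reg) : Frag J := (pushLetter b true).seq (mv .len (zerosTo [b]))

lemma exec_closePair {b : Reg} (hb : b ≠ .len) (φ : StrFun) (σ : Store J) (s t : Word)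
    (hs : σ.reg b = s ++ t) (hl : σ.reg .len = zeros s.length) :
    (closePair (J := J) b).Exec φ σ (s.length + 3) ((σ.set b (pairWord s t)).set .len []) := by
  refine ((exec_pushLetter b true φ σ).seq (exec_mv .len (zerosTo [b]) φ _)).of_eq ?_ ?_
  · ext1
    · funext k
      by_cases h1 : k = b
      · subst h1
        simp [mvStore, zerosTo, hb, hb.symm, hs, hl, pairWord, zeros]
      · by_cases h2 : k = .len
        · subst h2; simp [mvStore]
        · simp [mvStore, zerosTo, h1, h2]
    · rfl
    · rfl
  · simp [hb.symm, hl]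
    omega

variable {d D : ℕ}

/-- Write the code of the `i`-th coordinate to `row`. -/
def coordRow (i : Fin d) (flag : Bool) : Frag (Fin d × Fin (2 * D)) :=
  (emitLevel.seq ((convert i flag).seq (encode.seq (closePair .row)))).seq
    (restorePath.seq (mv .drs (zerosTo [.drp])))

lemma exec_coordRow (i : Fin d) (flag : Bool) (φ : StrFun) (S : ℕ)
    (σ : Store (Fin d × Fin (2 * D))) (hi : Idle σ) {n : ℤ} (hn : HasLevel σ n) (E : ℕ)
    (hE : σ.reg .drp = zeros E) (hp : flag = false → E + 1 ≤ σ.path.length)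
    (hS₁ : σ.path.length ≤ S) (hS₂ : n.natAbs ≤ S) (hS₃ : E ≤ S) :
    (dyadicCode (convertValue i flag E σ.path, n)).length ≤ 4 * (S + D + 1) ∧
    (coordRow i flag).Exec φ σ (30 * (S + D + 1))
      (σ.set .row (dyadicCode (convertValue i flag E σ.path, n))) := by
  obtain ⟨haux, hwk, hlen, hrow, hrev, hdrs, htmp⟩ := hi
  have h1 := exec_emitLevel φ hn haux hrow
  obtain ⟨l, hl, hll, h2⟩ := exec_convert i flag φ E σ.path (σ.set .row (unaryInt n)) rfl htmp
    (by simpa using hE) (by simpa using hdrs) (by simpa using hwk) hp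
  have hbl := hl.length_binaryInt
  have hul := length_unaryInt_le n
  set z := convertValue i flag E σ.path with hz
  refine ⟨by simp only [dyadicCode, pairWord, List.length_append, List.length_replicate,
    List.length_cons]; omega, ?_⟩
  have h3 := exec_encode φ hl (σ := ((((σ.set .row (unaryInt n)).set .wk l).set .drp
    (if flag then zeros E else [])).set .drs (if flag then [] else zeros E) |>.setPaths []
      σ.path.reverse)) (by simp)
  have h4 := exec_closePair (b := .row) (by simp) φ (s := binaryInt z) (t := unaryInt n) (σ :=
    (((((((σ.set .row (unaryInt n)).set .wk l).set .drp
    (if flag then zeros E else [])).set .drs (if flag then [] else zeros E) |>.setPaths []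
      σ.path.reverse).set .wk []).set .row
      (binaryInt z ++ unaryInt n)).set .len (zeros (binaryInt z).length))) (by simp) (by simp)
  have h3' := h3.of_eq (σ' := (((((((σ.set .row (unaryInt n)).set .wk l).set .drp
    (if flag then zeros E else [])).set .drs (if flag then [] else zeros E) |>.setPaths []
      σ.path.reverse).set .wk []).set .row
      (binaryInt z ++ unaryInt n)).set .len (zeros (binaryInt z).length)))
      (by simp [hlen]) le_rfl
  refine ((h1.seq (h2.seq (h3'.seq h4))).seq ((exec_restorePath φ _).seq
    (exec_mv .drs (zerosTo [.drp]) φ _))).of_eq ?_ ?_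
  · ext1
    · funext k
      cases k <;> simp [mvStore, zerosTo, hlen, hwk, hdrs, dyadicCode]
      cases flag <;> simp [hE, zeros]
    · simp [mvStore]
    · simp [mvStore, htmp]
  · simp
    have : (if flag then [] else zeros E).length ≤ E := by cases flag <;> simp
    omega

/-- Join the word on `row` to the word on `pnt`. -/
def joinRow (last : Bool) : Frag J :=
  (mv .row (toReg .rev)).seq (if last then mv .rev (toReg .pnt) else
    (mv .rev (fun k => if k = .pnt then some id else if k = .len then some fun _ => false
      else none)).seq (closePair .pnt))

lemma exec_joinRow (last : Bool) (φ : StrFun) (σ : Store J) (s : Word)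
    (hs : σ.reg .row = s) (hr : σ.reg .rev = []) (hl : σ.reg .len = [])
    (hp : last = true → σ.reg .pnt = []) : (joinRow last).Exec φ σ (3 * s.length + 8)
      ((σ.set .row []).set .pnt (if last then s else pairWord s (σ.reg .pnt))) := by
  cases last with
  | true =>
    refine ((exec_mv .row (toReg .rev) φ σ).seq (exec_mv .rev (toReg .pnt) φ _)).of_eq ?_ ?_
    · ext1
      · funext k
        cases k <;> simp [mvStore, toReg, hs, hr, hp]
      · rfl
      · rfl
    · simp [mvStore, toReg, hs, hr]
      omega
  | false =>
    refine ((exec_mv .row (toReg .rev) φ σ).seq ((exec_mv .rev _ φ _).seq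
      (exec_closePair (by simp) φ _ s (σ.reg .pnt) ?_ ?_))).of_eq ?_ ?_
    · simp [mvStore, toReg, hs, hr]
    · simp [mvStore, toReg, hs, hr, hl, zeros]
    · ext1
      · funext k
        cases k <;> simp [mvStore, toReg, hs, hr, hl]
      · rfl
      · rfl
    · simp [mvStore, toReg, hs, hr]
      omega

/-- Write the code of a point, given by a list of coordinates, to `pnt`. -/
def buildPoint (flag : Bool) : List (Fin d) → Frag (Fin d × Fin (2 * D))
  | [] => skip
  | i :: l => (buildPoint flag l).seq ((coordRow i flag).seq (joinRow l.isEmpty))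

lemma dyadicListCode_cons (q : ℤ × ℤ) (l : List (ℤ × ℤ)) : dyadicListCode (q :: l) =
    if l.isEmpty then dyadicCode q else pairWord (dyadicCode q) (dyadicListCode l) := by
  cases l <;> rfl

/-- The pairing of coordinates nests to the right, so the last coordinate is written first and each
further one is put in front of the word built so far. -/
lemma exec_buildPoint (flag : Bool) (φ : StrFun) (S : ℕ)
    (σ : Store (Fin d × Fin (2 * D))) (hi : Idle σ) {n : ℤ} (hn : HasLevel σ n) (E : ℕ)
    (hE : σ.reg .drp = zeros E) (hp : flag = false → E + 1 ≤ σ.path.length)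
    (hS₁ : σ.path.length ≤ S) (hS₂ : n.natAbs ≤ S) (hS₃ : E ≤ S) (hpnt : σ.reg .pnt = [])
    (l : List (Fin d)) :
    (dyadicListCode (l.map fun i => (convertValue i flag E σ.path, n))).length ≤
      9 * l.length * (S + D + 1) ∧
    (buildPoint flag l).Exec φ σ (53 * l.length * (S + D + 1) + 1)
      (σ.set .pnt (dyadicListCode (l.map fun i => (convertValue i flag E σ.path, n)))) := by
  induction l with
  | nil =>
    refine ⟨by simp [dyadicListCode], (exec_skip φ σ).of_eq ?_ (by simp)⟩
    ext1
    · funext k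
      cases k <;> simp [dyadicListCode, hpnt]
    · rfl
    · rfl
  | cons i l ih =>
    obtain ⟨h1, h2⟩ := ih
    set w := dyadicListCode (l.map fun i => (convertValue i flag E σ.path, n)) with hw
    obtain ⟨h3, h4⟩ := exec_coordRow i flag φ S (σ.set .pnt w)
      ⟨by simpa using hi.aux, by simpa using hi.wk, by simpa using hi.len, by simpa using hi.row,
        by simpa using hi.rev, by simpa using hi.drs, hi.tmp⟩ (n := n)
      ⟨by simpa using hn.1, by simpa using hn.2⟩ E (by simpa using hE) hp hS₁ hS₂ hS₃
    rw [Store.set_path] at h3 h4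
    set s := dyadicCode (convertValue i flag E σ.path, n) with hs
    have h5 := exec_joinRow l.isEmpty φ ((σ.set .pnt w).set .row s) s (by simp)
      (by simpa using hi.rev) (by simpa using hi.len) (by
        intro hl
        rw [List.isEmpty_iff] at hl
        subst hl
        simp [hw, dyadicListCode])
    rw [List.map_cons, dyadicListCode_cons, List.isEmpty_map, ← hw, ← hs, List.length_cons,
      show 9 * (l.length + 1) * (S + D + 1) = 9 * l.length * (S + D + 1) + 9 * (S + D + 1) by ring,
      show 53 * (l.length + 1) * (S + D + 1) =
        53 * l.length * (S + D + 1) + 53 * (S + D + 1) by ring]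
    refine ⟨?_, (h2.seq (h4.seq h5)).of_eq ?_ (by omega)⟩
    · split_ifs
      · omega
      · simp only [pairWord, List.length_append, List.length_replicate, List.length_cons]
        omega
    · ext1
      · funext k
        cases k <;> simp [hi.row]
      · rfl
      · rfl

end Frag

/-! ### Enumeration of words over a finite alphabet -/

section Enumeration

variable {Γ : Type} [Fintype Γ]

/-- The position of a symbol in a fixed enumeration of the alphabet. -/
noncomputable def symbolRank (γ : Γ) : ℕ := Fintype.equivFin Γ γ

lemma symbolRank_lt (γ : Γ) : symbolRank γ < Fintype.card Γ := (Fintype.equivFin Γ γ).2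

lemma symbolRank_injective : Function.Injective (symbolRank : Γ → ℕ) :=
  Fin.val_injective.comp (Fintype.equivFin Γ).injective

/-- The next symbol. -/
noncomputable def nextSymbol (γ : Γ) : Γ :=
  if h : symbolRank γ + 1 < Fintype.card Γ then (Fintype.equivFin Γ).symm ⟨_, h⟩ else γ

lemma symbolRank_next {γ : Γ} (h : symbolRank γ + 1 ≠ Fintype.card Γ) :
    symbolRank (nextSymbol γ) = symbolRank γ + 1 := by
  have h' : symbolRank γ + 1 < Fintype.card Γ := lt_of_le_of_ne (symbolRank_lt γ) h
  rw [nextSymbol, dif_pos h']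
  simp [symbolRank]

/-- The position of a word in the length-lexicographic order. -/
noncomputable def wordRank : List Γ → ℕ
  | [] => 0
  | γ :: u => Fintype.card Γ * wordRank u + symbolRank γ + 1

lemma wordRank_lt (u : List Γ) : wordRank u < (Fintype.card Γ + 1) ^ u.length := by
  induction u with
  | nil => simp [wordRank]
  | cons γ u ih =>
    rw [wordRank, List.length_cons, pow_succ]
    have h := symbolRank_lt γ
    have h2 := Nat.mul_le_mul_right (Fintype.card Γ + 1) (Nat.succ_le_of_lt ih)
    nlinarith

variable [Nonempty Γ]

variable (Γ) in
/-- The first symbol. -/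
noncomputable def firstSymbol : Γ := (Fintype.equivFin Γ).symm ⟨0, Fintype.card_pos⟩

lemma symbolRank_first : symbolRank (firstSymbol Γ) = 0 := by simp [symbolRank, firstSymbol]

/-- The successor of a word in the length-lexicographic order; the last letter comes first. -/
noncomputable def nextWord : List Γ → List Γ
  | [] => [firstSymbol Γ]
  | γ :: u => if symbolRank γ + 1 = Fintype.card Γ then firstSymbol Γ :: nextWord u
      else nextSymbol γ :: u

lemma nextWord_cons_of_eq {γ : Γ} (h : symbolRank γ + 1 = Fintype.card Γ) (u : List Γ) :
    nextWord (γ :: u) = firstSymbol Γ :: nextWord u := by rw [nextWord, if_pos h]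

lemma nextWord_cons_of_ne {γ : Γ} (h : symbolRank γ + 1 ≠ Fintype.card Γ) (u : List Γ) :
    nextWord (γ :: u) = nextSymbol γ :: u := by rw [nextWord, if_neg h]

lemma wordRank_next (u : List Γ) : wordRank (nextWord u) = wordRank u + 1 := by
  induction u with
  | nil => simp [nextWord, wordRank, symbolRank_first]
  | cons γ u ih =>
    by_cases h : symbolRank γ + 1 = Fintype.card Γ
    · rw [nextWord, if_pos h, wordRank, ih, symbolRank_first, wordRank]
      linarith
    · rw [nextWord, if_neg h, wordRank, symbolRank_next h, wordRank]
      ring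

/-- The rank is a numeral in base `Fintype.card Γ` with digits `symbolRank γ + 1`, from `1` to the
base, so words of different lengths do not collide. Remainder and quotient recover the letters. -/
lemma wordRank_injective : Function.Injective (wordRank : List Γ → ℕ) := by
  intro u
  induction u with
  | nil => intro v h; cases v <;> simp [wordRank] at h ⊢
  | cons γ u ih =>
    intro v h
    cases v with
    | nil => simp [wordRank] at h
    | cons δ v =>
      have h' : symbolRank γ + Fintype.card Γ * wordRank u =
          symbolRank δ + Fintype.card Γ * wordRank v := by simp only [wordRank] at h; omega
      have h1 := congrArg (· % Fintype.card Γ) h'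
      have h2 := congrArg (· / Fintype.card Γ) h'
      simp only [Nat.add_mul_mod_self_left, Nat.mod_eq_of_lt (symbolRank_lt _)] at h1
      simp only [Nat.add_mul_div_left _ _ Fintype.card_pos,
        Nat.div_eq_of_lt (symbolRank_lt _), zero_add] at h2
      rw [symbolRank_injective h1, ih h2]

/-- The enumeration from the empty word reaches `u` at the time given by its rank; this is what
bounds the number of rounds of the search. -/
lemma iterate_nextWord (u : List Γ) : nextWord^[wordRank u] [] = u := by
  have h : ∀ m, wordRank (nextWord^[m] ([] : List Γ)) = m := by
    intro m
    induction m with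
    | zero => rfl
    | succ m ih => rw [Function.iterate_succ_apply', wordRank_next, ih]
  exact wordRank_injective (h _)

lemma length_le_length_nextWord (u : List Γ) :
    u.length ≤ (nextWord u).length ∧ (nextWord u).length ≤ u.length + 1 := by
  induction u with
  | nil => simp [nextWord]
  | cons γ u ih =>
    rw [nextWord]
    split_ifs <;> simp [ih]

lemma nextWord_ne_nil (u : List Γ) : nextWord u ≠ [] := by
  cases u with
  | nil => simp [nextWord]
  | cons γ u => rw [nextWord]; split_ifs <;> simp

end Enumeration

/-! ### Oracles with advice words -/

/-- The function `φ` paired with constant functions. -/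
def withAdvice (φ : StrFun) : List Word → StrFun
  | [] => φ
  | w :: ws => pairFun (withAdvice φ ws) fun _ => w

/-- The prefix of the answers of `withAdvice φ ws` to queries to `φ`. -/
def adviceHeader : List Word → Word
  | [] => []
  | w :: ws => zeros w.length ++ true :: adviceHeader ws

/-- Each leading zero of a query selects the first component of a pair, whose answer comes after the
length of the constant component in unary and a `1`. The lengths of all advice words thus show in
the header. -/
lemma withAdvice_apply (φ : StrFun) (ws : List Word) (v : Word) :
    withAdvice φ ws (zeros ws.length ++ v) = adviceHeader ws ++ φ v := by
  induction ws with
  | nil => rfl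
  | cons w ws ih =>
    show List.replicate _ false ++ true :: withAdvice φ ws (zeros ws.length ++ v) = _
    rw [ih]
    simp [adviceHeader, zeros]

/-- The total length of a list of words. -/
def totalLength (ws : List Word) : ℕ := (ws.map List.length).sum

namespace Frag

variable {J : Type}

/-! ### Changes of the level -/

/-- Repeat a program. -/
def iter (F : Frag J) : ℕ → Frag J
  | 0 => skip
  | n + 1 => F.seq (iter F n)

/-- The operations on registers that increase the level. -/
def levelUp (o : Tops J) (k : Reg) : StackOp Bool :=
  if k = .pos then (false, if (o.reg .neg).isSome then none else some false)
  else if k = .neg then (true, none) else (false, none)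

/-- The operations on registers that decrease the level. -/
def levelDown (o : Tops J) (k : Reg) : StackOp Bool :=
  if k = .neg then (false, if (o.reg .pos).isSome then none else some false)
  else if k = .pos then (true, none) else (false, none)

/-- Overwrite the level. -/
def setLevel (σ : Store J) (n : ℤ) : Store J :=
  (σ.set .pos (zeros n.toNat)).set .neg (zeros (-n).toNat)

lemma HasLevel.setLevel_self {σ : Store J} {n : ℤ} (h : HasLevel σ n) : setLevel σ n = σ := by
  ext1
  · funext k
    cases k <;> simp [setLevel, h.1, h.2]
  · rfl
  · rfl

lemma zeros_isSome (n : ℕ) : (zeros n).head?.isSome = decide (0 < n) := by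
  cases n <;> simp [zeros_succ]

lemma zeros_tail (n : ℕ) : (zeros n).tail = zeros (n - 1) := by cases n <;> rfl

lemma runOp_levelUp {σ : Store J} {n : ℤ} (h : HasLevel σ n) (k : Reg) :
    runOp (levelUp σ.tops k) (σ.reg k) = (setLevel σ (n + 1)).reg k := by
  obtain ⟨h1, h2⟩ := h
  cases k <;> simp [levelUp, setLevel, h1, h2, zeros_isSome, zeros_tail]
  · split_ifs with h
    · rw [runOp_keep]
      congr 1
      omega
    · rw [runOp_push, ← zeros_succ]
      congr 1
      omega
  · exact congrArg zeros (by omega)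

lemma runOp_levelDown {σ : Store J} {n : ℤ} (h : HasLevel σ n) (k : Reg) :
    runOp (levelDown σ.tops k) (σ.reg k) = (setLevel σ (n - 1)).reg k := by
  obtain ⟨h1, h2⟩ := h
  cases k <;> simp [levelDown, setLevel, h1, h2, zeros_isSome, zeros_tail]
  split_ifs with h
  · rw [runOp_keep]
    congr 1
    omega
  · rw [runOp_push, ← zeros_succ]
    congr 1
    omega

lemma hasLevel_setLevel (σ : Store J) (n : ℤ) : HasLevel (setLevel σ n) n := by
  simp [HasLevel, setLevel]

lemma setLevel_setLevel (σ : Store J) (m n : ℤ) : setLevel (setLevel σ m) n = setLevel σ n := by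
  ext1
  · funext k
    cases k <;> simp [setLevel]
  · rfl
  · rfl

lemma exec_levelUp (φ : StrFun) (e : ℕ) {σ : Store J} {n : ℤ} (h : HasLevel σ n) :
    (iter (once fun o => { reg := levelUp o }) e).Exec φ σ (2 * e + 1) (setLevel σ (n + e)) := by
  induction e generalizing σ n with
  | zero => exact (exec_skip φ σ).of_eq (by simp [h.setLevel_self]) (by simp)
  | succ e ih =>
    have h1 : σ.apply { reg := levelUp σ.tops } = setLevel σ (n + 1) := by
      ext1
      · funext k
        exact runOp_levelUp h k
      · rfl
      · rfl
    refine (((exec_once _ φ σ).of_eq h1 le_rfl).seq (ih (hasLevel_setLevel σ _))).of_eq ?_ ?_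
    · rw [setLevel_setLevel]
      congr 1
      push_cast
      ring
    · omega

lemma exec_levelDown (φ : StrFun) (e : ℕ) {σ : Store J} {n : ℤ} (h : HasLevel σ n) :
    (iter (once fun o => { reg := levelDown o }) e).Exec φ σ (2 * e + 1)
      (setLevel σ (n - e)) := by
  induction e generalizing σ n with
  | zero => exact (exec_skip φ σ).of_eq (by simp [h.setLevel_self]) (by simp)
  | succ e ih =>
    have h1 : σ.apply { reg := levelDown σ.tops } = setLevel σ (n - 1) := by
      ext1
      · funext k
        exact runOp_levelDown h k
      · rfl
      · rfl
    refine (((exec_once _ φ σ).of_eq h1 le_rfl).seq (ih (hasLevel_setLevel σ _))).of_eq ?_ ?_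
    · rw [setLevel_setLevel]
      congr 1
      push_cast
      ring
    · omega

lemma exec_iter_pushLetter (a : Reg) (φ : StrFun) (m : ℕ) (σ : Store J) :
    (iter (pushLetter a false) m).Exec φ σ (2 * m + 1) (σ.set a (zeros m ++ σ.reg a)) := by
  induction m generalizing σ with
  | zero =>
    refine (exec_skip φ σ).of_eq ?_ (by simp)
    ext1
    · funext k
      by_cases h : k = a
      · subst h; simp
      · simp [h]
    · rfl
    · rfl
  | succ m ih =>
    refine ((exec_pushLetter a false φ σ).seq (ih _)).of_eq ?_ (by omega)
    ext1
    · funext k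
      by_cases h : k = a
      · subst h; simp [zeros_append_cons]
      · simp [h]
    · rfl
    · rfl

/-! ### Oracle queries -/

/-- Remove zeros and a one from the query tape. -/
def dropHeader : Frag J := auto Bool false fun v o =>
  match v, o.reg .qry with
  | false, some b => some (b, { reg := fun k => if k = .qry then (true, none) else (false, none) })
  | _, _ => none

lemma exec_dropHeader (φ : StrFun) (m : ℕ) (w : Word) (σ : Store J)
    (h : σ.reg .qry = zeros m ++ true :: w) :
    (dropHeader (J := J)).Exec φ σ (m + 2) (σ.set .qry w) := by
  refine Exec.of_auto ?_ le_rfl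
  induction m generalizing σ with
  | zero =>
    refine auto_next (v' := true) (o := { reg := fun k => if k = .qry then (true, none) else
      (false, none) }) (by simp [h]) ?_ (auto_stop (by simp))
    ext1
    · funext k
      cases k <;> simp [h]
    · rfl
    · rfl
  | succ m ih =>
    refine auto_next (v' := false) (o := { reg := fun k => if k = .qry then (true, none) else
      (false, none) }) (σ₁ := σ.set .qry (zeros m ++ true :: w)) (by simp [h, zeros_succ]) ?_ ?_
    · ext1
      · funext k
        cases k <;> simp [h, zeros_succ]
      · rfl
      · rfl
    · convert ih (σ.set .qry (zeros m ++ true :: w)) (by simp) using 1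
      simp [Store.set]

lemma exec_dropHeaders (φ : StrFun) (ws : List Word) (w : Word) (σ : Store J)
    (h : σ.reg .qry = adviceHeader ws ++ w) :
    (iter (dropHeader (J := J)) ws.length).Exec φ σ (totalLength ws + 3 * ws.length + 1)
      (σ.set .qry w) := by
  induction ws generalizing σ with
  | nil =>
    refine (exec_skip φ σ).of_eq ?_ (by simp)
    simp only [adviceHeader, List.nil_append] at h
    simp [Store.set, ← h]
  | cons v ws ih =>
    refine ((exec_dropHeader φ v.length (adviceHeader ws ++ w) σ
      (by simpa [adviceHeader] using h)).seq (ih _ (by simp))).of_eq ?_ ?_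
    · simp [Store.set]
    · simp [totalLength]
      omega

variable {d D : ℕ}

/-- Query the oracle, which has `h` advice words, about the point on `path`. -/
def test (h e : ℕ) : Frag (Fin d × Fin (2 * D)) :=
  (buildPoint true (List.finRange d)).seq <|
  (iter (once fun o => { reg := levelDown o }) e).seq <|
  emitLevel.seq <| (mv .row (toReg .qry)).seq <|
  (iter (once fun o => { reg := levelUp o }) e).seq <|
  ((mv .pnt (toReg .rev)).seq (mv .rev (fun k => if k = .qry then some id else
    if k = .len then some fun _ => false else none))).seq <| (closePair .qry).seq <|
  (iter (pushLetter .qry false) h).seq <| ask.seq <| iter dropHeader h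

lemma unaryInt_reverse (n : ℤ) : (unaryInt n).reverse = unaryInt n := by
  rw [unaryInt_eq, reverse_zeros]

lemma pointCode_eq (c : Fin d → ℤ × ℤ) :
    pointCode c = dyadicListCode ((List.finRange d).map c) := by
  rw [pointCode, List.ofFn_eq_map]

/-- The level is lowered by `e` only while the precision is written, so the ball in question has a
radius of `2 ^ e` grid widths. The leading zeros of the query select the name of the set. `S` bounds
all sizes involved, and the constant is uniform in the oracle and the path. -/
lemma exec_test (h e : ℕ) : ∃ C, ∀ ws : List Word, ws.length = h → ∀ (φ₁ : StrFun) (S : ℕ)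
    (σ : Store (Fin d × Fin (2 * D))), Idle σ → ∀ n : ℤ, HasLevel σ n → ∀ E : ℕ,
    σ.reg .drp = zeros E → σ.path.length ≤ S → n.natAbs ≤ S → E ≤ S → totalLength ws ≤ S →
    σ.reg .pnt = [] → σ.reg .qry = [] →
    (test ws.length e).Exec (withAdvice φ₁ ws) σ (C * (S + 1))
      (σ.set .qry (φ₁ (queryWord (fun i => (digitSum i σ.path, n)) (n - e)))) := by
  refine ⟨80 * d * (D + 1) + 12 + 20 * e + 20 * h + 80, ?_⟩
  rintro ws rfl φ₁ S σ hi n hn E hE h1 h2 h3 h4 hpnt hqry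
  obtain ⟨hl, hb⟩ := exec_buildPoint true (withAdvice φ₁ ws) S σ hi hn E hE (by simp) h1 h2 h3
    hpnt (List.finRange d)
  simp only [convertValue, if_true, List.length_finRange] at hl hb
  rw [← pointCode_eq] at hl hb
  set w := pointCode fun i => (digitSum i σ.path, n) with hw
  have hu := length_unaryInt_le (n - e)
  set u := unaryInt (n - e) with hu_def
  have t2 := exec_levelDown (withAdvice φ₁ ws) e (σ := σ.set .pnt w) (n := n)
    ⟨by simpa using hn.1, by simpa using hn.2⟩
  have t3 := exec_emitLevel (withAdvice φ₁ ws) (hasLevel_setLevel (σ.set .pnt w) (n - e))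
    (by simp [setLevel, hi.aux]) (by simp [setLevel, hi.row])
  have t4 := (exec_mv .row (toReg .qry) (withAdvice φ₁ ws)
    ((setLevel (σ.set .pnt w) (n - e)).set .row u)).of_eq
    (σ' := (setLevel (σ.set .pnt w) (n - e)).set .qry u) (T' := u.length + 1) (by
      ext1
      · funext k
        cases k <;> simp [mvStore, toReg, setLevel, hi.row, hqry, hu_def, unaryInt_reverse]
      · rfl
      · rfl) (by simp)
  have t5 := (exec_levelUp (withAdvice φ₁ ws) e (n := n - e)
    (σ := (setLevel (σ.set .pnt w) (n - e)).set .qry u)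
    (by simp [HasLevel, setLevel])).of_eq (σ' := (σ.set .pnt w).set .qry u) (T' := 2 * e + 1) (by
      rw [sub_add_cancel]
      ext1
      · funext k
        cases k <;> simp [setLevel, hn.1, hn.2]
      · rfl
      · rfl) le_rfl
  have t6 := ((exec_mv .pnt (toReg .rev) (withAdvice φ₁ ws) ((σ.set .pnt w).set .qry u)).seq
    (exec_mv .rev (fun k => if k = .qry then some id else if k = .len then some fun _ => false
      else none) (withAdvice φ₁ ws) _)).of_eq
    (σ' := (σ.set .qry (w ++ u)).set .len (zeros w.length)) (T' := 2 * w.length + 3) (by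
      ext1
      · funext k
        cases k <;> simp [mvStore, toReg, hi.rev, hi.len, hpnt, zeros]
      · rfl
      · rfl) (by simp [mvStore, toReg, hi.rev]; omega)
  have t7 := exec_closePair (b := .qry) (by simp) (withAdvice φ₁ ws)
    ((σ.set .qry (w ++ u)).set .len (zeros w.length)) w u (by simp) (by simp)
  have t8 := exec_iter_pushLetter .qry (withAdvice φ₁ ws) ws.length
    ((((σ.set .qry (w ++ u)).set .len (zeros w.length)).set .qry (pairWord w u)).set .len [])
  have t9 := exec_ask (withAdvice φ₁ ws)
    (((((σ.set .qry (w ++ u)).set .len (zeros w.length)).set .qry (pairWord w u)).set .len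
    []).set .qry (zeros ws.length ++ pairWord w u))
  have t10 := exec_dropHeaders (withAdvice φ₁ ws) ws (φ₁ (pairWord w u))
    ((((((σ.set .qry (w ++ u)).set .len (zeros w.length)).set .qry (pairWord w u)).set .len
    []).set .qry (zeros ws.length ++ pairWord w u)).set .qry
      (withAdvice φ₁ ws (zeros ws.length ++ pairWord w u)))
      (by rw [withAdvice_apply]; simp)
  refine (hb.seq (t2.seq (t3.seq (t4.seq (t5.seq (t6.seq (t7.seq ((t8.of_eq ?_ le_rfl).seq
    (t9.seq t10))))))))).of_eq ?_ ?_
  · simp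
  · ext1
    · funext k
      cases k <;> simp [hi.len, hpnt, queryWord, hw, hu_def]
    · rfl
    · rfl
  · have e1 : d * (S + D + 1) ≤ d * ((D + 1) * (S + 1)) := Nat.mul_le_mul_left _ (by nlinarith)
    have e2 : (80 * d * (D + 1) + 12 + 20 * e + 20 * ws.length + 80) * (S + 1) =
      80 * (d * ((D + 1) * (S + 1))) + 92 * S + 92 + 20 * (e * S) + 20 * e + 20 * (ws.length * S)
        + 20 * ws.length := by ring
    rw [e2, mul_assoc 53]
    rw [mul_assoc 9] at hl
    generalize d * ((D + 1) * (S + 1)) = X at *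
    generalize d * (S + D + 1) = Y at *
    omega

end Frag

namespace Frag

variable {d D : ℕ}

/-! ### The search -/

/-- The automaton that replaces the extension, which consists of as many symbols of `path` as `ext`
holds letters, by its successor. -/
noncomputable def advanceStep : Bool → Tops (Fin d × Fin (2 * D)) →
    Option (Bool × StackOps (Fin d × Fin (2 * D)))
  | false, o => some <| if (o.reg .ext).isSome then
      match o.path with
      | some γ => if symbolRank γ + 1 = Fintype.card (Fin d × Fin (2 * D) → Bool) then
          (false, ⟨fun k => if k = .ext then (true, none) else if k = .cnt then (false, some false)
            else levelDown o k, (true, none), (false, none)⟩)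
        else (true, ⟨fun _ => (false, none), (true, some (nextSymbol γ)), (false, none)⟩)
      | none => (true, keepAll)
    else (true, ⟨fun k => if k = .ext then (false, some false) else levelUp o k,
      (false, some (firstSymbol _)), (false, none)⟩)
  | true, o => (o.reg .cnt).map fun _ => (true, ⟨fun k => if k = .ext then (false, some false) else
      if k = .cnt then (true, none) else levelUp o k,
      (false, some (firstSymbol _)), (false, none)⟩)

noncomputable def advance : Frag (Fin d × Fin (2 * D)) := auto Bool false advanceStep

lemma runs_advance_fill (φ : StrFun) (m : ℕ) (σ : Store (Fin d × Fin (2 * D))) (n : ℤ)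
    (hn : HasLevel σ n) (hm : σ.reg .cnt = zeros m) :
    (advance (d := d) (D := D)).Runs φ (some true) σ (m + 1)
      ((((setLevel σ (n + m)).set .cnt []).set .ext (zeros m ++ σ.reg .ext)).setPaths
        (List.replicate m (firstSymbol _) ++ σ.path) σ.tmp) := by
  induction m generalizing σ n with
  | zero =>
    have : ((((setLevel σ (n + (0 : ℕ))).set .cnt []).set .ext (zeros 0 ++ σ.reg .ext)).setPaths
        (List.replicate 0 (firstSymbol _) ++ σ.path) σ.tmp) = σ := by
      ext1
      · funext k
        cases k <;> simp [setLevel, hn.1, hn.2, hm]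
      · rfl
      · rfl
    rw [this]
    exact auto_stop (by simp [advanceStep, hm])
  | succ m ih =>
    let σ₁ := (((setLevel σ (n + 1)).set .cnt (zeros m)).set .ext (false :: σ.reg .ext)).setPaths
      (firstSymbol _ :: σ.path) σ.tmp
    have h := ih σ₁ (n + 1) (by simp [HasLevel, σ₁, setLevel]) (by simp [σ₁])
    have e : ((((setLevel σ₁ (n + 1 + m)).set .cnt []).set .ext (zeros m ++ σ₁.reg .ext)).setPaths
        (List.replicate m (firstSymbol _) ++ σ₁.path) σ₁.tmp) =
        ((((setLevel σ (n + (m + 1 : ℕ))).set .cnt []).set .ext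
          (zeros (m + 1) ++ σ.reg .ext)).setPaths
        (List.replicate (m + 1) (firstSymbol _) ++ σ.path) σ.tmp) := by
      ext1
      · funext k
        cases k <;> simp [σ₁, setLevel, zeros_append_cons] <;> congr 2 <;> ring
      · simp [σ₁, List.replicate_succ', List.append_assoc]
      · rfl
    rw [e] at h
    refine auto_next (o := ⟨fun k => if k = .ext then (false, some false) else
      if k = .cnt then (true, none) else levelUp σ.tops k,
      (false, some (firstSymbol _)), (false, none)⟩) (by simp [advanceStep, hm, zeros_succ]) ?_ h
    ext1
    · funext k
      have := runOp_levelUp hn k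
      cases k <;> simp [σ₁, hm, zeros_succ] at this ⊢ <;> exact this
    · rfl
    · rfl

/-- `m` counts the letters already popped because they were the last symbol of the alphabet. When
the carry stops, they are put back as first symbols by `runs_advance_fill`. -/
lemma runs_advance (φ : StrFun) (u p : List (Fin d × Fin (2 * D) → Bool)) (m : ℕ)
    (σ : Store (Fin d × Fin (2 * D))) (n : ℤ) (hn : HasLevel σ n) (hm : σ.reg .cnt = zeros m)
    (hp : σ.path = u ++ p) (hu : σ.reg .ext = zeros u.length) :
    ∃ t ≤ 2 * u.length + m + 2, (advance (d := d) (D := D)).Runs φ (some false) σ t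
      ((((setLevel σ (n + m + (nextWord u).length - u.length)).set .cnt []).set .ext
        (zeros (m + (nextWord u).length))).setPaths
        (List.replicate m (firstSymbol _) ++ nextWord u ++ p) σ.tmp) := by
  induction u generalizing σ n m with
  | nil =>
    let σ₁ := ((setLevel σ (n + 1)).set .ext [false]).setPaths
      (firstSymbol _ :: σ.path) σ.tmp
    have h := runs_advance_fill φ m σ₁ (n + 1) (by simp [HasLevel, σ₁, setLevel])
      (by simp [σ₁, setLevel, hm])
    have e : ((((setLevel σ₁ (n + 1 + m)).set .cnt []).set .ext (zeros m ++ σ₁.reg .ext)).setPaths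
        (List.replicate m (firstSymbol _) ++ σ₁.path) σ₁.tmp) =
        ((((setLevel σ (n + m + (nextWord ([] : List (Fin d × Fin (2 * D) → Bool))).length -
          ([] : List (Fin d × Fin (2 * D) → Bool)).length)).set .cnt []).set .ext
        (zeros (m + (nextWord ([] : List (Fin d × Fin (2 * D) → Bool))).length))).setPaths
        (List.replicate m (firstSymbol _) ++ nextWord [] ++ p) σ.tmp) := by
      ext1
      · funext k
        cases k <;> simp [σ₁, setLevel, nextWord, zeros_append_cons m []] <;> congr 2 <;> ring
      · simp [σ₁, nextWord, hp]
      · rfl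
    rw [e] at h
    refine ⟨m + 1 + 1, by simp, auto_next (o := ⟨fun k => if k = .ext then (false, some false) else
      levelUp σ.tops k,
      (false, some (firstSymbol _)), (false, none)⟩) (by simp [advanceStep, hu]) ?_ h⟩
    ext1
    · funext k
      have := runOp_levelUp hn k
      cases k <;> simp [σ₁, hu] at this ⊢ <;> exact this
    · rfl
    · rfl
  | cons γ u ih =>
    by_cases hγ : symbolRank γ + 1 = Fintype.card (Fin d × Fin (2 * D) → Bool)
    · rw [nextWord_cons_of_eq hγ]
      let σ₁ := (((setLevel σ (n - 1)).set .ext (zeros u.length)).set .cnt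
        (zeros (m + 1))).setPaths (u ++ p) σ.tmp
      obtain ⟨t, ht, h⟩ := ih (m + 1) σ₁ (n - 1) (by simp [HasLevel, σ₁, setLevel])
        (by simp [σ₁]) rfl (by simp [σ₁])
      refine ⟨t + 1, by rw [List.length_cons]; omega, auto_next (v' := false)
        (o := ⟨fun k => if k = .ext then (true, none) else
        if k = .cnt then (false, some false) else levelDown σ.tops k, (true, none), (false, none)⟩)
        (σ₁ := σ₁) ?_ ?_ ?_⟩
      · simp [advanceStep, hu, hp, zeros_succ, hγ]
      · ext1
        · funext k
          have := runOp_levelDown hn k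
          cases k <;> simp [σ₁, hu, hm, zeros_succ] at this ⊢ <;> exact this
        · simp [σ₁, hp]
        · rfl
      · change (advance (d := d) (D := D)).Runs _ _ _ _ _
        convert h using 1
        ext1
        · funext k
          cases k <;> simp [σ₁, setLevel] <;> congr 1 <;> omega
        · simp [σ₁, List.replicate_succ']
        · rfl
    · rw [nextWord_cons_of_ne hγ]
      let σ₁ := σ.setPaths (nextSymbol γ :: (u ++ p)) σ.tmp
      have h := runs_advance_fill φ m σ₁ n hn hm
      refine ⟨m + 1 + 1, by rw [List.length_cons]; omega, auto_next (v' := true)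
        (o := ⟨fun _ => (false, none), (true, some (nextSymbol γ)), (false, none)⟩)
        (σ₁ := σ₁) ?_ ?_ ?_⟩
      · simp [advanceStep, hu, hp, zeros_succ]
        simpa using hγ
      · ext1
        · funext k
          simp [σ₁]
        · simp [σ₁, hp]
        · rfl
      · change (advance (d := d) (D := D)).Runs _ _ _ _ _
        convert h using 1
        ext1
        · funext k
          cases k <;> simp [σ₁, setLevel, hu]
        · simp [σ₁]
        · rfl

/-! ### Padding of paths and bookkeeping of their lengths -/

/-- The symbol whose digits are all `0`. -/
def zeroDigit : Fin d × Fin (2 * D) → Bool := fun x => decide ((x.2 : ℕ) < D)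

lemma rowSum_zeroDigit (i : Fin d) : rowSum i (zeroDigit (d := d) (D := D)) = D := by
  have h : (Finset.univ.filter fun j : Fin (2 * D) => (j : ℕ) < D).card = D := by
    rw [Fin.card_filter_val_lt]
    omega
  conv_rhs => rw [← h, Finset.card_filter]
  refine Finset.sum_congr rfl fun j _ => ?_
  by_cases hj : (j : ℕ) < D <;> simp [zeroDigit, hj]

/-- Append as many digits `0` as `pad` holds letters. -/
def padIn : Frag (Fin d × Fin (2 * D)) := auto Unit () fun _ o => (o.reg .pad).map fun _ =>
  ((), ⟨fun k => if k = .pad then (true, none) else if k = .pds then (false, some false) else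
    levelUp o k, (false, some zeroDigit), (false, none)⟩)

/-- Undo `padIn`. -/
def padOut : Frag (Fin d × Fin (2 * D)) := auto Unit () fun _ o => (o.reg .pds).map fun _ =>
  ((), ⟨fun k => if k = .pds then (true, none) else if k = .pad then (false, some false) else
    levelDown o k, (true, none), (false, none)⟩)

lemma exec_padIn (φ : StrFun) (z : ℕ) (σ : Store (Fin d × Fin (2 * D))) (n : ℤ)
    (hn : HasLevel σ n) (hz : σ.reg .pad = zeros z) :
    (padIn (d := d) (D := D)).Exec φ σ (z + 1)
      ((((setLevel σ (n + z)).set .pad []).set .pds (zeros z ++ σ.reg .pds)).setPaths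
        (List.replicate z zeroDigit ++ σ.path) σ.tmp) := by
  refine Exec.of_auto ?_ le_rfl
  induction z generalizing σ n with
  | zero =>
    have : ((((setLevel σ (n + (0 : ℕ))).set .pad []).set .pds (zeros 0 ++ σ.reg .pds)).setPaths
        (List.replicate 0 zeroDigit ++ σ.path) σ.tmp) = σ := by
      ext1
      · funext k
        cases k <;> simp [setLevel, hn.1, hn.2, hz]
      · rfl
      · rfl
    rw [this]
    exact auto_stop (by simp [hz])
  | succ z ih =>
    let σ₁ := (((setLevel σ (n + 1)).set .pad (zeros z)).set .pds (false :: σ.reg .pds)).setPaths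
      (zeroDigit :: σ.path) σ.tmp
    have h := ih σ₁ (n + 1) (by simp [HasLevel, σ₁, setLevel]) (by simp [σ₁])
    have e : ((((setLevel σ₁ (n + 1 + z)).set .pad []).set .pds (zeros z ++ σ₁.reg .pds)).setPaths
        (List.replicate z zeroDigit ++ σ₁.path) σ₁.tmp) =
        ((((setLevel σ (n + (z + 1 : ℕ))).set .pad []).set .pds
          (zeros (z + 1) ++ σ.reg .pds)).setPaths
        (List.replicate (z + 1) zeroDigit ++ σ.path) σ.tmp) := by
      ext1
      · funext k
        cases k <;> simp [σ₁, setLevel, zeros_append_cons] <;> congr 1 <;> omega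
      · simp [σ₁, List.replicate_succ', List.append_assoc]
      · rfl
    rw [e] at h
    refine auto_next (v' := ()) (o := ⟨fun k => if k = .pad then (true, none) else
      if k = .pds then (false, some false) else
      levelUp σ.tops k, (false, some zeroDigit), (false, none)⟩) (by simp [hz, zeros_succ]) ?_ h
    ext1
    · funext k
      have := runOp_levelUp hn k
      cases k <;> simp [σ₁, hz, zeros_succ] at this ⊢ <;> exact this
    · rfl
    · rfl

lemma exec_padOut (φ : StrFun) (z : ℕ) (σ : Store (Fin d × Fin (2 * D))) (n : ℤ)
    (hn : HasLevel σ n) (hz : σ.reg .pds = zeros z) :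
    (padOut (d := d) (D := D)).Exec φ σ (z + 1)
      ((((setLevel σ (n - z)).set .pds []).set .pad (zeros z ++ σ.reg .pad)).setPaths
        (σ.path.drop z) σ.tmp) := by
  refine Exec.of_auto ?_ le_rfl
  induction z generalizing σ n with
  | zero =>
    have : ((((setLevel σ (n - (0 : ℕ))).set .pds []).set .pad (zeros 0 ++ σ.reg .pad)).setPaths
        (σ.path.drop 0) σ.tmp) = σ := by
      ext1
      · funext k
        cases k <;> simp [setLevel, hn.1, hn.2, hz]
      · rfl
      · rfl
    rw [this]
    exact auto_stop (by simp [hz])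
  | succ z ih =>
    let σ₁ := (((setLevel σ (n - 1)).set .pds (zeros z)).set .pad (false :: σ.reg .pad)).setPaths
      σ.path.tail σ.tmp
    have h := ih σ₁ (n - 1) (by simp [HasLevel, σ₁, setLevel]) (by simp [σ₁])
    have e : ((((setLevel σ₁ (n - 1 - z)).set .pds []).set .pad (zeros z ++ σ₁.reg .pad)).setPaths
        (σ₁.path.drop z) σ₁.tmp) =
        ((((setLevel σ (n - (z + 1 : ℕ))).set .pds []).set .pad
          (zeros (z + 1) ++ σ.reg .pad)).setPaths (σ.path.drop (z + 1)) σ.tmp) := by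
      ext1
      · funext k
        cases k <;> simp [σ₁, setLevel, zeros_append_cons] <;> congr 1 <;> omega
      · simp [σ₁]
      · rfl
    rw [e] at h
    refine auto_next (v' := ()) (o := ⟨fun k => if k = .pds then (true, none) else
      if k = .pad then (false, some false) else
      levelDown σ.tops k, (true, none), (false, none)⟩) (by simp [hz, zeros_succ]) ?_ h
    ext1
    · funext k
      have := runOp_levelDown hn k
      cases k <;> simp [σ₁, hz, zeros_succ] at this ⊢ <;> exact this
    · rfl
    · rfl

lemma zeros_eq_nil (n : ℕ) : zeros n = [] ↔ n = 0 := by simp [zeros]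

/-- Remove a letter from `rem`, or add one to `drp` if there is none. -/
def account {J : Type} (o : Tops J) (k : Reg) : StackOp Bool :=
  if k = .drp then (false, if (o.reg .rem).isSome then none else some false)
  else if k = .rem then (true, none) else (false, none)

/-- Account for the length of the extension and the padding. -/
def settle : Frag (Fin d × Fin (2 * D)) := auto Unit () fun _ o =>
  if (o.reg .ext).isSome then some ((),
    { reg := fun k => if k = .ext then (true, none) else account o k })
  else (o.reg .pds).map fun _ => ((), { reg := fun k => if k = .pds then (true, none) else
    if k = .pad then (false, some false) else account o k })

/-- The `a + z` new digits first serve the `R` missing ones and only then count as superfluous; the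
two truncated subtractions express this split. The padding length is restored for the next round. -/
lemma exec_settle (φ : StrFun) (a z R E : ℕ) (σ : Store (Fin d × Fin (2 * D)))
    (ha : σ.reg .ext = zeros a) (hz : σ.reg .pds = zeros z) (hR : σ.reg .rem = zeros R)
    (hE : σ.reg .drp = zeros E) :
    (settle (d := d) (D := D)).Exec φ σ (a + z + 1)
      (((((σ.set .ext []).set .pds []).set .pad (zeros z ++ σ.reg .pad)).set .rem
        (zeros (R - (a + z)))).set .drp (zeros (E + (a + z - R)))) := by
  refine Exec.of_auto ?_ le_rfl
  induction a generalizing σ R E with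
  | zero =>
    induction z generalizing σ R E with
    | zero =>
      have : (((((σ.set .ext []).set .pds []).set .pad (zeros 0 ++ σ.reg .pad)).set .rem
          (zeros (R - (0 + 0)))).set .drp (zeros (E + (0 + 0 - R)))) = σ := by
        ext1
        · funext k
          cases k <;> simp [ha, hz, hR, hE]
        · rfl
        · rfl
      rw [this]
      exact auto_stop (by simp [hz, ha])
    | succ z ih =>
      let σ₁ := (((σ.set .pds (zeros z)).set .pad (false :: σ.reg .pad)).set .rem
        (zeros (R - 1))).set .drp (zeros (E + (1 - R)))
      have h := ih (R - 1) (E + (1 - R)) σ₁ (by simp [σ₁, ha]) (by simp [σ₁]) (by simp [σ₁])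
        (by simp [σ₁])
      rw [show 0 + (z + 1) + 1 = 0 + z + 1 + 1 by ring]
      refine auto_next (v' := ()) (o := { reg := fun k => if k = .pds then (true, none) else
        if k = .pad then (false, some false) else account σ.tops k })
        (by simp [hz, ha, zeros_succ]) (σ₁ := σ₁) ?_ ?_
      · ext1
        · funext k
          cases k <;> simp [σ₁, hz, hR, hE, zeros_succ, account, zeros_tail]
          rcases Nat.eq_zero_or_pos R with rfl | hR'
          · simp [zeros_succ]
          · simp [zeros_eq_nil, hR'.ne', Nat.sub_eq_zero_of_le hR']
        · rfl
        · rfl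
      · convert h using 1
        ext1
        · funext k
          cases k <;> simp [σ₁, zeros_append_cons] <;> congr 1 <;> omega
        · rfl
        · rfl
  | succ a ih =>
    let σ₁ := ((σ.set .ext (zeros a)).set .rem (zeros (R - 1))).set .drp (zeros (E + (1 - R)))
    have h := ih (R - 1) (E + (1 - R)) σ₁ (by simp [σ₁]) (by simp [σ₁, hz]) (by simp [σ₁])
      (by simp [σ₁])
    rw [show a + 1 + z + 1 = a + z + 1 + 1 by ring]
    refine auto_next (v' := ()) (o := ⟨fun k => if k = .ext then (true, none) else
      account σ.tops k, (false, none), (false, none)⟩)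
      (by simp [ha, zeros_succ]) (σ₁ := σ₁) ?_ ?_
    · ext1
      · funext k
        cases k <;> simp [σ₁, ha, hR, hE, zeros_succ, account, zeros_tail]
        rcases Nat.eq_zero_or_pos R with rfl | hR'
        · simp [zeros_succ]
        · simp [zeros_eq_nil, hR'.ne', Nat.sub_eq_zero_of_le hR']
      · rfl
      · rfl
    · convert h using 1
      ext1
      · funext k
        cases k <;> simp [σ₁] <;> congr 1 <;> omega
      · rfl
      · rfl

end Frag

/-! ### One round of the search, its initialization and the output -/

namespace Frag

variable {d D : ℕ}

/-- The store during the search for a point: `n` is the output precision, `z` the length of the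
padding, `β` the length of the outer radius parameter, `p` the current path, `u` its extension, `R`
the number of missing digits and `E` the number of superfluous digits. -/
def searchStore (n z β : ℕ) (u p : List (Fin d × Fin (2 * D) → Bool)) (R E : ℕ) :
    Store (Fin d × Fin (2 * D)) where
  reg
    | .num => zeros n
    | .pad => zeros z
    | .pos => zeros ((u.length + p.length : ℤ) - β).toNat
    | .neg => zeros (-((u.length + p.length : ℤ) - β)).toNat
    | .ext => zeros u.length
    | .rem => zeros R
    | .drp => zeros E
    | _ => []
  path := u ++ p
  tmp := []

/-- The oracle answers that the ball around the point with digits `p` meets the set. -/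
def Accepts (φ : StrFun) (β e : ℕ) (p : List (Fin d × Fin (2 * D) → Bool)) : Prop :=
  φ (queryWord (fun i => (digitSum i p, (p.length : ℤ) - β)) ((p.length : ℤ) - β - e)) = [true]

/-- The path extended by `u` and the padding. -/
def padded (z : ℕ) (u p : List (Fin d × Fin (2 * D) → Bool)) :
    List (Fin d × Fin (2 * D) → Bool) := List.replicate z zeroDigit ++ (u ++ p)

/-- One round of the search. -/
noncomputable def searchRound (h e : ℕ) : Frag (Fin d × Fin (2 * D)) :=
  advance.seq <| padIn.seq <| (test h e).seq <|
  (cond (fun o => o.reg .qry == some true) settle padOut).seq (mv .qry fun _ => none)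

/-- An accepted extension, with its padding, becomes part of the path, and the next extension starts
from the empty word. A rejected one only loses its padding, so that the next round can replace it by
its successor. -/
lemma exec_searchRound (h e : ℕ) : ∃ C, ∀ ws : List Word, ws.length = h →
    ∀ (φ₁ : StrFun), IsPredicate φ₁ →
    ∀ (n z β : ℕ) (u p : List (Fin d × Fin (2 * D) → Bool)) (R E S : ℕ),
    u.length + 1 + p.length + z + β ≤ S → E ≤ S → totalLength ws ≤ S →
    (Accepts φ₁ β e (padded z (nextWord u) p) →
      (searchRound ws.length e).Exec (withAdvice φ₁ ws) (searchStore n z β u p R E) (C * (S + 1))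
        (searchStore n z β [] (padded z (nextWord u) p) (R - ((nextWord u).length + z))
          (E + ((nextWord u).length + z - R)))) ∧
    (¬ Accepts φ₁ β e (padded z (nextWord u) p) →
      (searchRound ws.length e).Exec (withAdvice φ₁ ws) (searchStore n z β u p R E) (C * (S + 1))
        (searchStore n z β (nextWord u) p R E)) := by
  obtain ⟨C, hC⟩ := exec_test (d := d) (D := D) h e
  refine ⟨C + 30, fun ws hws φ₁ hφ₁ n z β u p R E S hS hE hw => ?_⟩
  subst hws
  set φ := withAdvice φ₁ ws with hφ
  set v := nextWord u with hv
  have hvl := length_le_length_nextWord u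
  rw [← hv] at hvl
  obtain ⟨t, ht, h1⟩ := runs_advance φ u p 0 (searchStore n z β u p R E)
    ((u.length + p.length : ℤ) - β) ⟨rfl, rfl⟩ rfl rfl rfl
  have h1' : advance.Exec φ (searchStore n z β u p R E) (2 * u.length + 2)
      (searchStore n z β v p R E) := (Exec.of_auto h1 (by omega)).of_eq (by
    ext1
    · funext k
      cases k <;> simp [searchStore, setLevel, ← hv] <;> congr 1 <;> omega
    · simp [searchStore, ← hv]
    · rfl) le_rfl
  set q := padded z v p with hq
  have hql : q.length = z + (v.length + p.length) := by simp [hq, padded]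
  let σ₂ : Store (Fin d × Fin (2 * D)) := ((((searchStore n z β [] q R E).set .pad []).set .pds
    (zeros z)).set .ext (zeros v.length))
  have h2 : padIn.Exec φ (searchStore n z β v p R E) (z + 1) σ₂ :=
    (exec_padIn φ z _ ((v.length + p.length : ℤ) - β) ⟨rfl, rfl⟩ rfl).of_eq (by
      ext1
      · funext k
        cases k <;> simp [searchStore, setLevel, σ₂, hql] <;> congr 1 <;> omega
      · simp [searchStore, hq, padded, σ₂]
      · rfl) le_rfl
  have h3 := hC ws rfl φ₁ S σ₂ (by constructor <;> simp [σ₂, searchStore]) ((q.length : ℤ) - β)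
    (by simp [HasLevel, σ₂, searchStore]) E (by simp [σ₂, searchStore])
    (by simp only [σ₂, Store.set_path, searchStore, List.nil_append]; omega) (by omega) hE hw
    (by simp [σ₂, searchStore]) (by simp [σ₂, searchStore])
  have hσ₂p : σ₂.path = q := rfl
  rw [hσ₂p] at h3
  set b := φ₁ (queryWord (fun i => (digitSum i q, (q.length : ℤ) - β))
    ((q.length : ℤ) - β - e)) with hb
  have hlev : HasLevel (σ₂.set .qry b) ((q.length : ℤ) - β) := by
    simp [HasLevel, σ₂, searchStore]
  -- The answer is a single letter, so clearing the query tape takes constant time.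
  have hbl : b.length = 1 := by rcases hφ₁ (queryWord (fun i => (digitSum i q, (q.length : ℤ) - β))
    ((q.length : ℤ) - β - e)) with h | h <;> rw [hb, h] <;> rfl
  have htime : 2 * u.length + 2 + 1 + (z + 1 + 1 + (C * (S + 1) + 1 +
      (v.length + z + 1 + 1 + 1 + (1 + 1)))) ≤ (C + 30) * (S + 1) := by
    rw [add_mul]
    omega
  constructor
  · intro hacc
    have hb' : b = [true] := hacc
    have h4 := Exec.cond_true (c := fun o : Tops (Fin d × Fin (2 * D)) => o.reg .qry == some true)
      (F := settle) (G := padOut) (φ := φ) (σ := σ₂.set .qry b) (by simp [hb'])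
      (exec_settle φ v.length z R E (σ₂.set .qry b) (by simp [σ₂]) (by simp [σ₂])
        (by simp [σ₂, searchStore]) (by simp [σ₂, searchStore]))
    refine (h1'.seq (h2.seq (h3.seq (h4.seq (exec_mv .qry (fun _ => none) φ _))))).of_eq ?_ ?_
    · ext1
      · funext k
        cases k <;> simp [mvStore, σ₂, searchStore]
      · rfl
      · rfl
    · simpa [hbl] using htime
  · intro hacc
    have hb' : ¬ b = [true] := hacc
    have hb'' : b = [false] := (hφ₁ _).resolve_right hb'
    have h4 := Exec.cond_false (c := fun o : Tops (Fin d × Fin (2 * D)) => o.reg .qry == some true)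
      (F := settle) (G := padOut) (φ := φ) (σ := σ₂.set .qry b) (by simp [hb''])
      (exec_padOut φ z (σ₂.set .qry b) _ hlev (by simp [σ₂]))
    refine (h1'.seq (h2.seq (h3.seq (h4.seq (exec_mv .qry (fun _ => none) φ _))))).of_eq ?_ ?_
    · ext1
      · funext k
        cases k <;> simp [mvStore, σ₂, searchStore, setLevel] <;> congr 1 <;> omega
      · simp [mvStore, σ₂, searchStore, hq, padded]
      · rfl
    · refine le_trans ?_ htime
      simp [hbl, setLevel]

/-- The search. -/
noncomputable def search (h e : ℕ) : Frag (Fin d × Fin (2 * D)) :=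
  loop (fun o => (o.reg .rem).isSome) (searchRound h e)

/-! ### Initialization and output -/

/-- Read the outer radius parameter from the query tape. -/
def readRadius (padding : Bool) : Frag (Fin d × Fin (2 * D)) := auto Unit () fun _ o =>
  if o.reg .qry = some false then some ((), { reg := fun k =>
    if k = .qry then (true, none) else if k = .neg ∨ k = .rem ∨ (k = .pad ∧ padding = true) then
      (false, some false) else (false, none) })
  else none

lemma exec_readRadius (padding : Bool) (φ : StrFun) (β : ℕ) (w : Word)
    (σ : Store (Fin d × Fin (2 * D))) (hσ : σ.reg .qry = zeros β ++ true :: w) :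
    (readRadius (d := d) (D := D) padding).Exec φ σ (β + 1)
      ((((σ.set .qry (true :: w)).set .neg (zeros β ++ σ.reg .neg)).set .rem
        (zeros β ++ σ.reg .rem)).set .pad
          ((if padding then zeros β else []) ++ σ.reg .pad)) := by
  refine Exec.of_auto ?_ le_rfl
  induction β generalizing σ with
  | zero =>
    have : ((((σ.set .qry (true :: w)).set .neg (zeros 0 ++ σ.reg .neg)).set .rem
        (zeros 0 ++ σ.reg .rem)).set .pad
          ((if padding then zeros 0 else []) ++ σ.reg .pad)) = σ := by
      ext1
      · funext k
        cases k <;> simp [hσ]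
      · rfl
      · rfl
    rw [this]
    exact auto_stop (by simp [hσ])
  | succ β ih =>
    let σ₁ := ((((σ.set .qry (zeros β ++ true :: w)).set .neg (false :: σ.reg .neg)).set .rem
        (false :: σ.reg .rem)).set .pad ((if padding then [false] else []) ++ σ.reg .pad))
    refine auto_next (v' := ()) (o := { reg := fun k =>
      if k = .qry then (true, none) else if k = .neg ∨ k = .rem ∨ (k = .pad ∧ padding = true) then
      (false, some false) else (false, none) }) (σ₁ := σ₁) (by simp [hσ, zeros_succ]) ?_ ?_
    · ext1
      · funext k
        cases k <;> simp [σ₁, hσ, zeros_succ]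
        cases padding <;> simp
      · rfl
      · rfl
    · convert ih σ₁ (by simp [σ₁]) using 1
      ext1
      · funext k
        cases k <;> simp [σ₁, zeros_append_cons]
        cases padding <;> simp [zeros_append_cons]
      · rfl
      · rfl

/-- Initialize the search. -/
def initSearch (h R₀ : ℕ) (padding : Bool) : Frag (Fin d × Fin (2 * D)) :=
  (iter (pushLetter .qry false) h).seq <| ask.seq <| (readRadius padding).seq <|
  (mv .qry fun _ => none).seq <|
  (mv .inp (zerosTo (if padding then [.num, .rem, .pad] else [.num, .rem]))).seq <|
  (iter (pushLetter .rem false) R₀).seq <|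
  (iter (pushLetter .pad false) (if padding then R₀ else 0)).seq
  (iter (pushLetter .drp false) (R₀ - 1))

lemma replicate_false (n : ℕ) : List.replicate n false = zeros n := rfl

lemma length_adviceHeader (ws : List Word) :
    (adviceHeader ws).length = totalLength ws + ws.length := by
  induction ws with
  | nil => rfl
  | cons w ws ih =>
    simp only [adviceHeader, List.length_append, length_zeros, List.length_cons, ih, totalLength,
      List.map_cons, List.sum_cons]
    ring

/-- One query suffices, since the header of its answer begins with the length `β` of `w₀` in unary.
The level starts at `-β`, which makes the first grid width `2 ^ β`. Of the `R₀` guard digits beyond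
the output precision, one is the rounding digit that `convert` drops by itself, whence `R₀ - 1`. -/
lemma exec_initSearch (w₀ : Word) (ws : List Word) (R₀ : ℕ) (padding : Bool) (φ₁ : StrFun)
    (hφ₁ : IsPredicate φ₁) (s : Word) :
    (initSearch (d := d) (D := D) (ws.length + 1) R₀ padding).Exec (withAdvice φ₁ (w₀ :: ws))
      (inputStore s) (2 * totalLength (w₀ :: ws) + 4 * ws.length + s.length + 6 * R₀ + 40)
      (searchStore s.length (if padding then s.length + w₀.length + R₀ else 0) w₀.length [] []
        (s.length + w₀.length + R₀) (R₀ - 1)) := by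
  set φ := withAdvice φ₁ (w₀ :: ws) with hφ
  have h1 := exec_iter_pushLetter .qry φ (ws.length + 1)
    (inputStore s : Store (Fin d × Fin (2 * D)))
  let σ₁ : Store (Fin d × Fin (2 * D)) := (inputStore s).set .qry (zeros (ws.length + 1) ++ [])
  have h1' := h1.of_eq (σ' := σ₁) rfl le_rfl
  let w := adviceHeader ws ++ φ₁ []
  have h2 : ask.Exec φ σ₁ 1 (σ₁.set .qry (zeros w₀.length ++ true :: w)) :=
    (exec_ask φ σ₁).of_eq (by
      have := withAdvice_apply φ₁ (w₀ :: ws) []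
      rw [List.length_cons] at this
      simp only [σ₁, Store.set_reg, if_true]
      rw [hφ, this]
      simp [adviceHeader, w]) le_rfl
  have h3 := exec_readRadius padding φ w₀.length w (σ := σ₁.set .qry
    (zeros w₀.length ++ true :: w)) (by simp)
  have hlen : (φ₁ []).length = 1 := by rcases hφ₁ [] with h | h <;> rw [h] <;> rfl
  refine (h1'.seq (h2.seq (h3.seq ((exec_mv .qry (fun _ => none) φ _).seq
    ((exec_mv .inp (zerosTo (if padding then [.num, .rem, .pad] else [.num, .rem])) φ _).seq
    ((exec_iter_pushLetter .rem φ R₀ _).seq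
    ((exec_iter_pushLetter .pad φ (if padding then R₀ else 0) _).seq
    (exec_iter_pushLetter .drp φ (R₀ - 1) _)))))))).of_eq ?_ ?_
  · ext1
    · funext k
      cases padding <;> cases k <;>
        simp [σ₁, searchStore, inputStore, mvStore, zerosTo, replicate_false] <;>
        (congr 1; omega)
    · rfl
    · rfl
  · have hw := length_adviceHeader ws
    have ht : totalLength (w₀ :: ws) = w₀.length + totalLength ws := by simp [totalLength]
    cases padding <;> simp [mvStore, σ₁, inputStore, w, hlen] <;> omega

/-- Round the point and write its code to the output tape. -/
def output : Frag (Fin d × Fin (2 * D)) :=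
  (mv .pos fun _ => none).seq <| (mv .neg fun _ => none).seq <| (mv .num (toReg .pos)).seq <|
  (buildPoint false (List.finRange d)).seq <| (mv .pnt (toReg .rev)).seq (mv .rev (toReg .out))

/-- Dropping `E + 1` digits moves the number to the output precision, so `n` takes the place of the
level before the code is written. -/
lemma exec_output (φ : StrFun) (n z β : ℕ) (p : List (Fin d × Fin (2 * D) → Bool)) (E S : ℕ)
    (hE : E + 1 ≤ p.length) (hS : p.length + n + β ≤ S) :
    ∃ σ', (output (d := d) (D := D)).Exec φ (searchStore n z β [] p 0 E)
        ((80 * d * (D + 1) + 40) * (S + 1)) σ' ∧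
      σ'.reg .out = pointCode fun i => (convertValue i false E p, (n : ℤ)) := by
  let σ₁ : Store (Fin d × Fin (2 * D)) :=
    (((searchStore n z β [] p 0 E).set .pos (zeros n)).set .neg []).set .num []
  have h1 := (((exec_mv .pos (fun _ => none) φ (searchStore n z β [] p 0 E)))).of_eq
    (σ' := (searchStore n z β [] p 0 E).set .pos []) (T' := S + 1) (by
      ext1
      · funext k
        cases k <;> simp [mvStore]
      · rfl
      · rfl) (by simp [searchStore]; omega)
  have h2 := (((exec_mv .neg (fun _ => none) φ ((searchStore n z β [] p 0 E).set .pos [])))).of_eq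
    (σ' := ((searchStore n z β [] p 0 E).set .pos []).set .neg []) (T' := S + 1) (by
      ext1
      · funext k
        cases k <;> simp [mvStore]
      · rfl
      · rfl) (by simp [searchStore]; omega)
  have h3 := (((exec_mv .num (toReg .pos) φ
    (((searchStore n z β [] p 0 E).set .pos []).set .neg [])))).of_eq
    (σ' := σ₁) (T' := S + 1) (by
      ext1
      · funext k
        cases k <;> simp [mvStore, toReg, σ₁, searchStore]
      · rfl
      · rfl) (by simp [searchStore]; omega)
  obtain ⟨h4, h5⟩ := exec_buildPoint false φ S σ₁ (by constructor <;> simp [σ₁, searchStore])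
    (n := n) (by simp [HasLevel, σ₁]) E (by simp [σ₁, searchStore])
    (by simpa [σ₁, searchStore] using hE) (by simp [σ₁, searchStore]; omega) (by simp; omega)
    (by omega) (by simp [σ₁, searchStore]) (List.finRange d)
  have hp : σ₁.path = p := rfl
  rw [hp, ← pointCode_eq, List.length_finRange] at h4 h5
  refine ⟨_, (h1.seq (h2.seq (h3.seq (h5.seq ((exec_mv .pnt (toReg .rev) φ _).seq
    (exec_mv .rev (toReg .out) φ _)))))).of_eq rfl ?_, ?_⟩
  · simp [mvStore, toReg, σ₁, searchStore]
    have e1 : d * (S + D + 1) ≤ d * ((D + 1) * (S + 1)) := Nat.mul_le_mul_left _ (by nlinarith)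
    have e2 : (80 * d * (D + 1) + 40) * (S + 1) =
      80 * (d * ((D + 1) * (S + 1))) + 40 * (S + 1) := by ring
    rw [e2, mul_assoc 53]
    rw [mul_assoc 9] at h4
    generalize d * ((D + 1) * (S + 1)) = X at *
    generalize d * (S + D + 1) = Y at *
    omega
  · simp [mvStore, toReg, σ₁, searchStore]

/-- The machine that finds a point and outputs an approximation to it. -/
noncomputable def findPoint (h e R₀ : ℕ) (padding : Bool) : Frag (Fin d × Fin (2 * D)) :=
  (initSearch h R₀ padding).seq ((search h e).seq output)

end Frag

/-! ### The course of the search: termination, running time and the paths visited -/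

namespace Frag

variable {d D : ℕ}

/-- The path extended by padding and the first extension with property `P`. -/
noncomputable def nextPath (P : List (Fin d × Fin (2 * D) → Bool) → Prop) (z : ℕ)
    (p : List (Fin d × Fin (2 * D) → Bool)) : List (Fin d × Fin (2 * D) → Bool) :=
  open Classical in
  if h : ∃ m, P (padded z (nextWord^[m + 1] []) p) then
    padded z (nextWord^[Nat.find h + 1] []) p else p

lemma length_iterate_nextWord_mono (i j : ℕ) (h : i ≤ j) :
    (nextWord^[i] ([] : List (Fin d × Fin (2 * D) → Bool))).length ≤
      (nextWord^[j] ([] : List (Fin d × Fin (2 * D) → Bool))).length := by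
  refine monotone_nat_of_le_succ (f := fun i =>
    (nextWord^[i] ([] : List (Fin d × Fin (2 * D) → Bool))).length) (fun i => ?_) h
  simp only [Function.iterate_succ_apply']
  exact (length_le_length_nextWord _).1

/-- The enumeration reaches `u` after `wordRank u` steps and lengths never decrease along it, so the
first hit comes no later and is no longer than `u`. The shift `m + 1` excludes the empty extension,
whence each hit makes the path grow. -/
lemma nextPath_spec (P : List (Fin d × Fin (2 * D) → Bool) → Prop) (z : ℕ)
    (p u : List (Fin d × Fin (2 * D) → Bool)) (hu : u ≠ []) (h : P (padded z u p)) :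
    ∃ m, nextPath P z p = padded z (nextWord^[m + 1] []) p ∧
      P (padded z (nextWord^[m + 1] []) p) ∧
      (∀ i < m, ¬ P (padded z (nextWord^[i + 1] []) p)) ∧ m + 1 ≤ wordRank u ∧
      (nextWord^[m + 1] ([] : List (Fin d × Fin (2 * D) → Bool))).length ≤ u.length ∧
      1 ≤ (nextWord^[m + 1] ([] : List (Fin d × Fin (2 * D) → Bool))).length := by
  classical
  obtain ⟨r, hr⟩ : ∃ r, wordRank u = r + 1 := by
    cases u with
    | nil => exact absurd rfl hu
    | cons γ u => exact ⟨_, rfl⟩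
  have hur : nextWord^[r + 1] [] = u := by rw [← hr, iterate_nextWord]
  have hex : ∃ m, P (padded z (nextWord^[m + 1] []) p) := ⟨r, by rwa [hur]⟩
  have hle : Nat.find hex ≤ r := Nat.find_min' hex (by rwa [hur])
  refine ⟨Nat.find hex, ?_, Nat.find_spec hex, fun i hi => Nat.find_min hex hi, by omega, ?_, ?_⟩
  · rw [nextPath, dif_pos hex]
  · exact (length_iterate_nextWord_mono _ _ (Nat.succ_le_succ hle)).trans_eq (by rw [hur])
  · rw [Function.iterate_succ_apply']
    exact List.length_pos_of_ne_nil (nextWord_ne_nil _)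

lemma length_padded (z : ℕ) (u p : List (Fin d × Fin (2 * D) → Bool)) :
    (padded z u p).length = z + u.length + p.length := by
  simp [padded]
  ring

/-- The search finds the first extension that the oracle accepts. -/
lemma exec_search_next (h e : ℕ) : ∃ C, ∀ ws : List Word, ws.length = h →
    ∀ (φ₁ : StrFun), IsPredicate φ₁ →
    ∀ (n z β : ℕ) (p : List (Fin d × Fin (2 * D) → Bool)) (R E S : ℕ),
    ∀ u : List (Fin d × Fin (2 * D) → Bool), u ≠ [] → Accepts φ₁ β e (padded z u p) →
    u.length + 1 + p.length + z + β ≤ S → E ≤ S → totalLength ws ≤ S → 0 < R → ∀ T σ',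
    (search ws.length e).Exec (withAdvice φ₁ ws)
      (searchStore n z β [] (nextPath (Accepts φ₁ β e) z p)
        (R - ((nextPath (Accepts φ₁ β e) z p).length - p.length))
        (E + ((nextPath (Accepts φ₁ β e) z p).length - p.length - R))) T σ' →
    (search ws.length e).Exec (withAdvice φ₁ ws) (searchStore n z β [] p R E)
      (wordRank u * (C * (S + 1)) + T) σ' := by
  obtain ⟨C, hC⟩ := exec_searchRound (d := d) (D := D) h e
  refine ⟨C + 2, ?_⟩
  rintro ws rfl φ₁ hφ₁ n z β p R E S u hu hacc hS hE hw hR T σ' hT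
  obtain ⟨m, h1, h2, h3, h4, h5, -⟩ := nextPath_spec (Accepts φ₁ β e) z p u hu hacc
  rw [h1, length_padded] at hT
  have hcost : C * (S + 1) + 2 ≤ (C + 2) * (S + 1) := by nlinarith
  have hcond : ∀ v : List (Fin d × Fin (2 * D) → Bool),
      (fun o : Tops (Fin d × Fin (2 * D)) => (o.reg .rem).isSome)
        (searchStore n z β v p R E).tops = true := by
    intro v
    simp only [Store.tops_reg, searchStore, zeros_isSome, hR, decide_true]
  -- Induction on the number `j` of rejections still ahead of the first acceptance.
  have key : ∀ j i, i + j = m → (search ws.length e).Exec (withAdvice φ₁ ws)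
      (searchStore n z β (nextWord^[i] []) p R E) ((j + 1) * ((C + 2) * (S + 1)) + T) σ' := by
    intro j
    induction j with
    | zero =>
      intro i hi
      obtain rfl : i = m := by omega
      have hl := length_iterate_nextWord_mono (d := d) (D := D) i (i + 1) (by omega)
      obtain ⟨hy, -⟩ := hC ws rfl φ₁ hφ₁ n z β (nextWord^[i] []) p R E S (by omega) hE hw
      rw [← Function.iterate_succ_apply' nextWord] at hy
      have hl2 : z + (nextWord^[i + 1] ([] : List (Fin d × Fin (2 * D) → Bool))).length +
          p.length - p.length =
          (nextWord^[i + 1] ([] : List (Fin d × Fin (2 * D) → Bool))).length + z := by omega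
      rw [hl2] at hT
      refine (Exec.loop_next (hcond _) (hy h2) hT).mono ?_
      omega
    | succ j ih =>
      intro i hi
      have hl := length_iterate_nextWord_mono (d := d) (D := D) i (m + 1) (by omega)
      obtain ⟨-, hn⟩ := hC ws rfl φ₁ hφ₁ n z β (nextWord^[i] []) p R E S (by omega) hE hw
      rw [← Function.iterate_succ_apply' nextWord] at hn
      refine (Exec.loop_next (hcond _) (hn (h3 i (by omega)))
        (ih (i + 1) (by omega))).of_eq rfl ?_
      rw [add_mul (j + 1) 1]
      omega
  refine (key m 0 (by omega)).mono ?_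
  have := Nat.mul_le_mul_right ((C + 2) * (S + 1)) h4
  omega

/-- The search for a point without padding stops at one of the iterates of `nextPath`. -/
lemma exec_search_iterate (h e R₀ : ℕ) : ∃ C, ∀ ws : List Word, ws.length = h →
    ∀ (φ₁ : StrFun), IsPredicate φ₁ →
    ∀ (n β : ℕ) (G : List (Fin d × Fin (2 * D) → Bool) → Prop), G [] →
    (∀ p, Accepts φ₁ β e p → G p) → (∀ p, G p → ∃ u, u ≠ [] ∧ Accepts φ₁ β e (u ++ p)) →
    ∃ (k T : ℕ), n + β + R₀ ≤ ((nextPath (d := d) (D := D) (Accepts φ₁ β e) 0)^[k] []).length ∧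
    (search ws.length e).Exec (withAdvice φ₁ ws) (searchStore n 0 β [] [] (n + β + R₀) (R₀ - 1))
      T (searchStore n 0 β [] ((nextPath (d := d) (D := D) (Accepts φ₁ β e) 0)^[k] []) 0
        (R₀ - 1 + (((nextPath (d := d) (D := D) (Accepts φ₁ β e) 0)^[k] []).length -
          (n + β + R₀)))) ∧
    ((∀ p, G p → ∃ γ, Accepts φ₁ β e (γ :: p)) →
      ((nextPath (d := d) (D := D) (Accepts φ₁ β e) 0)^[k] []).length ≤ n + β + R₀ ∧
      ∀ S, n + 2 * β + 2 * R₀ + 2 ≤ S → totalLength ws ≤ S → T ≤ (S + 1) * (C * (S + 1))) := by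
  obtain ⟨C, hC⟩ := exec_search_next (d := d) (D := D) h e
  set A := Fintype.card (Fin d × Fin (2 * D) → Bool) with hA
  refine ⟨A * C + 1, ?_⟩
  rintro ws rfl φ₁ hφ₁ n β G hG₀ hG hnext
  set b := nextPath (d := d) (D := D) (Accepts φ₁ β e) 0 with hb
  have hGb : ∀ k, G (b^[k] []) := by
    intro k
    induction k with
    | zero => exact hG₀
    | succ k ih =>
      obtain ⟨u, hu, ha⟩ := hnext _ ih
      obtain ⟨m, h1, h2, -⟩ := nextPath_spec (Accepts φ₁ β e) 0 _ u hu ha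
      rw [Function.iterate_succ_apply', hb, h1]
      exact hG _ h2
  -- Strong induction on the number of missing digits, since one accepted extension may supply many
  -- of them.
  have key : ∀ R k, R = n + β + R₀ - (b^[k] []).length →
      ∃ (k' T : ℕ), n + β + R₀ ≤ (b^[k'] []).length ∧
      (search ws.length e).Exec (withAdvice φ₁ ws) (searchStore n 0 β [] (b^[k] []) R
        (R₀ - 1 + ((b^[k] []).length - (n + β + R₀))))
        T (searchStore n 0 β [] (b^[k'] []) 0 (R₀ - 1 + ((b^[k'] []).length - (n + β + R₀)))) ∧
      ((∀ p, G p → ∃ γ, Accepts φ₁ β e (γ :: p)) → (b^[k] []).length ≤ n + β + R₀ →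
        (b^[k'] []).length ≤ n + β + R₀ ∧
        ∀ S, n + 2 * β + 2 * R₀ + 2 ≤ S → totalLength ws ≤ S →
          T ≤ R * (A * (C * (S + 1))) + 1) := by
    intro R
    induction R using Nat.strong_induction_on with
    | _ R ih =>
      intro k hR
      rcases Nat.eq_zero_or_pos R with rfl | hRpos
      · exact ⟨k, 1, by omega, exec_loop_stop rfl, fun _ h => ⟨h, fun S _ _ => by omega⟩⟩
      · have hbk : b^[k + 1] [] = b (b^[k] []) := Function.iterate_succ_apply' _ _ _
        have hEk : R₀ - 1 + ((b^[k] []).length - (n + β + R₀)) = R₀ - 1 := by omega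
        -- One passage to the next accepted path, followed by the induction hypothesis. The word `u`
        -- is any accepted extension; it need not be the one found and only bounds the cost.
        have step : ∀ u, u ≠ [] → Accepts φ₁ β e (u ++ b^[k] []) →
            (b^[k + 1] []).length ≤ (b^[k] []).length + u.length ∧
            ∃ k' T, n + β + R₀ ≤ (b^[k'] []).length ∧
            (∀ S, u.length + 1 + (b^[k] []).length + β ≤ S → R₀ - 1 ≤ S → totalLength ws ≤ S →
              (search ws.length e).Exec (withAdvice φ₁ ws) (searchStore n 0 β [] (b^[k] []) R
              (R₀ - 1 + ((b^[k] []).length - (n + β + R₀)))) (wordRank u * (C * (S + 1)) + T)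
              (searchStore n 0 β [] (b^[k'] []) 0
                (R₀ - 1 + ((b^[k'] []).length - (n + β + R₀))))) ∧
            ((∀ p, G p → ∃ γ, Accepts φ₁ β e (γ :: p)) →
              (b^[k + 1] []).length ≤ n + β + R₀ → (b^[k'] []).length ≤ n + β + R₀ ∧
              ∀ S, n + 2 * β + 2 * R₀ + 2 ≤ S → totalLength ws ≤ S →
              T ≤ (R - 1) * (A * (C * (S + 1))) + 1) := by
          intro u hu ha
          obtain ⟨m, h1, h2, h3, h4, h5, h6⟩ :=
            nextPath_spec (Accepts φ₁ β e) 0 (b^[k] []) u hu ha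
          rw [← hb, ← hbk] at h1
          have hlen := congrArg List.length h1
          rw [length_padded] at hlen
          obtain ⟨k', T, i1, i2, i3⟩ := ih (n + β + R₀ - (b^[k + 1] []).length) (by omega)
            (k + 1) rfl
          refine ⟨by omega, k', T, i1, fun S hS hE hw => ?_, fun hγ hl => ?_⟩
          · rw [hEk]
            refine hC ws rfl φ₁ hφ₁ n 0 β _ R (R₀ - 1) S u hu ha (by omega) hE hw hRpos T _ ?_
            rw [← hb, ← hbk]
            convert i2 using 2 <;> omega
          · obtain ⟨j1, j2⟩ := i3 hγ hl
            refine ⟨j1, fun S hS hw => (j2 S hS hw).trans ?_⟩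
            refine Nat.add_le_add_right (Nat.mul_le_mul_right _ ?_) 1
            omega
        -- If one symbol always suffices, a digit costs at most `A` rounds and the path cannot
        -- overshoot. Otherwise only termination is claimed.
        by_cases hγ : ∀ p, G p → ∃ γ, Accepts φ₁ β e (γ :: p)
        · obtain ⟨γ, ha⟩ := hγ _ (hGb k)
          obtain ⟨j0, k', T, j1, j2, j3⟩ := step [γ] (by simp) ha
          have hrank : wordRank [γ] ≤ A := by
            have := symbolRank_lt γ
            simp only [wordRank]
            omega
          simp only [List.length_singleton] at j0 j2
          -- The running time has to be chosen before `S`; the least admissible `S` gives a time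
          -- that is good for all of them.
          refine ⟨k', _, j1, j2 (max (n + 2 * β + 2 * R₀ + 2) (totalLength ws))
            (by omega) (by omega) (by omega), fun hγ hl => ?_⟩
          obtain ⟨l1, l2⟩ := j3 hγ (by omega)
          refine ⟨l1, fun S hS hw => ?_⟩
          have l3 := l2 S hS hw
          have l4 : wordRank [γ] * (C * (max (n + 2 * β + 2 * R₀ + 2) (totalLength ws) + 1)) ≤
              A * (C * (S + 1)) := by
            gcongr
            exact max_le hS hw
          obtain ⟨R, rfl⟩ : ∃ R', R = R' + 1 := ⟨R - 1, by omega⟩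
          rw [Nat.add_sub_cancel] at l3
          rw [add_mul R 1]
          omega
        · obtain ⟨u, hu, ha⟩ := hnext _ (hGb k)
          obtain ⟨-, k', T, j1, j2, -⟩ := step u hu ha
          refine ⟨k', _, j1, j2 (u.length + 1 + (b^[k] []).length + β + R₀ + totalLength ws)
            (by omega) (by omega) (by omega), fun h => absurd h hγ⟩
  obtain ⟨k, T, h1, h2, h3⟩ := key (n + β + R₀) 0 rfl
  refine ⟨k, T, h1, by simpa using h2, fun hγ => ?_⟩
  obtain ⟨h4, h5⟩ := h3 hγ (by simp)
  refine ⟨h4, fun S hS hw => (h5 S hS hw).trans ?_⟩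
  have h6 : (n + β + R₀) * (A * (C * (S + 1))) ≤ S * (A * (C * (S + 1))) :=
    Nat.mul_le_mul_right _ (by omega)
  have h7 : (S + 1) * ((A * C + 1) * (S + 1)) =
      S * (A * (C * (S + 1))) + (A * C * (S + 1) + (S + 1) * (S + 1)) := by ring
  have h8 : 1 ≤ (S + 1) * (S + 1) := Nat.mul_pos (by omega) (by omega)
  omega

/-- With enough padding the search stops at the first accepted path. -/
lemma exec_search_padded (h e R₀ : ℕ) : ∃ C, ∀ ws : List Word, ws.length = h →
    ∀ (φ₁ : StrFun), IsPredicate φ₁ →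
    ∀ (n β S : ℕ) (u : List (Fin d × Fin (2 * D) → Bool)), u ≠ [] →
    Accepts φ₁ β e (padded (n + β + R₀) u []) →
    u.length + 1 + n + 2 * β + R₀ ≤ S → totalLength ws ≤ S → 0 < R₀ →
    ∃ v : List (Fin d × Fin (2 * D) → Bool), v ≠ [] ∧ v.length ≤ u.length ∧
      Accepts φ₁ β e (padded (n + β + R₀) v []) ∧
      (search ws.length e).Exec (withAdvice φ₁ ws)
        (searchStore n (n + β + R₀) β [] [] (n + β + R₀) (R₀ - 1))
        (wordRank u * (C * (S + 1)) + 1)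
        (searchStore n (n + β + R₀) β [] (padded (n + β + R₀) v []) 0 (R₀ - 1 + v.length)) := by
  obtain ⟨C, hC⟩ := exec_search_next (d := d) (D := D) h e
  refine ⟨C, fun ws hws φ₁ hφ₁ n β S u hu ha hS hw hR => ?_⟩
  obtain ⟨m, h1, h2, -, -, h5, h6⟩ := nextPath_spec (Accepts φ₁ β e) (n + β + R₀) [] u hu ha
  have h := hC ws hws φ₁ hφ₁ n (n + β + R₀) β [] (n + β + R₀) (R₀ - 1) S u hu ha
    (by rw [List.length_nil]; omega) (by omega) hw
  set v := nextWord^[m + 1] ([] : List (Fin d × Fin (2 * D) → Bool))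
  refine ⟨v, List.ne_nil_of_length_pos h6, h5, h2, ?_⟩
  refine h (by omega) _ _ ?_
  have hl : (padded (n + β + R₀) v []).length - ([] : List (Fin d × Fin (2 * D) → Bool)).length =
    n + β + R₀ + v.length := by rw [length_padded]; simp
  -- The padding alone supplies all missing digits, so nothing remains after one acceptance and all
  -- digits of `v` are superfluous.
  rw [h1, hl, show n + β + R₀ - (n + β + R₀ + v.length) = 0 by omega,
    show n + β + R₀ + v.length - (n + β + R₀) = v.length by omega]
  exact exec_loop_stop rfl

lemma exec_findPoint (w₀ : Word) (ws : List Word) (e R₀ : ℕ) (padding : Bool) (φ₁ : StrFun)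
    (hφ₁ : IsPredicate φ₁) (s : Word) (p : List (Fin d × Fin (2 * D) → Bool)) (E T S : ℕ)
    (h : (search (ws.length + 1) e).Exec (withAdvice φ₁ (w₀ :: ws))
      (searchStore s.length (if padding then s.length + w₀.length + R₀ else 0) w₀.length [] []
        (s.length + w₀.length + R₀) (R₀ - 1)) T
      (searchStore s.length (if padding then s.length + w₀.length + R₀ else 0) w₀.length [] p 0 E))
    (hE : E + 1 ≤ p.length) (hS : p.length + s.length + totalLength (w₀ :: ws) ≤ S) :
    ∃ σ', (findPoint (d := d) (D := D) (ws.length + 1) e R₀ padding).Exec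
        (withAdvice φ₁ (w₀ :: ws)) (inputStore s)
        (T + (80 * d * (D + 1) + 4 * ws.length + 6 * R₀ + 100) * (S + 1)) σ' ∧
      σ'.reg .out = pointCode fun i => (convertValue i false E p, (s.length : ℤ)) := by
  have ht : totalLength (w₀ :: ws) = w₀.length + totalLength ws := by simp [totalLength]
  obtain ⟨σ', h1, h2⟩ := exec_output (withAdvice φ₁ (w₀ :: ws)) s.length
    (if padding then s.length + w₀.length + R₀ else 0) w₀.length p E S hE (by omega)
  refine ⟨σ', ((exec_initSearch w₀ ws R₀ padding φ₁ hφ₁ s).seq (h.seq h1)).mono ?_, h2⟩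
  nlinarith

end Frag

section

open Frag Filter Topology

variable {d D : ℕ}

/-! ### The points given by paths -/

/-- The grid width at the end of a path. -/
noncomputable def pathWidth (β : ℕ) (p : List (Fin d × Fin (2 * D) → Bool)) : ℝ :=
  (2 : ℝ) ^ ((β : ℤ) - p.length)

/-- The point at the end of a path. -/
noncomputable def pathPoint (β : ℕ) (p : List (Fin d × Fin (2 * D) → Bool)) : Fin d → ℝ :=
  dyadicPoint fun i => (digitSum i p, (p.length : ℤ) - β)

lemma pathPoint_apply (β : ℕ) (p : List (Fin d × Fin (2 * D) → Bool)) (i : Fin d) :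
    pathPoint β p i = digitSum i p * pathWidth β p := by
  rw [pathPoint, pathWidth, dyadicPoint, div_eq_mul_inv, ← zpow_neg, neg_sub]

lemma pathWidth_pos (β : ℕ) (p : List (Fin d × Fin (2 * D) → Bool)) : 0 < pathWidth β p := by
  unfold pathWidth
  positivity

lemma pathWidth_cons (β : ℕ) (γ) (p : List (Fin d × Fin (2 * D) → Bool)) :
    pathWidth β p = 2 * pathWidth β (γ :: p) := by
  rw [pathWidth, pathWidth, ← zpow_one_add₀ two_ne_zero]
  congr 1
  push_cast [List.length_cons]
  ring

lemma pathWidth_append (β : ℕ) (u p : List (Fin d × Fin (2 * D) → Bool)) :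
    pathWidth β (u ++ p) = pathWidth β p * (1 / 2) ^ u.length := by
  induction u with
  | nil => simp
  | cons γ u ih =>
    have := pathWidth_cons β γ (u ++ p)
    rw [List.cons_append, List.length_cons, pow_succ, ← mul_assoc, ← ih, this]
    ring

lemma pathWidth_append_le (β : ℕ) (u p : List (Fin d × Fin (2 * D) → Bool)) :
    pathWidth β (u ++ p) ≤ pathWidth β p := by
  rw [pathWidth_append]
  exact mul_le_of_le_one_right (pathWidth_pos β p).le (pow_le_one₀ (by norm_num) (by norm_num))

lemma pathPoint_cons (β : ℕ) (γ) (p : List (Fin d × Fin (2 * D) → Bool)) (i : Fin d) :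
    pathPoint β (γ :: p) i = pathPoint β p i + (rowSum i γ - D) * pathWidth β (γ :: p) := by
  rw [pathPoint_apply, pathPoint_apply, pathWidth_cons β γ p, digitSum]
  push_cast
  ring

lemma pathPoint_nil (β : ℕ) : pathPoint β ([] : List (Fin d × Fin (2 * D) → Bool)) = 0 := by
  funext i
  simp [pathPoint_apply, digitSum]

lemma pathPoint_zeroDigit (β z : ℕ) (p : List (Fin d × Fin (2 * D) → Bool)) :
    pathPoint β (List.replicate z zeroDigit ++ p) = pathPoint β p := by
  induction z with
  | zero => rfl
  | succ z ih =>
    funext i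
    rw [List.replicate_succ, List.cons_append, pathPoint_cons, ih, rowSum_zeroDigit]
    simp

/-- Extensions of a path stay close to its point. -/
lemma abs_pathPoint_append_sub_le (β : ℕ) (u p : List (Fin d × Fin (2 * D) → Bool)) (i : Fin d) :
    |pathPoint β (u ++ p) i - pathPoint β p i| ≤ D * (pathWidth β p - pathWidth β (u ++ p)) := by
  induction u with
  | nil => simp
  | cons γ u ih =>
    rw [List.cons_append, pathPoint_cons]
    have h1 := pathWidth_cons β γ (u ++ p)
    have h2 := pathWidth_pos β (γ :: (u ++ p))
    -- A digit moves the point by at most `D` new widths, and the new width is exactly what the old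
    -- width loses; the estimate therefore telescopes.
    have h3 : |((rowSum i γ : ℝ) - D) * pathWidth β (γ :: (u ++ p))| ≤
        D * pathWidth β (γ :: (u ++ p)) := by
      rw [abs_mul, abs_of_pos h2]
      refine mul_le_mul_of_nonneg_right (abs_le.2 ⟨?_, ?_⟩) h2.le
      · have : (0 : ℝ) ≤ rowSum i γ := Nat.cast_nonneg _
        linarith
      · have : (rowSum i γ : ℝ) ≤ 2 * D := by exact_mod_cast rowSum_le i γ
        linarith
    calc |pathPoint β (u ++ p) i + ((rowSum i γ : ℝ) - D) * pathWidth β (γ :: (u ++ p)) -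
          pathPoint β p i|
        = |(pathPoint β (u ++ p) i - pathPoint β p i) +
          ((rowSum i γ : ℝ) - D) * pathWidth β (γ :: (u ++ p))| := by congr 1; ring
      _ ≤ _ := abs_add_le _ _
      _ ≤ D * (pathWidth β p - pathWidth β (u ++ p)) + D * pathWidth β (γ :: (u ++ p)) :=
        add_le_add ih h3
      _ = _ := by rw [h1]; ring

/-- Any tuple of digits is the tuple of digits of a symbol. -/
lemma exists_rowSum_eq (δ : Fin d → ℤ) (hδ : ∀ i, |δ i| ≤ D) :
    ∃ γ : Fin d × Fin (2 * D) → Bool, ∀ i, (rowSum i γ : ℤ) - D = δ i := by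
  refine ⟨fun x => decide ((x.2 : ℕ) < (δ x.1 + D).toNat), fun i => ?_⟩
  have hi := abs_le.1 (hδ i)
  have h : (Finset.univ.filter fun j : Fin (2 * D) => (j : ℕ) < (δ i + D).toNat).card =
      (δ i + D).toNat := by
    rw [Fin.card_filter_val_lt]
    omega
  have h2 : rowSum i (fun x : Fin d × Fin (2 * D) => decide ((x.2 : ℕ) < (δ x.1 + D).toNat)) =
      (δ i + D).toNat := by
    rw [← h, Finset.card_filter, rowSum]
    refine Finset.sum_congr rfl fun j _ => ?_
    by_cases hj : (j : ℕ) < (δ i + D).toNat <;> simp [hj]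
  rw [h2]
  omega

/-- The admissible displacement is `D` times the new width, so rounding the quotient by the new
width to integers yields digits of absolute value at most `D`: rounding is monotone and fixes `D`
and `-D`. -/
lemma exists_cons_close (β : ℕ) (p : List (Fin d × Fin (2 * D) → Bool)) (y : Fin d → ℝ)
    (hy : ∀ i, |y i - pathPoint β p i| ≤ D / 2 * pathWidth β p) :
    ∃ γ, ∀ i, |pathPoint β (γ :: p) i - y i| ≤ pathWidth β (γ :: p) := by
  set w := pathWidth β p / 2 with hw
  have hwpos : 0 < w := half_pos (pathWidth_pos β p)
  obtain ⟨γ, hγ⟩ := exists_rowSum_eq (D := D) (fun i => round ((y i - pathPoint β p i) / w)) (by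
    intro i
    have h1 : |(y i - pathPoint β p i) / w| ≤ D := by
      rw [abs_div, abs_of_pos hwpos, div_le_iff₀ hwpos]
      refine (hy i).trans (le_of_eq ?_)
      rw [hw]
      ring
    rw [abs_le] at h1 ⊢
    have hm : Monotone (round : ℝ → ℤ) := fun a b hab => by
      rw [round_eq, round_eq]
      exact Int.floor_le_floor (by linarith)
    constructor
    · have := hm h1.1
      rwa [show (-(D : ℝ)) = ((-(D : ℤ) : ℤ) : ℝ) by push_cast; rfl, round_intCast] at this
    · have := hm h1.2
      rwa [round_natCast] at this)
  refine ⟨γ, fun i => ?_⟩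
  have h2 : pathWidth β (γ :: p) = w := by rw [hw, pathWidth_cons β γ p]; ring
  have h3 : ((rowSum i γ : ℝ) - D) = (round ((y i - pathPoint β p i) / w) : ℤ) := by
    rw [← hγ i]
    push_cast
    rfl
  have h4 := abs_sub_round ((y i - pathPoint β p i) / w)
  rw [pathPoint_cons, h2, h3]
  have h5 : pathPoint β p i + (round ((y i - pathPoint β p i) / w) : ℤ) * w - y i =
      -((y i - pathPoint β p i) / w - (round ((y i - pathPoint β p i) / w) : ℤ)) * w := by
    field_simp
    ring
  rw [h5, abs_mul, abs_neg, abs_of_pos hwpos]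
  nlinarith

/-- The points of extensions of a path approximate all points in a neighbourhood. -/
lemma exists_append_close (hD : 2 ≤ D) (β k : ℕ) (p : List (Fin d × Fin (2 * D) → Bool))
    (y : Fin d → ℝ) (hy : ∀ i, |y i - pathPoint β p i| ≤ D / 2 * pathWidth β p) :
    ∃ u : List (Fin d × Fin (2 * D) → Bool), u.length = k + 1 ∧
      ∀ i, |pathPoint β (u ++ p) i - y i| ≤ pathWidth β (u ++ p) := by
  induction k with
  | zero =>
    obtain ⟨γ, hγ⟩ := exists_cons_close β p y hy
    exact ⟨[γ], rfl, hγ⟩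
  | succ k ih =>
    obtain ⟨u, hu, h⟩ := ih
    -- The error after one symbol, one grid width, is within the reach `D / 2` of the next symbol
    -- because `2 ≤ D`.
    obtain ⟨γ, hγ⟩ := exists_cons_close β (u ++ p) y fun i => by
      rw [abs_sub_comm]
      refine (h i).trans (le_mul_of_one_le_left (pathWidth_pos β _).le ?_)
      have : (2 : ℝ) ≤ D := by exact_mod_cast hD
      linarith
    exact ⟨γ :: u, by simp [hu], hγ⟩

/-- Rounding a point near the end of a long path. -/
lemma abs_convertValue_sub_le (β n R₀ E : ℕ) (p : List (Fin d × Fin (2 * D) → Bool))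
    (y : Fin d → ℝ) (hy : ∀ i, |pathPoint β p i - y i| ≤ D * pathWidth β p)
    (hR : 2 * D ≤ 2 ^ R₀) (hp : n + β + R₀ ≤ p.length) (hE : p.length = E + 1 + n + β)
    (i : Fin d) :
    |((convertValue i false E p : ℤ) : ℝ) / (2 : ℝ) ^ n - y i| ≤ 1 / 2 ^ n := by
  have hv : convertValue i false E p = (digitSum i p + 2 ^ E) / 2 ^ (E + 1) := rfl
  set a := digitSum i p with ha
  set v := convertValue i false E p with hv_def
  have hw : pathWidth β p = 1 / (2 ^ (E + 1) * 2 ^ n) := by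
    rw [pathWidth, hE, ← pow_add, show (β : ℤ) - ((E + 1 + n + β : ℕ) : ℤ) =
      -((E + 1 + n : ℕ) : ℤ) by push_cast; ring, zpow_neg, zpow_natCast, one_div]
  have h1 := hy i
  rw [pathPoint_apply, ← ha] at h1
  -- The guard digits keep the distance to `y` below half of the permitted error; the rounding takes
  -- the other half.
  have hDw : D * pathWidth β p ≤ 1 / 2 / 2 ^ n := by
    have h2 : (2 : ℝ) * D ≤ 2 ^ (E + 1) := by
      have : 2 * D ≤ 2 ^ (E + 1) := hR.trans (Nat.pow_le_pow_right two_pos (by omega))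
      exact_mod_cast this
    rw [hw, mul_one_div, div_div, div_le_div_iff₀ (by positivity) (by positivity)]
    have : (0 : ℝ) < 2 ^ n := by positivity
    nlinarith
  have hround : |(v : ℝ) / 2 ^ n - a * pathWidth β p| ≤ 1 / 2 / 2 ^ n := by
    have e1 : v * 2 ^ (E + 1) ≤ a + 2 ^ E := by
      rw [hv]
      exact Int.ediv_mul_le _ (by positivity)
    have e2 : a + 2 ^ E < (v + 1) * 2 ^ (E + 1) := by
      rw [hv]
      exact Int.lt_ediv_add_one_mul_self _ (by positivity)
    have e1' : (v : ℝ) * 2 ^ (E + 1) ≤ a + 2 ^ E := by exact_mod_cast e1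
    have e2' : (a : ℝ) + 2 ^ E < (v + 1) * 2 ^ (E + 1) := by exact_mod_cast e2
    have e3 : (v : ℝ) / 2 ^ n - a * pathWidth β p = (v - a / 2 ^ (E + 1)) / 2 ^ n := by
      rw [hw]
      field_simp
    rw [e3, abs_div, abs_of_pos (show (0 : ℝ) < 2 ^ n by positivity)]
    refine div_le_div_of_nonneg_right ?_ (by positivity)
    have hq : (0 : ℝ) < 2 ^ (E + 1) := by positivity
    have e4 : (a : ℝ) / 2 ^ (E + 1) * 2 ^ (E + 1) = a := div_mul_cancel₀ _ hq.ne'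
    have e5 : (2 : ℝ) ^ (E + 1) = 2 * 2 ^ E := pow_succ' _ _
    rw [abs_le]
    constructor <;> nlinarith
  calc |(v : ℝ) / 2 ^ n - y i| ≤ |(v : ℝ) / 2 ^ n - a * pathWidth β p| +
        |a * pathWidth β p - y i| := abs_sub_le _ _ _
    _ ≤ 1 / 2 / 2 ^ n + 1 / 2 / 2 ^ n := add_le_add hround (h1.trans hDw)
    _ = 1 / 2 ^ n := by ring

/-- The points of a sequence of successive extensions converge. -/
lemma exists_limit_pathPoint (β : ℕ) (b : ℕ → List (Fin d × Fin (2 * D) → Bool))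
    (hb : ∀ k, ∃ u, u ≠ [] ∧ b (k + 1) = u ++ b k) :
    ∃ y, Tendsto (fun k => pathPoint β (b k)) atTop (𝓝 y) ∧
      Tendsto (fun k => pathWidth β (b k)) atTop (𝓝 0) ∧
      ∀ k i, |pathPoint β (b k) i - y i| ≤ D * pathWidth β (b k) := by
  have hpre : ∀ k l, ∃ u, b (k + l) = u ++ b k := by
    intro k l
    induction l with
    | zero => exact ⟨[], rfl⟩
    | succ l ih =>
      obtain ⟨u, hu⟩ := ih
      obtain ⟨v, -, hv⟩ := hb (k + l)
      exact ⟨v ++ u, by rw [← add_assoc, hv, hu, List.append_assoc]⟩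
  have hlen : ∀ k, k ≤ (b k).length := by
    intro k
    induction k with
    | zero => exact Nat.zero_le _
    | succ k ih =>
      obtain ⟨u, hu, h⟩ := hb k
      have := List.length_pos_of_ne_nil hu
      rw [h, List.length_append]
      omega
  have hw : Tendsto (fun k => pathWidth β (b k)) atTop (𝓝 0) := by
    have h1 : Tendsto (fun k : ℕ => (2 : ℝ) ^ β * (1 / 2) ^ k) atTop (𝓝 0) := by
      have := (tendsto_pow_atTop_nhds_zero_of_lt_one (r := (1 / 2 : ℝ)) (by norm_num)
        (by norm_num)).const_mul ((2 : ℝ) ^ β)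
      simpa using this
    refine squeeze_zero (fun k => (pathWidth_pos β _).le) (fun k => ?_) h1
    have h2 := pathWidth_append β (b k) []
    rw [List.append_nil] at h2
    rw [h2]
    have h3 : pathWidth β ([] : List (Fin d × Fin (2 * D) → Bool)) = 2 ^ β := by
      simp [pathWidth]
    rw [h3]
    exact mul_le_mul_of_nonneg_left (pow_le_pow_of_le_one (by norm_num) (by norm_num) (hlen k))
      (by positivity)
  have hclose : ∀ k l i, |pathPoint β (b (k + l)) i - pathPoint β (b k) i| ≤
      D * pathWidth β (b k) := by
    intro k l i
    obtain ⟨u, hu⟩ := hpre k l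
    rw [hu]
    refine (abs_pathPoint_append_sub_le β u (b k) i).trans ?_
    exact mul_le_mul_of_nonneg_left (sub_le_self _ (pathWidth_pos β _).le) (Nat.cast_nonneg D)
  have hDw : Tendsto (fun k => D * pathWidth β (b k)) atTop (𝓝 0) := by
    simpa using hw.const_mul (D : ℝ)
  have hcauchy : CauchySeq fun k => pathPoint β (b k) := by
    refine cauchySeq_of_le_tendsto_0' (fun k => D * pathWidth β (b k)) (fun k m hkm => ?_) hDw
    obtain ⟨l, rfl⟩ := Nat.exists_eq_add_of_le hkm
    rw [dist_comm, dist_pi_le_iff (mul_nonneg (Nat.cast_nonneg D) (pathWidth_pos β _).le)]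
    exact fun i => hclose k l i
  obtain ⟨y, hy⟩ := cauchySeq_tendsto_of_complete hcauchy
  refine ⟨y, hy, hw, fun k i => ?_⟩
  have h1 : Tendsto (fun l => |pathPoint β (b k) i - pathPoint β (b l) i|) atTop
      (𝓝 |pathPoint β (b k) i - y i|) :=
    (tendsto_const_nhds.sub (tendsto_pi_nhds.1 hy i)).abs
  refine le_of_tendsto h1 ?_
  filter_upwards [eventually_ge_atTop k] with m hm
  obtain ⟨l, rfl⟩ := Nat.exists_eq_add_of_le hm
  rw [abs_sub_comm]
  exact hclose k l i

end

section

open Frag Filter Topology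

variable {d D : ℕ}

/-! ### Equivalence of norms -/

/-- A seminorm is convex, and convex functions on a finite-dimensional space are continuous. -/
lemma Seminorm.continuous_pi (N : Seminorm ℝ (Fin d → ℝ)) : Continuous N := by
  have := ConvexOn.continuousOn (C := Set.univ) isOpen_univ N.convexOn
  rwa [continuousOn_univ] at this

lemma exists_pow_two_mul_norm_bound (N : Seminorm ℝ (Fin d → ℝ)) (hN : ∀ x, N x = 0 → x = 0) :
    ∃ e₁ e₂ : ℕ, (∀ x, N x ≤ 2 ^ e₁ * ‖x‖) ∧ ∀ x, ‖x‖ ≤ 2 ^ e₂ * N x := by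
  have hcont := N.continuous_pi
  obtain ⟨C, hC, hb⟩ := Seminorm.bound_of_continuous_normedSpace N hcont
  obtain ⟨e₁, he₁⟩ := pow_unbounded_of_one_lt C (one_lt_two (α := ℝ))
  obtain ⟨c, hc, hlow⟩ : ∃ c > 0, ∀ x : Fin d → ℝ, ‖x‖ = 1 → c ≤ N x := by
    -- The unit sphere is empty in dimension `0`; otherwise the minimum of `N` on it is the
    -- constant.
    rcases (Metric.sphere (0 : Fin d → ℝ) 1).eq_empty_or_nonempty with h | h
    · refine ⟨1, one_pos, fun x hx => ?_⟩
      have : x ∈ Metric.sphere (0 : Fin d → ℝ) 1 := by simpa using hx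
      rw [h] at this
      exact this.elim
    · obtain ⟨x, hx, hmin⟩ := (isCompact_sphere (0 : Fin d → ℝ) 1).exists_isMinOn h
        hcont.continuousOn
      refine ⟨N x, (apply_nonneg N x).lt_of_ne fun h0 => ?_, fun y hy => hmin (by simpa using hy)⟩
      have hx0 := hN x h0.symm
      rw [hx0] at hx
      simp at hx
  obtain ⟨e₂, he₂⟩ := pow_unbounded_of_one_lt (1 / c) (one_lt_two (α := ℝ))
  refine ⟨e₁, e₂, fun x => (hb x).trans (by gcongr), fun x => ?_⟩
  rcases eq_or_ne x 0 with rfl | hx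
  · simp
  have hx' : 0 < ‖x‖ := norm_pos_iff.2 hx
  have h3 := hlow (‖x‖⁻¹ • x) (by rw [norm_smul, norm_inv, norm_norm, inv_mul_cancel₀ hx'.ne'])
  rw [map_smul_eq_mul, norm_inv, norm_norm, inv_mul_eq_div, le_div_iff₀ hx'] at h3
  have h4 : ‖x‖ ≤ 1 / c * N x := by
    rw [one_div, inv_mul_eq_div, le_div_iff₀ hc]
    linarith
  exact h4.trans (by gcongr)

/-! ### Paths near a set -/

/-- A point of the set lies near the end of the path. -/
def NearSet (N : Seminorm ℝ (Fin d → ℝ)) (S : Set (Fin d → ℝ)) (β e : ℕ)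
    (p : List (Fin d × Fin (2 * D) → Bool)) : Prop :=
  ∃ y ∈ S, N (pathPoint β p - y) ≤ 2 * 2 ^ e * pathWidth β p

lemma two_zpow_neg_eq (β e : ℕ) (p : List (Fin d × Fin (2 * D) → Bool)) :
    (2 : ℝ) ^ (-((p.length : ℤ) - β - e)) = 2 ^ e * pathWidth β p := by
  rw [pathWidth, ← zpow_natCast (2 : ℝ) e, ← zpow_add₀ two_ne_zero]
  congr 1
  ring

variable {N : Seminorm ℝ (Fin d → ℝ)} {S : Set (Fin d → ℝ)} {e₁ e₂ β : ℕ} {φ : StrFun}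

/-- An answer `1` excludes that the closed ball of twice the radius misses `S`; this is the origin
of the factor `2` in `NearSet`. -/
lemma NearSet.of_accepts_set (hφ : setRep N φ S) (e : ℕ)
    (p : List (Fin d × Fin (2 * D) → Bool)) (h : Accepts φ β e p) : NearSet N S β e p := by
  have h1 := ((hφ.2 (fun i => (digitSum i p, (p.length : ℤ) - β)) ((p.length : ℤ) - β - e)).2).mt
    (by rw [h]; simp)
  obtain ⟨y, hy, hyS⟩ := Set.nonempty_iff_ne_empty.2 h1
  rw [zpow_add_one₀ two_ne_zero, two_zpow_neg_eq, Seminorm.mem_closedBall, map_sub_rev] at hy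
  exact ⟨y, hyS, hy.trans (le_of_eq (by ring))⟩

lemma NearSet.of_accepts_wmem (hφ : wmemRep N φ S) (e : ℕ)
    (p : List (Fin d × Fin (2 * D) → Bool)) (h : Accepts φ β e p) : NearSet N S β e p := by
  have h1 := ((hφ.2 (fun i => (digitSum i p, (p.length : ℤ) - β)) ((p.length : ℤ) - β - e)).2).mt
    (by rw [h]; simp)
  obtain ⟨y, hy, hyS⟩ := Set.nonempty_iff_ne_empty.2 h1
  rw [two_zpow_neg_eq, Seminorm.mem_closedBall, map_sub_rev] at hy
  refine ⟨y, hyS, hy.trans ?_⟩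
  have := mul_pos (pow_pos (two_pos (α := ℝ)) e) (pathWidth_pos β p)
  linarith

lemma NearSet.nil {b : ℤ} (hb : S ⊆ N.closedBall 0 ((2 : ℝ) ^ b)) (hne : S.Nonempty)
    (hβ : b ≤ β) (e : ℕ) : NearSet (D := D) N S β e [] := by
  obtain ⟨y, hy⟩ := hne
  refine ⟨y, hy, ?_⟩
  have h1 := hb hy
  rw [Seminorm.mem_closedBall, map_sub_rev] at h1
  rw [pathPoint_nil]
  have h2 : (2 : ℝ) ^ b ≤ pathWidth β ([] : List (Fin d × Fin (2 * D) → Bool)) :=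
    zpow_le_zpow_right₀ one_le_two (by simpa using hβ)
  have h3 : (1 : ℝ) ≤ 2 ^ e := one_le_pow₀ one_le_two
  have := pathWidth_pos β ([] : List (Fin d × Fin (2 * D) → Bool))
  nlinarith

lemma abs_sub_le_of_seminorm (h2 : ∀ x, ‖x‖ ≤ 2 ^ e₂ * N x) {x y : Fin d → ℝ} {r : ℝ}
    (h : N (x - y) ≤ r) (i : Fin d) : |x i - y i| ≤ 2 ^ e₂ * r :=
  calc |x i - y i| = ‖(x - y) i‖ := rfl
    _ ≤ ‖x - y‖ := norm_le_pi_norm _ i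
    _ ≤ 2 ^ e₂ * N (x - y) := h2 _
    _ ≤ 2 ^ e₂ * r := by gcongr

lemma seminorm_sub_le_of_abs (h1 : ∀ x, N x ≤ 2 ^ e₁ * ‖x‖) {x y : Fin d → ℝ} {r : ℝ}
    (hr : 0 ≤ r) (h : ∀ i, |x i - y i| ≤ r) : N (x - y) ≤ 2 ^ e₁ * r := by
  refine (h1 _).trans ?_
  gcongr
  exact (pi_norm_le_iff_of_nonneg hr).2 h

lemma NearSet.abs_sub_le (h2 : ∀ x, ‖x‖ ≤ 2 ^ e₂ * N x) {y : Fin d → ℝ}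
    {p : List (Fin d × Fin (2 * D) → Bool)}
    (h : N (pathPoint β p - y) ≤ 2 * 2 ^ (e₁ + 1) * pathWidth β p) (i : Fin d) :
    |pathPoint β p i - y i| ≤ 2 ^ (e₁ + e₂ + 2) * pathWidth β p :=
  (abs_sub_le_of_seminorm h2 h i).trans (le_of_eq (by ring))

/-- The point of `S` is within `2 ^ (e₁ + e₂ + 2)` grid widths in each coordinate, hence within the
reach `D / 2` of one symbol. The new grid point is within one new width of it in the sup norm, so
within `2 ^ e₁` new widths in `N`. This is strictly less than the radius `2 ^ (e₁ + 1)` of the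
query, so the open ball meets `S`. -/
lemma exists_accepts_of_nearSet (hφ : setRep N φ S) (h1 : ∀ x, N x ≤ 2 ^ e₁ * ‖x‖)
    (h2 : ∀ x, ‖x‖ ≤ 2 ^ e₂ * N x) (hD : (2 : ℝ) ^ (e₁ + e₂ + 3) + 3 ≤ D)
    (p : List (Fin d × Fin (2 * D) → Bool)) (h : NearSet N S β (e₁ + 1) p) :
    ∃ γ, Accepts φ β (e₁ + 1) (γ :: p) := by
  obtain ⟨y, hy, hyp⟩ := h
  have hw := pathWidth_pos β p
  obtain ⟨γ, hγ⟩ := exists_cons_close β p y fun i => by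
    rw [abs_sub_comm]
    refine (NearSet.abs_sub_le h2 hyp i).trans ?_
    rw [pow_succ] at hD
    gcongr
    linarith
  refine ⟨γ, (hφ.2 _ _).1 ⟨y, ?_, hy⟩⟩
  have h3 := seminorm_sub_le_of_abs h1 (pathWidth_pos β (γ :: p)).le hγ
  rw [two_zpow_neg_eq, Seminorm.mem_ball, map_sub_rev]
  refine lt_of_le_of_lt h3 ?_
  have := mul_pos (pow_pos (two_pos (α := ℝ)) e₁) (pathWidth_pos β (γ :: p))
  rw [pow_succ]
  linarith

/-- A ball around an interior point close to `y` lies in `S`, and sufficiently long extensions aim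
at that point with query balls inside this ball. Their length depends on the unknown size of the
ball. -/
lemma exists_append_accepts_of_nearSet (hφ : wmemRep N φ S) (hS : closure (interior S) = S)
    (h2 : ∀ x, ‖x‖ ≤ 2 ^ e₂ * N x) (hD : (2 : ℝ) ^ (e₁ + e₂ + 3) + 3 ≤ D)
    (p : List (Fin d × Fin (2 * D) → Bool)) (h : NearSet N S β (e₁ + 1) p) :
    ∃ u, u ≠ [] ∧ Accepts φ β (e₁ + 1) (u ++ p) := by
  obtain ⟨y, hy, hyp⟩ := h
  have hw := pathWidth_pos β p
  rw [← hS] at hy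
  -- Moving from `y` to `y'` costs one more grid width; the summand `3` in `hD` makes room for it.
  obtain ⟨y', hy', hyy⟩ := Metric.mem_closure_iff.1 hy _ hw
  obtain ⟨ε, hε, hball⟩ := Metric.mem_nhds_iff.1 (mem_interior_iff_mem_nhds.1 hy')
  -- The factor collects, in the sup norm and in units of the final width, the grid error `1` and
  -- the radius `2 ^ e₂ * 2 ^ (e₁ + 1)` of the query ball.
  obtain ⟨k, hk⟩ := exists_pow_lt_of_lt_one
    (show 0 < ε / (pathWidth β p * (1 + 2 ^ e₂ * 2 ^ (e₁ + 1))) by positivity)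
    (show (1 / 2 : ℝ) < 1 by norm_num)
  rw [lt_div_iff₀ (by positivity)] at hk
  have hD2 : 2 ≤ D := by
    have : (0 : ℝ) < 2 ^ (e₁ + e₂ + 3) := by positivity
    have : (2 : ℝ) ≤ D := by linarith
    exact_mod_cast this
  obtain ⟨u, hu, hclose⟩ := exists_append_close hD2 β k p y' fun i => by
    have e1 := NearSet.abs_sub_le h2 hyp i
    have e2 : |y i - y' i| ≤ pathWidth β p := by
      have := dist_le_pi_dist y y' i
      rw [Real.dist_eq] at this
      linarith
    rw [abs_sub_comm]
    refine (abs_sub_le _ (y i) _).trans ((add_le_add e1 e2).trans ?_)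
    rw [pow_succ] at hD
    nlinarith
  refine ⟨u, List.ne_nil_of_length_pos (by omega), (hφ.2 _ _).1 fun x hx => hball ?_⟩
  change x ∈ N.closedBall (pathPoint β (u ++ p)) _ at hx
  rw [two_zpow_neg_eq, Seminorm.mem_closedBall] at hx
  have hw' : pathWidth β (u ++ p) ≤ pathWidth β p * (1 / 2) ^ k := by
    rw [pathWidth_append, hu, pow_succ]
    have : (0 : ℝ) < pathWidth β p * (1 / 2) ^ k := by positivity
    linarith
  rw [Metric.mem_ball]
  refine lt_of_le_of_lt ((dist_pi_le_iff (r := (1 + 2 ^ e₂ * 2 ^ (e₁ + 1)) * pathWidth β (u ++ p))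
    (mul_nonneg (by positivity) (pathWidth_pos _ _).le)).2 fun i => ?_) ?_
  · rw [Real.dist_eq]
    have e1 := abs_sub_le_of_seminorm h2 hx i
    have e2 := abs_sub_le (x i) (pathPoint β (u ++ p) i) (y' i)
    have e3 := hclose i
    linarith
  · calc (1 + 2 ^ e₂ * 2 ^ (e₁ + 1)) * pathWidth β (u ++ p) ≤
        (1 + 2 ^ e₂ * 2 ^ (e₁ + 1)) * (pathWidth β p * (1 / 2) ^ k) := by gcongr
      _ = (1 / 2) ^ k * (pathWidth β p * (1 + 2 ^ e₂ * 2 ^ (e₁ + 1))) := by ring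
      _ < ε := hk

/-- Aim at the centre `x` of the inner ball. After `β + ρ + e₁ + 2` symbols the width is `2 ^ (-(ρ +
e₁ + 2))`, so the grid error and the query radius together are at most `2 ^ (e₁ + 2)` widths, hence
at most `2 ^ (-r)`. Padding keeps the centre and shrinks the query ball. -/
lemma exists_accepts_padded (hφ : wmemRep N φ S) (h1 : ∀ x, N x ≤ 2 ^ e₁ * ‖x‖)
    (h2 : ∀ x, ‖x‖ ≤ 2 ^ e₂ * N x) (hD : (2 : ℝ) ^ (e₁ + e₂ + 3) + 3 ≤ D)
    {b r : ℤ} (hb : S ⊆ N.closedBall 0 ((2 : ℝ) ^ b)) (hβ : b ≤ β) {x : Fin d → ℝ}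
    (hx : x ∈ S) (hr : N.closedBall x ((2 : ℝ) ^ (-r)) ⊆ S) {ρ : ℕ} (hρ : r ≤ ρ) (z : ℕ) :
    ∃ u : List (Fin d × Fin (2 * D) → Bool), u.length = β + ρ + e₁ + 2 ∧
      Accepts φ β (e₁ + 1) (padded z u []) := by
  have hD2 : 2 ≤ D := by
    have : (0 : ℝ) < 2 ^ (e₁ + e₂ + 3) := by positivity
    have : (2 : ℝ) ≤ D := by linarith
    exact_mod_cast this
  have hw := pathWidth_pos β ([] : List (Fin d × Fin (2 * D) → Bool))
  have hb' : (2 : ℝ) ^ b ≤ pathWidth β ([] : List (Fin d × Fin (2 * D) → Bool)) :=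
    zpow_le_zpow_right₀ one_le_two (by simpa using hβ)
  obtain ⟨u, hu, hclose⟩ := exists_append_close hD2 β (β + ρ + e₁ + 1) [] x fun i => by
    have e1 := hb hx
    rw [Seminorm.mem_closedBall] at e1
    have e2 := abs_sub_le_of_seminorm h2 e1 i
    rw [pathPoint_nil]
    refine e2.trans ?_
    have e3 : (2 : ℝ) ^ e₂ ≤ D / 2 := by
      have e4 : (2 : ℝ) ^ e₂ ≤ 2 ^ (e₁ + e₂ + 2) := pow_le_pow_right₀ one_le_two (by omega)
      rw [pow_succ] at hD
      linarith
    gcongr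
  refine ⟨u, hu, (hφ.2 _ _).1 fun y hy => hr ?_⟩
  change y ∈ N.closedBall (pathPoint β (padded z u [])) _ at hy
  rw [padded, two_zpow_neg_eq, pathPoint_zeroDigit, Seminorm.mem_closedBall] at hy
  have e1 := seminorm_sub_le_of_abs h1 (pathWidth_pos β (u ++ [])).le hclose
  have e2 := pathWidth_append_le β (List.replicate z zeroDigit) (u ++ [])
  have e3 : pathWidth β (u ++ []) ≤ 2 ^ (-r) * (1 / 2) ^ (e₁ + 2) := by
    have : (1 / 2 : ℝ) ^ (e₁ + 2) = 2 ^ (-((e₁ + 2 : ℕ) : ℤ)) := by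
      rw [zpow_neg, zpow_natCast, one_div, inv_pow]
    rw [this, ← zpow_add₀ two_ne_zero, pathWidth]
    refine zpow_le_zpow_right₀ one_le_two ?_
    rw [List.append_nil, hu]
    push_cast
    omega
  rw [Seminorm.mem_closedBall]
  have e4 : N (y - x) ≤ N (y - pathPoint β (u ++ [])) + N (pathPoint β (u ++ []) - x) := by
    have := map_add_le_add N (y - pathPoint β (u ++ [])) (pathPoint β (u ++ []) - x)
    rwa [sub_add_sub_cancel] at this
  have e5 : (2 : ℝ) ^ (e₁ + 2) * (2 ^ (-r) * (1 / 2) ^ (e₁ + 2)) = 2 ^ (-r) := by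
    rw [mul_left_comm, ← mul_pow]
    norm_num
  calc N (y - x) ≤ 2 ^ (e₁ + 1) * pathWidth β (u ++ []) + 2 ^ e₁ * pathWidth β (u ++ []) :=
        e4.trans (add_le_add (hy.trans (by gcongr)) e1)
    _ ≤ 2 ^ (e₁ + 2) * pathWidth β (u ++ []) := by
        have := pathWidth_pos β (u ++ [])
        have : (0 : ℝ) < 2 ^ e₁ := by positivity
        rw [pow_succ, pow_add]
        nlinarith
    _ ≤ 2 ^ (e₁ + 2) * (2 ^ (-r) * (1 / 2) ^ (e₁ + 2)) := by gcongr
    _ = 2 ^ (-r) := e5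

/-- The points of `S` that accompany the paths are squeezed to the same limit. -/
lemma mem_of_tendsto_pathPoint (hS : IsClosed S) (h2 : ∀ x, ‖x‖ ≤ 2 ^ e₂ * N x)
    {b : ℕ → List (Fin d × Fin (2 * D) → Bool)} {y : Fin d → ℝ}
    (hy : Tendsto (fun k => pathPoint β (b k)) atTop (𝓝 y))
    (hw : Tendsto (fun k => pathWidth β (b k)) atTop (𝓝 0))
    (hn : ∀ k, NearSet N S β (e₁ + 1) (b k)) : y ∈ S := by
  choose z hzS hz using hn
  have h3 : Tendsto (fun k => pathPoint β (b k) - z k) atTop (𝓝 0) := by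
    refine squeeze_zero_norm (a := fun k => 2 ^ e₂ * (2 * 2 ^ (e₁ + 1) * pathWidth β (b k)))
      (fun k => (h2 _).trans (by gcongr; exact hz k)) ?_
    simpa using (hw.const_mul (2 * 2 ^ (e₁ + 1) : ℝ)).const_mul ((2 : ℝ) ^ e₂)
  have h4 : Tendsto z atTop (𝓝 y) := by simpa using hy.sub h3
  exact hS.mem_of_tendsto h4 (Eventually.of_forall hzS)

end

section

open Frag Filter Topology

variable {d D : ℕ}

/-! ### Upper bounds -/

lemma OTM.OutputsWithin.mono {M : OTM} {φ : StrFun} {s w : Word} {T T' : ℕ}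
    (h : M.OutputsWithin φ s w T) (hT : T ≤ T') : M.OutputsWithin φ s w T' := by
  obtain ⟨n, hn, h⟩ := h
  exact ⟨n, hn.trans hT, h⟩

lemma dyadicPoint_natCast_apply (a : Fin d → ℤ) (n : ℕ) (i : Fin d) :
    dyadicPoint (fun i => (a i, (n : ℤ))) i = a i / (2 : ℝ) ^ n := by
  simp [dyadicPoint]

lemma exists_realRep (y : Fin d → ℝ) : ∃ ψ, realRep d ψ y := by
  refine ⟨fun s => pointCode fun i => (round (y i * 2 ^ s.length), (s.length : ℤ)), fun s =>
    ⟨_, rfl, fun i => ?_⟩⟩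
  rw [dyadicPoint_natCast_apply]
  refine ⟨⟨_, rfl⟩, ?_⟩
  have h := abs_sub_round (y i * 2 ^ s.length)
  have hpos : (0 : ℝ) < 2 ^ s.length := by positivity
  rw [abs_sub_comm, le_div_iff₀ hpos, ← abs_of_pos hpos, ← abs_mul, abs_of_pos hpos, sub_mul,
    div_mul_cancel₀ _ hpos.ne']
  linarith

lemma exists_realRep_apply_eq (y : Fin d → ℝ) (s : Word) (a : Fin d → ℤ)
    (h : ∀ i, |(a i : ℝ) / 2 ^ s.length - y i| ≤ 1 / 2 ^ s.length) :
    ∃ ψ, realRep d ψ y ∧ ψ s = pointCode fun i => (a i, (s.length : ℤ)) := by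
  obtain ⟨ψ, hψ⟩ := exists_realRep y
  refine ⟨Function.update ψ s (pointCode fun i => (a i, (s.length : ℤ))), fun t => ?_, by simp⟩
  by_cases ht : t = s
  · subst ht
    refine ⟨_, Function.update_self .., fun i => ?_⟩
    rw [dyadicPoint_natCast_apply]
    exact ⟨⟨_, rfl⟩, h i⟩
  · rw [Function.update_of_ne ht]
    exact hψ t

lemma two_mul_le_two_pow (D : ℕ) : 2 * D ≤ 2 ^ (2 * D) := (Nat.lt_two_pow_self).le

/-- Finding a point by successive extensions of a path. -/
lemma exists_OTM_choice (N : Seminorm ℝ (Fin d → ℝ)) (hd : 0 < d) (h e₁ e₂ : ℕ)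
    (h2 : ∀ x, ‖x‖ ≤ 2 ^ e₂ * N x) (hD0 : 0 < D) :
    ∃ (M : OTM) (C : ℕ), ∀ (φ₁ : StrFun) (b : ℤ) (ws : List Word) (S : Set (Fin d → ℝ)),
      IsPredicate φ₁ → ws.length = h → S.Nonempty → IsClosed S → S ⊆ N.closedBall 0 (2 ^ b) →
      (∀ p : List (Fin d × Fin (2 * D) → Bool), Accepts φ₁ (unaryInt b).length (e₁ + 1) p →
        NearSet N S (unaryInt b).length (e₁ + 1) p) →
      (∀ p : List (Fin d × Fin (2 * D) → Bool), NearSet N S (unaryInt b).length (e₁ + 1) p →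
        ∃ u, u ≠ [] ∧ Accepts φ₁ (unaryInt b).length (e₁ + 1) (u ++ p)) →
      ∃ y ∈ S, ∃ ψ, realRep d ψ y ∧
        (∀ s, ∃ T, M.OutputsWithin (withAdvice φ₁ (unaryInt b :: ws)) s (ψ s) T) ∧
        ((∀ p : List (Fin d × Fin (2 * D) → Bool), NearSet N S (unaryInt b).length (e₁ + 1) p →
          ∃ γ, Accepts φ₁ (unaryInt b).length (e₁ + 1) (γ :: p)) →
          ∀ s, M.OutputsWithin (withAdvice φ₁ (unaryInt b :: ws)) s (ψ s)
            (C * (totalLength (unaryInt b :: ws) + 1) ^ 2 * (s.length + 1) ^ 2)) := by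
  have : Nonempty (Fin d × Fin (2 * D)) := ⟨⟨⟨0, hd⟩, ⟨0, by omega⟩⟩⟩
  obtain ⟨M, hM⟩ := Frag.exists_OTM
    (findPoint (d := d) (D := D) (h + 1) (e₁ + 1) (2 * D) false)
  obtain ⟨C, hC⟩ := exec_search_iterate (d := d) (D := D) (h + 1) (e₁ + 1) (2 * D)
  set K := 80 * d * (D + 1) + 4 * h + 6 * (2 * D) + 100 with hK
  refine ⟨M, 2 * ((C + K) * (4 * D + 3) ^ 2), ?_⟩
  intro φ₁ b ws S hφ₁ hws hne hcl hb hG hnext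
  set β := (unaryInt b).length with hβ
  have hbβ : b ≤ β := le_length_unaryInt b
  have hnil : NearSet (D := D) N S β (e₁ + 1) [] := NearSet.nil hb hne hbβ _
  -- This sequence does not involve the input. Inputs only decide at which index the search stops,
  -- so all outputs approximate the one limit `y`.
  set bs := fun k => (nextPath (d := d) (D := D) (Accepts φ₁ β (e₁ + 1)) 0)^[k] [] with hbs
  have hstep : ∀ k, NearSet N S β (e₁ + 1) (bs k) →
      ∃ u, u ≠ [] ∧ bs (k + 1) = u ++ bs k ∧ Accepts φ₁ β (e₁ + 1) (u ++ bs k) := by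
    intro k hk
    obtain ⟨u, hu, ha⟩ := hnext _ hk
    obtain ⟨m, m1, m2, -, -, -, m3⟩ := nextPath_spec (Accepts φ₁ β (e₁ + 1)) 0 (bs k) u hu ha
    refine ⟨_, List.ne_nil_of_length_pos m3, ?_, m2⟩
    simp only [hbs]
    rw [Function.iterate_succ_apply']
    exact m1
  have hnear : ∀ k, NearSet N S β (e₁ + 1) (bs k) := by
    intro k
    induction k with
    | zero => exact hnil
    | succ k ih =>
      obtain ⟨u, -, h1, h2⟩ := hstep k ih
      rw [h1]
      exact hG _ h2
  obtain ⟨y, hy, hw, hyb⟩ := exists_limit_pathPoint β bs fun k => by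
    obtain ⟨u, h1, h2, -⟩ := hstep k (hnear k)
    exact ⟨u, h1, h2⟩
  have hyS : y ∈ S := mem_of_tendsto_pathPoint hcl h2 hy hw hnear
  have main : ∀ s : Word, ∃ (a : Fin d → ℤ) (T : ℕ),
      (∀ i, |(a i : ℝ) / 2 ^ s.length - y i| ≤ 1 / 2 ^ s.length) ∧
      M.OutputsWithin (withAdvice φ₁ (unaryInt b :: ws)) s
        (pointCode fun i => (a i, (s.length : ℤ))) T ∧
      ((∀ p : List (Fin d × Fin (2 * D) → Bool), NearSet N S β (e₁ + 1) p →
          ∃ γ, Accepts φ₁ β (e₁ + 1) (γ :: p)) →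
        T ≤ 2 * ((C + K) * (4 * D + 3) ^ 2) * (totalLength (unaryInt b :: ws) + 1) ^ 2 *
          (s.length + 1) ^ 2) := by
    intro s
    obtain ⟨k, T, hk, hT, hγ⟩ := hC (unaryInt b :: ws) (by simp [hws]) φ₁ hφ₁ s.length β
      (NearSet N S β (e₁ + 1)) hnil hG hnext
    change _ ≤ (bs k).length at hk
    have ht : totalLength (unaryInt b :: ws) = β + totalLength ws := by simp [totalLength, hβ]
    obtain ⟨σ', h3, h4⟩ := exec_findPoint (unaryInt b) ws (e₁ + 1) (2 * D) false φ₁ hφ₁ s (bs k)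
      (2 * D - 1 + ((bs k).length - (s.length + β + 2 * D))) T
      ((bs k).length + s.length + totalLength (unaryInt b :: ws)) (by simpa using hT)
      (by omega) le_rfl
    rw [hws] at h3
    have h5 := hM _ _ _ _ h3
    rw [h4] at h5
    refine ⟨_, _, fun i => ?_, h5, fun hyp => ?_⟩
    · exact abs_convertValue_sub_le β s.length (2 * D) _ (bs k) y (hyb k)
        (two_mul_le_two_pow D) hk (by omega) i
    · obtain ⟨g1, g2⟩ := hγ hyp
      change (bs k).length ≤ _ at g1
      set t := totalLength (unaryInt b :: ws) with ht'
      set L := 2 * s.length + 2 * t + 4 * D + 2 with hL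
      have g3 := g2 L (by omega) (by omega)
      have g4 : (bs k).length + s.length + t ≤ L := by omega
      have g5 : L + 1 ≤ (4 * D + 3) * ((t + 1) * (s.length + 1)) := by
        rw [hL]
        have : (4 * D + 3) * ((t + 1) * (s.length + 1)) =
          (4 * D) * (t * s.length + t + s.length) + 4 * D + 3 * (t * s.length) + 3 * t +
            3 * s.length + 3 := by ring
        omega
      calc 2 * (T + K * ((bs k).length + s.length + t + 1))
          ≤ 2 * ((L + 1) * (C * (L + 1)) + K * ((L + 1) * (L + 1))) := by
            gcongr
            exact (Nat.add_le_add_right g4 1).trans (Nat.le_mul_of_pos_left _ (by omega))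
        _ = 2 * (C + K) * ((L + 1) * (L + 1)) := by ring
        _ ≤ 2 * (C + K) * (((4 * D + 3) * ((t + 1) * (s.length + 1))) *
            ((4 * D + 3) * ((t + 1) * (s.length + 1)))) := by gcongr
        _ = _ := by ring
  choose a T h3 h4 h5 using main
  refine ⟨y, hyS, fun s => pointCode fun i => (a s i, (s.length : ℤ)),
    fun s => ⟨_, rfl, fun i => ?_⟩, fun s => ⟨_, h4 s⟩, fun hyp s => (h4 s).mono (h5 s hyp)⟩
  rw [dyadicPoint_natCast_apply]
  exact ⟨⟨_, rfl⟩, h3 s i⟩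

/-- Finding a point near the set with the help of an inner radius parameter. -/
lemma exists_OTM_approxChoice (N : Seminorm ℝ (Fin d → ℝ)) (hd : 0 < d) (e₁ e₂ : ℕ)
    (h1 : ∀ x, N x ≤ 2 ^ e₁ * ‖x‖) (h2 : ∀ x, ‖x‖ ≤ 2 ^ e₂ * N x)
    (hD : (2 : ℝ) ^ (e₁ + e₂ + 3) + 3 ≤ D) (hD0 : 0 < D) :
    ∃ (M : OTM) (c q : ℕ), ∀ (φ₁ : StrFun) (b r : ℤ) (S : Set (Fin d → ℝ)) (x : Fin d → ℝ),
      wmemRep N φ₁ S → S ⊆ N.closedBall 0 (2 ^ b) → x ∈ S → N.closedBall x (2 ^ (-r)) ⊆ S →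
      ∀ s, ∃ y ∈ S, ∃ ψ, realRep d ψ y ∧
        M.OutputsWithin (withAdvice φ₁ [unaryInt b, unaryInt r]) s (ψ s)
          (2 ^ (c * ((unaryInt r).length + (unaryInt b).length + 1)) * (q * (s.length + 1))) := by
  have : Nonempty (Fin d × Fin (2 * D)) := ⟨⟨⟨0, hd⟩, ⟨0, by omega⟩⟩⟩
  obtain ⟨M, hM⟩ := Frag.exists_OTM
    (findPoint (d := d) (D := D) (1 + 1) (e₁ + 1) (2 * D) true)
  obtain ⟨C, hC⟩ := exec_search_padded (d := d) (D := D) (1 + 1) (e₁ + 1) (2 * D)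
  set K := 80 * d * (D + 1) + 4 * 1 + 6 * (2 * D) + 100 with hK
  set A := Fintype.card (Fin d × Fin (2 * D) → Bool) with hA
  refine ⟨M, A * (e₁ + 2) + 1, 2 * ((C + K + 1) * (2 * e₁ + 2 * D + 10)), ?_⟩
  intro φ₁ b r S x hφ hb hx hr s
  set β := (unaryInt b).length with hβ
  set ρ := (unaryInt r).length with hρ
  set n := s.length with hn
  -- The word `u` only serves to bound the length of the search; the output comes from the first
  -- accepted word `v`, and its distance to `S` is controlled by the padding.
  obtain ⟨u, hu, hacc⟩ := exists_accepts_padded hφ h1 h2 hD hb (le_length_unaryInt b) hx hr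
    (le_length_unaryInt r) (n + β + 2 * D)
  rw [← hβ, ← hρ] at hu
  have ht : totalLength [unaryInt b, unaryInt r] = β + ρ := by simp [totalLength, hβ, hρ]
  set L := 2 * n + 4 * (ρ + β) + 2 * e₁ + 2 * D + 8 with hL
  obtain ⟨v, hv, hvu, hva, hT⟩ := hC [unaryInt b, unaryInt r] rfl φ₁ hφ.1 n β L u
    (List.ne_nil_of_length_pos (by omega)) hacc (by omega) (by omega) (by omega)
  set p := padded (n + β + 2 * D) v [] with hp
  have hpl : p.length = n + β + 2 * D + v.length := by rw [hp, length_padded]; simp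
  obtain ⟨y, hyS, hy⟩ := NearSet.of_accepts_wmem hφ _ _ hva
  obtain ⟨σ', h3, h4⟩ := exec_findPoint (unaryInt b) [unaryInt r] (e₁ + 1) (2 * D) true φ₁ hφ.1 s p
    (2 * D - 1 + v.length) (wordRank u * (C * (L + 1)) + 1) L (by simpa using hT)
    (by omega) (by omega)
  have h5 := hM _ _ _ _ h3
  rw [h4] at h5
  have hDR : (2 : ℝ) ^ (e₁ + e₂ + 2) ≤ D := by
    rw [pow_succ] at hD
    have : (0 : ℝ) < 2 ^ (e₁ + e₂ + 2) := by positivity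
    linarith
  obtain ⟨ψ, hψ, hψs⟩ := exists_realRep_apply_eq y s (fun i =>
      convertValue i false (2 * D - 1 + v.length) p) fun i =>
    abs_convertValue_sub_le β n (2 * D) _ p y (fun i => (NearSet.abs_sub_le h2 hy i).trans
      (mul_le_mul_of_nonneg_right hDR (pathWidth_pos β p).le))
      (two_mul_le_two_pow D) (by omega) (by omega) i
  refine ⟨y, hyS, ψ, hψ, ?_⟩
  rw [hψs]
  refine h5.mono ?_
  -- The base `A + 1` of the bound on the rank is at most `2 ^ A`.
  have hrank : wordRank u ≤ 2 ^ (A * (ρ + β + e₁ + 2)) := by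
    refine (wordRank_lt u).le.trans ?_
    rw [hu, pow_mul, show β + ρ + e₁ + 2 = ρ + β + e₁ + 2 by omega]
    exact Nat.pow_le_pow_left Nat.lt_two_pow_self _
  -- The `+ 1` in the exponent absorbs the linear factor contributed by the cost of a single round.
  have hexp : 2 ^ (A * (ρ + β + e₁ + 2)) * (ρ + β + 1) ≤
      2 ^ ((A * (e₁ + 2) + 1) * (ρ + β + 1)) := by
    rw [add_mul, one_mul, pow_add]
    refine Nat.mul_le_mul (Nat.pow_le_pow_right two_pos ?_) Nat.lt_two_pow_self.le
    rw [mul_assoc]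
    exact Nat.mul_le_mul_left _ (by nlinarith)
  have hL1 : L + 1 ≤ (2 * e₁ + 2 * D + 10) * ((ρ + β + 1) * (n + 1)) := by
    have : (2 * e₁ + 2 * D + 10) * ((ρ + β + 1) * (n + 1)) = (2 * e₁ + 2 * D) *
      ((ρ + β) * n + (ρ + β) + n) + 2 * e₁ + 2 * D + 10 * ((ρ + β) * n) + 10 * (ρ + β) + 10 * n
        + 10 := by ring
    omega
  set X := 2 ^ (A * (ρ + β + e₁ + 2)) with hX
  have hX1 : 1 ≤ X := Nat.one_le_two_pow
  calc 2 * (wordRank u * (C * (L + 1)) + 1 + K * (L + 1))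
      ≤ 2 * (X * (C * (L + 1)) + X * (L + 1) + X * (K * (L + 1))) := by
        refine Nat.mul_le_mul_left _ (Nat.add_le_add (Nat.add_le_add ?_ ?_) ?_)
        · exact Nat.mul_le_mul_right _ hrank
        · exact Nat.mul_pos hX1 (by omega)
        · exact Nat.le_mul_of_pos_left _ hX1
    _ = 2 * (C + K + 1) * X * (L + 1) := by ring
    _ ≤ 2 * (C + K + 1) * X * ((2 * e₁ + 2 * D + 10) * ((ρ + β + 1) * (n + 1))) := by gcongr
    _ = (X * (ρ + β + 1)) * (2 * ((C + K + 1) * (2 * e₁ + 2 * D + 10)) * (n + 1)) := by ring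
    _ ≤ _ := by gcongr

variable {N : Seminorm ℝ (Fin d → ℝ)}

lemma exists_digit_bound (e₁ e₂ : ℕ) : ∃ D : ℕ, (2 : ℝ) ^ (e₁ + e₂ + 3) + 3 ≤ D ∧ 0 < D :=
  ⟨2 ^ (e₁ + e₂ + 3) + 3, by push_cast; rfl, Nat.succ_pos _⟩

theorem isFullyPolyTime_choice (hd : 0 < d) (hN : ∀ x, N x = 0 → x = 0) :
    IsFullyPolyTime (setRepB N) (realRep d) Choice := by
  obtain ⟨e₁, e₂, h1, h2⟩ := exists_pow_two_mul_norm_bound N hN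
  obtain ⟨D, hD, hD0⟩ := exists_digit_bound e₁ e₂
  obtain ⟨M, C, hM⟩ := exists_OTM_choice N hd 0 e₁ e₂ h2 hD0
  refine ⟨Polynomial.C C * (Polynomial.X + 1) ^ 2, (Polynomial.X + 1) ^ 2, M, ?_⟩
  rintro φ S k ⟨φ₁, w, j, rfl, ⟨⟨hne, hcomp⟩, hφ, rfl⟩, ⟨b, rfl, hb⟩, rfl⟩ -
  have hγ := fun p => exists_accepts_of_nearSet (β := (unaryInt b).length) hφ h1 h2 hD p
  obtain ⟨y, hy, ψ, hψ, -, h3⟩ := hM φ₁ b [] S hφ.1 rfl hne hcomp.isClosed hb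
    (NearSet.of_accepts_set hφ _) fun p hp => by
      obtain ⟨γ, hγ⟩ := hγ p hp
      exact ⟨[γ], by simp, hγ⟩
  refine ⟨y, hy, ψ, hψ, fun s => ?_⟩
  have h4 := h3 hγ s
  simpa [totalLength, withAdvice] using h4

theorem isComputableMV_choice (hd : 0 < d) (hN : ∀ x, N x = 0 → x = 0) :
    IsComputableMV (wmemRepRB N) (realRep d) Choice := by
  obtain ⟨e₁, e₂, h1, h2⟩ := exists_pow_two_mul_norm_bound N hN
  obtain ⟨D, hD, hD0⟩ := exists_digit_bound e₁ e₂
  obtain ⟨M, C, hM⟩ := exists_OTM_choice N hd 1 e₁ e₂ h2 hD0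
  refine ⟨M, ?_⟩
  rintro φ S k ⟨_, w, j, rfl, ⟨φ₁, w', j', rfl, ⟨⟨hne, hcomp, hint⟩, hφ, rfl⟩, hr, rfl⟩,
    ⟨b, rfl, hb⟩, rfl⟩ -
  obtain ⟨y, hy, ψ, hψ, h3, -⟩ := hM φ₁ b [w'] S hφ.1 rfl hne hcomp.isClosed hb
    (NearSet.of_accepts_wmem hφ _)
    fun p hp => exists_append_accepts_of_nearSet hφ hint h2 hD p hp
  exact ⟨y, hy, ψ, hψ, h3⟩

theorem isApproxComputableInTime_choice (hd : 0 < d) (hN : ∀ x, N x = 0 → x = 0) :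
    ∃ (c : ℕ) (q : Polynomial ℕ), IsApproxComputableInTime (wmemRepRB N) (realRep d) Choice
      (fun k => 2 ^ (c * (k + 1))) (fun n => q.eval n) := by
  obtain ⟨e₁, e₂, h1, h2⟩ := exists_pow_two_mul_norm_bound N hN
  obtain ⟨D, hD, hD0⟩ := exists_digit_bound e₁ e₂
  obtain ⟨M, c, q, hM⟩ := exists_OTM_approxChoice N hd e₁ e₂ h1 h2 hD hD0
  refine ⟨c, Polynomial.C q * (Polynomial.X + 1), M, ?_⟩
  rintro φ S k ⟨_, w, j, rfl, ⟨φ₁, w', j', rfl, ⟨-, hφ, rfl⟩, ⟨r, rfl, x, hx, hr⟩, rfl⟩,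
    ⟨b, rfl, hb⟩, rfl⟩ - s
  obtain ⟨y, hy, ψ, hψ, h3⟩ := hM φ₁ b r S x hφ hb (interior_subset hx) hr s
  refine ⟨y, hy, ψ, hψ, ?_⟩
  simpa [withAdvice] using h3

end

section

open Filter Topology

variable {d : ℕ}

/-! ### Injectivity of the codes -/

lemma replicate_false_append_injective {m n : ℕ} {s t : Word}
    (h : List.replicate m false ++ true :: s = List.replicate n false ++ true :: t) :
    m = n ∧ s = t := by
  induction m generalizing n with
  | zero => cases n <;> simp_all [List.replicate_succ]
  | succ m ih =>
    cases n with
    | zero => simp [List.replicate_succ] at h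
    | succ n =>
      simp only [List.replicate_succ, List.cons_append, List.cons.injEq, true_and] at h
      exact ⟨congrArg _ (ih h).1, (ih h).2⟩

lemma pairWord_injective {s t s' t' : Word} (h : pairWord s t = pairWord s' t') :
    s = s' ∧ t = t' := by
  obtain ⟨h1, h2⟩ := replicate_false_append_injective h
  exact List.append_inj h2 h1

lemma unaryInt_injective : Function.Injective unaryInt := fun m n h => by
  have := congrArg List.length h
  simpa [unaryInt] using this

lemma natBits_injective : Function.Injective Nat.bits := by
  have h : ∀ n : ℕ, n.bits.foldr Nat.bit 0 = n := by
    intro n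
    induction n using Nat.binaryRec' with
    | zero => simp
    | bit b n h ih => rw [Nat.bits_append_bit n b h, List.foldr_cons, ih]
  intro m n hmn
  rw [← h m, hmn, h]

lemma binaryInt_injective : Function.Injective binaryInt := fun _ _ h =>
  Equiv.intEquivNat.injective (natBits_injective h)

lemma dyadicCode_injective : Function.Injective dyadicCode := fun _ _ h =>
  Prod.ext (binaryInt_injective (pairWord_injective h).1)
    (unaryInt_injective (pairWord_injective h).2)

/-- Knowing the length tells whether the outermost pairing separates two coordinates or the
numerator and exponent of a single one. -/
lemma dyadicListCode_injective {l l' : List (ℤ × ℤ)} (hl : l.length = l'.length)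
    (h : dyadicListCode l = dyadicListCode l') : l = l' := by
  induction l generalizing l' with
  | nil => exact (List.length_eq_zero_iff.1 hl.symm).symm
  | cons q l ih =>
    obtain _ | ⟨q', l'⟩ := l'
    · simp at hl
    cases l with
    | nil =>
      obtain rfl : l' = [] := List.length_eq_zero_iff.1 (by simpa using hl.symm)
      rw [dyadicCode_injective h]
    | cons r l =>
      obtain _ | ⟨r', l'⟩ := l'
      · simp at hl
      obtain ⟨h1, h2⟩ := pairWord_injective h
      rw [dyadicCode_injective h1, ih (by simpa using hl) h2]

lemma pointCode_injective : Function.Injective (pointCode (d := d)) := fun _ _ h =>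
  List.ofFn_injective (dyadicListCode_injective (by simp) h)

lemma queryWord_injective {c c' : Fin d → ℤ × ℤ} {n n' : ℤ} (h : queryWord c n = queryWord c' n') :
    c = c' ∧ n = n' :=
  ⟨pointCode_injective (pairWord_injective h).1, unaryInt_injective (pairWord_injective h).2⟩

/-! ### Computations with different oracles -/

lemma OTM.iterate_step_of_halt (M : OTM) (φ : StrFun) {c : M.Cfg}
    (h : M.instr c.state = OTMInstr.halt) (n : ℕ) : (M.step φ)^[n] c = c :=
  Function.iterate_fixed (by rw [OTM.step, h]) n

/-- Halting configurations are fixed by `step`, so the output can be read at the time bound itself.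
This allows two runs to be compared at the same time. -/
lemma OTM.OutputsWithin.tapeWord_eq {M : OTM} {φ : StrFun} {s w : Word} {T : ℕ}
    (h : M.OutputsWithin φ s w T) :
    tapeWord (((M.step φ)^[T] (M.startCfg s)).tapes 2) = w := by
  obtain ⟨n, hn, h1, h2⟩ := h
  obtain ⟨m, rfl⟩ := Nat.exists_eq_add_of_le hn
  rw [add_comm, Function.iterate_add_apply, M.iterate_step_of_halt φ h1, h2]

/-- Runs coincide until the oracles disagree on a query. Demanding agreement on the query tape's
word at all times, even without a query, is stronger but harmless for counting. -/
lemma OTM.iterate_step_congr (M : OTM) {φ φ' : StrFun} (c : M.Cfg) (T : ℕ)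
    (h : ∀ n < T, φ' (tapeWord (((M.step φ)^[n] c).tapes 1)) =
      φ (tapeWord (((M.step φ)^[n] c).tapes 1))) :
    (M.step φ')^[T] c = (M.step φ)^[T] c := by
  induction T with
  | zero => rfl
  | succ T ih =>
    rw [Function.iterate_succ_apply', Function.iterate_succ_apply',
      ih fun n hn => h n (Nat.lt_succ_of_lt hn)]
    simp only [OTM.step]
    split
    · rfl
    · rw [h T (Nat.lt_succ_self T)]
    · rfl

/-- Among many oracles that differ from one oracle at mutually different words, two lead to the
same result. -/
lemma OTM.exists_ne_iterate_step_eq (M : OTM) (φ : StrFun) (φs : ℕ → StrFun) (c : M.Cfg) (T J : ℕ)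
    (hT : T + 2 ≤ J) (h : ∀ v i j, φs i v ≠ φ v → φs j v ≠ φ v → i = j) :
    ∃ i < J, ∃ j < J, i ≠ j ∧ (M.step (φs i))^[T] c = (M.step (φs j))^[T] c := by
  classical
  let v := fun n => tapeWord (((M.step φ)^[n] c).tapes 1)
  -- The indices whose oracle is told apart from `φ` by the word on the query tape at some time;
  -- each time contributes at most one index.
  let bad := (Finset.range T).biUnion fun n => (Finset.range J).filter fun j =>
    φs j (v n) ≠ φ (v n)
  have hbad : bad.card ≤ T := by
    refine (Finset.card_biUnion_le_card_mul _ _ 1 fun n _ => ?_).trans (by simp)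
    refine Finset.card_le_one.2 fun i hi j hj => ?_
    exact h _ i j (Finset.mem_filter.1 hi).2 (Finset.mem_filter.1 hj).2
  have hgood : 1 < (Finset.range J \ bad).card := by
    have := Finset.le_card_sdiff bad (Finset.range J)
    rw [Finset.card_range] at this
    omega
  obtain ⟨i, hi, j, hj, hij⟩ := Finset.one_lt_card.1 hgood
  have key : ∀ j ∈ Finset.range J \ bad, (M.step (φs j))^[T] c = (M.step φ)^[T] c := by
    intro j hj
    refine M.iterate_step_congr c T fun n hn => ?_
    by_contra hne
    refine (Finset.mem_sdiff.1 hj).2 (Finset.mem_biUnion.2 ⟨n, Finset.mem_range.2 hn, ?_⟩)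
    exact Finset.mem_filter.2 ⟨(Finset.mem_sdiff.1 hj).1, hne⟩
  exact ⟨i, Finset.mem_range.1 (Finset.mem_sdiff.1 hi).1, j,
    Finset.mem_range.1 (Finset.mem_sdiff.1 hj).1, hij, (key i hi).trans (key j hj).symm⟩

/-! ### The lower bound -/

open Classical in
/-- The name of a set that answers `1` only if it has to. -/
noncomputable def wmemName (N : Seminorm ℝ (Fin d → ℝ)) (S : Set (Fin d → ℝ)) : StrFun := fun v =>
  if ∃ (c : Fin d → ℤ × ℤ) (n : ℤ), v = queryWord c n ∧
    N.closedBall (dyadicPoint c) ((2 : ℝ) ^ (-n)) ⊆ S then [true] else [false]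

lemma length_wmemName (N : Seminorm ℝ (Fin d → ℝ)) (S : Set (Fin d → ℝ)) (v : Word) :
    (wmemName N S v).length = 1 := by
  unfold wmemName
  split <;> rfl

lemma dyadicPoint_mem_closedBall (N : Seminorm ℝ (Fin d → ℝ)) (c : Fin d → ℤ × ℤ) (n : ℤ) :
    dyadicPoint c ∈ N.closedBall (dyadicPoint c) ((2 : ℝ) ^ (-n)) :=
  N.mem_closedBall_self (by positivity)

lemma wmemRep_wmemName (N : Seminorm ℝ (Fin d → ℝ)) (S : Set (Fin d → ℝ)) :
    wmemRep N (wmemName N S) S := by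
  refine ⟨fun v => ?_, fun c n => ⟨fun h => if_pos ⟨c, n, rfl, h⟩, fun h => if_neg ?_⟩⟩
  · unfold wmemName
    split
    · exact Or.inr rfl
    · exact Or.inl rfl
  · rintro ⟨c', n', hcn, h'⟩
    obtain ⟨rfl, rfl⟩ := queryWord_injective hcn
    have := dyadicPoint_mem_closedBall N c n
    exact Set.eq_empty_iff_forall_notMem.1 h _ ⟨this, h' this⟩

/-- An answer `1` puts the centre of the queried ball into the set, and the query word determines
that centre. -/
lemma wmemName_eq_true {N : Seminorm ℝ (Fin d → ℝ)} {S S' : Set (Fin d → ℝ)} {v : Word}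
    (h : wmemName N S v ≠ [false]) (h' : wmemName N S' v ≠ [false]) : (S ∩ S').Nonempty := by
  unfold wmemName at h h'
  split_ifs at h with h1
  · split_ifs at h' with h2
    · obtain ⟨c, n, rfl, hc⟩ := h1
      obtain ⟨c', n', hcn, hc'⟩ := h2
      obtain ⟨rfl, rfl⟩ := queryWord_injective hcn
      have := dyadicPoint_mem_closedBall N c n
      exact ⟨_, hc this, hc' this⟩
    · exact absurd rfl h'
  · exact absurd rfl h

/-- The name of a set with two advice words. -/
def adviceName (φ : StrFun) (w w' : Word) : StrFun :=
  pairFun (pairFun φ fun _ => w) fun _ => w'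

/-- Queries for the advice see `φ` only through the lengths of its answers, which agree. A
difference must therefore come from a query to `φ` itself. -/
lemma exists_apply_ne_of_adviceName_ne {φ φ' : StrFun} {w w' v : Word}
    (hlen : ∀ s, (φ s).length = (φ' s).length) (h : adviceName φ w w' v ≠ adviceName φ' w w' v) :
    ∃ t, v = false :: false :: t ∧ φ t ≠ φ' t := by
  rcases v with _ | ⟨_ | _, _ | ⟨_ | _, t⟩⟩
  · exact absurd rfl h
  · exact absurd rfl h
  · exact ⟨t, rfl, fun ht => h (by simp only [adviceName, pairFun, ht])⟩
  · exact absurd (by simp only [adviceName, pairFun, hlen]) h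
  · exact absurd rfl h
  · exact absurd (by simp only [adviceName, pairFun, List.length_append, List.length_cons,
      hlen]) h
  · exact absurd (by simp only [adviceName, pairFun, List.length_append, List.length_cons,
      List.length_replicate, hlen]) h

lemma tendsto_polynomial_div_two_pow (P : Polynomial ℕ) :
    Tendsto (fun n : ℕ => ((P.eval n : ℕ) : ℝ) / 2 ^ n) atTop (𝓝 0) := by
  induction P using Polynomial.induction_on' with
  | add p q hp hq =>
    have := hp.add hq
    simpa [add_div] using this
  | monomial k a =>
    have := (tendsto_pow_const_div_const_pow_of_one_lt k (one_lt_two (α := ℝ))).const_mul (a : ℝ)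
    simpa [mul_div_assoc] using this

lemma exists_polynomial_eval_le_two_pow (P : Polynomial ℕ) : ∃ m : ℕ, P.eval m ≤ 2 ^ m := by
  obtain ⟨m, hm⟩ := ((tendsto_polynomial_div_two_pow P).eventually_le_const one_pos).exists
  refine ⟨m, ?_⟩
  rw [div_le_one (by positivity)] at hm
  exact_mod_cast hm

variable {N : Seminorm ℝ (Fin d → ℝ)}

lemma closedBall_mem_boundedBodies {e₂ : ℕ} (h2 : ∀ x, ‖x‖ ≤ 2 ^ e₂ * N x) (c : Fin d → ℝ) :
    c ∈ interior (N.closedBall c 1) ∧ N.closedBall c 1 ∈ boundedBodies d := by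
  have hcont : Continuous fun y => N (y - c) := N.continuous_pi.comp (continuous_id.sub
    continuous_const)
  have hint : c ∈ interior (N.closedBall c 1) := by
    refine mem_interior.2 ⟨N.ball c 1, N.ball_subset_closedBall c 1, ?_,
      N.mem_ball_self one_pos⟩
    have : N.ball c 1 = (fun y => N (y - c)) ⁻¹' Set.Iio 1 := by
      ext y
      simp [Seminorm.mem_ball]
    rw [this]
    exact isOpen_Iio.preimage hcont
  have hclosed : IsClosed (N.closedBall c 1) := by
    have : N.closedBall c 1 = (fun y => N (y - c)) ⁻¹' Set.Iic 1 := by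
      ext y
      simp [Seminorm.mem_closedBall]
    rw [this]
    exact isClosed_Iic.preimage hcont
  refine ⟨hint, ⟨c, interior_subset hint⟩, ?_, ?_⟩
  · refine Metric.isCompact_of_isClosed_isBounded hclosed
      ((Metric.isBounded_closedBall (x := c) (r := 2 ^ e₂)).subset fun y hy => ?_)
    rw [Seminorm.mem_closedBall] at hy
    rw [Metric.mem_closedBall, dist_eq_norm]
    refine (h2 _).trans ?_
    exact mul_le_of_le_one_right (by positivity) hy
  · rw [(N.convex_closedBall c 1).closure_interior_eq_closure_of_nonempty_interior ⟨c, hint⟩,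
      hclosed.closure_eq]

theorem not_isApproxFullyPolyTime_choice (hd : 0 < d) (hN : ∀ x, N x = 0 → x = 0) :
    ¬ IsApproxFullyPolyTime (wmemRepRB N) (realRep d) Choice := by
  rintro ⟨p, q, M, hM⟩
  obtain ⟨e₁, e₂, h1, h2⟩ := exists_pow_two_mul_norm_bound N hN
  -- A unit ball of `N` extends at most `2 ^ e₂` in each coordinate. Centres `G` apart thus leave a
  -- gap of at least `3`, while a common output would allow only `2`.
  set G : ℕ := 2 ^ (e₂ + 1) + 3 with hG
  obtain ⟨g, hg⟩ := pow_unbounded_of_one_lt ((2 : ℝ) ^ e₁ * G + 1) (one_lt_two (α := ℝ))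
  -- The advice has length `2 * (m + g)`, since `unaryInt 0` is empty. The polynomial is the time
  -- bound at this length and the empty input, plus the `2` needed for the pigeonhole argument.
  obtain ⟨m, hm⟩ := exists_polynomial_eval_le_two_pow
    (p.comp (2 * (Polynomial.X + Polynomial.C g)) * Polynomial.C (q.eval 0) + 2)
  have hlen : (unaryInt ((m + g : ℕ) : ℤ)).length = 2 * (m + g) := by
    rw [unaryInt_eq, length_zeros]
    omega
  simp only [Polynomial.eval_add, Polynomial.eval_mul, Polynomial.eval_comp, Polynomial.eval_ofNat,
    Polynomial.eval_X, Polynomial.eval_C, ← hlen] at hm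
  set w := unaryInt ((m + g : ℕ) : ℤ) with hw
  set T := p.eval w.length * q.eval 0 with hT
  let ctr : ℕ → Fin d → ℝ := fun j _ => j * G
  let S : ℕ → Set (Fin d → ℝ) := fun j => N.closedBall (ctr j) 1
  let φs : ℕ → StrFun := fun j => adviceName (wmemName N (S j)) (unaryInt 0) w
  have hname : ∀ j < 2 ^ m, wmemRepRB N (φs j) (S j) w.length := by
    intro j hj
    obtain ⟨hint, hbody⟩ := closedBall_mem_boundedBodies h2 (ctr j)
    refine ⟨_, w, 0, rfl, ⟨_, unaryInt 0, 0, rfl, ⟨hbody, wmemRep_wmemName N (S j), rfl⟩,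
      ⟨0, rfl, ctr j, hint, by simp [S]⟩, rfl⟩, ⟨_, rfl, fun y hy => ?_⟩, by simp⟩
    rw [Seminorm.mem_closedBall] at hy ⊢
    rw [sub_zero, zpow_natCast, pow_add]
    have e1 : ‖ctr j‖ ≤ j * G := by
      rw [pi_norm_le_iff_of_nonneg (by positivity)]
      intro i
      rw [Real.norm_eq_abs, abs_of_nonneg (by positivity)]
    have e2 : N y ≤ N (y - ctr j) + N (ctr j) := by
      simpa using map_add_le_add N (y - ctr j) (ctr j)
    have e3 : (j : ℝ) + 1 ≤ 2 ^ m := by exact_mod_cast hj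
    have e4 : N (ctr j) ≤ 2 ^ e₁ * (j * G) := (h1 _).trans (by gcongr)
    have e5 : (0 : ℝ) ≤ 2 ^ e₁ * G := by positivity
    have e6 : (0 : ℝ) ≤ j := Nat.cast_nonneg j
    calc N y ≤ 1 + 2 ^ e₁ * (j * G) := by linarith
      _ ≤ (j + 1) * (2 ^ e₁ * G + 1) := by nlinarith
      _ ≤ 2 ^ m * 2 ^ g := by gcongr
  have hfar : ∀ i j : ℕ, i ≠ j → ∀ x ∈ S i, ∀ y ∈ S j, ∀ k, 2 < |x k - y k| := by
    intro i j hij x hx y hy k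
    rw [Seminorm.mem_closedBall] at hx hy
    have e1 := abs_sub_le_of_seminorm h2 hx k
    have e2 := abs_sub_le_of_seminorm h2 hy k
    have e3 : (G : ℝ) ≤ |ctr i k - ctr j k| := by
      have e4 : (1 : ℝ) ≤ |(i : ℝ) - j| := by
        have : (1 : ℤ) ≤ |(i : ℤ) - j| := Int.one_le_abs (sub_ne_zero.2 (by exact_mod_cast hij))
        exact_mod_cast this
      have e5 : (0 : ℝ) ≤ G := Nat.cast_nonneg G
      rw [show ctr i k - ctr j k = ((i : ℝ) - j) * G from (sub_mul _ _ _).symm, abs_mul,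
        abs_of_nonneg e5]
      nlinarith
    have e6 : (G : ℝ) = 2 * 2 ^ e₂ + 3 := by rw [hG]; push_cast; ring
    have e7 : |ctr i k - ctr j k| ≤ |x k - ctr i k| + |x k - y k| + |y k - ctr j k| := by
      have e8 := abs_sub_le (ctr i k) (x k) (ctr j k)
      have e9 := abs_sub_le (x k) (y k) (ctr j k)
      rw [abs_sub_comm (ctr i k) (x k)] at e8
      linarith
    linarith
  -- The reference oracle always answers `0` about the set and carries the same advice as all the
  -- names.
  obtain ⟨i, hi, j, hj, hij, heq⟩ := M.exists_ne_iterate_step_eq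
    (adviceName (fun _ => [false]) (unaryInt 0) w) φs (M.startCfg []) T (2 ^ m) hm (by
      intro v i j hi hj
      obtain ⟨t, ht, hti⟩ := exists_apply_ne_of_adviceName_ne
        (fun s => length_wmemName N (S i) s) hi
      obtain ⟨t', ht', htj⟩ := exists_apply_ne_of_adviceName_ne
        (fun s => length_wmemName N (S j) s) hj
      obtain rfl : t = t' := by simpa [ht] using ht'
      obtain ⟨x, hxi, hxj⟩ := wmemName_eq_true hti htj
      by_contra hij
      have := hfar i j hij x hxi x hxj ⟨0, hd⟩
      norm_num at this)
  obtain ⟨x, hx, ψ, hψ, hout⟩ := hM _ _ _ (hname i hi)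
    (closedBall_mem_boundedBodies h2 (ctr i)).2.1 []
  obtain ⟨y, hy, ψ', hψ', hout'⟩ := hM _ _ _ (hname j hj)
    (closedBall_mem_boundedBodies h2 (ctr j)).2.1 []
  obtain ⟨c, hc, hcx⟩ := hψ []
  obtain ⟨c', hc', hcy⟩ := hψ' []
  have e1 : ψ [] = ψ' [] := by
    rw [← hout.tapeWord_eq, ← hout'.tapeWord_eq]
    exact congrArg (fun C : M.Cfg => tapeWord (C.tapes 2)) heq
  obtain rfl : c = c' := pointCode_injective (by rw [← hc, ← hc', e1])
  have e2 := (hcx ⟨0, hd⟩).2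
  have e3 := (hcy ⟨0, hd⟩).2
  have e4 := hfar i j hij x hx y hy ⟨0, hd⟩
  have e5 := abs_sub_le (x ⟨0, hd⟩) (dyadicPoint c ⟨0, hd⟩) (y ⟨0, hd⟩)
  -- On the empty input the precision is `0`: the common output is within `1` of both points in the
  -- first coordinate.
  rw [abs_sub_comm (x ⟨0, hd⟩) (dyadicPoint c ⟨0, hd⟩)] at e5
  norm_num at e2 e3
  linarith

end

theorem mainTheorem10 (d : ℕ) (hd : 1 ≤ d) (N : Seminorm ℝ (Fin d → ℝ))
    (hN : ∀ x, N x = 0 → x = 0) :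
    IsFullyPolyTime (setRepB N) (realRep d) Choice ∧
    IsComputableMV (wmemRepRB N) (realRep d) Choice ∧
    (∃ (c : ℕ) (q : Polynomial ℕ), IsApproxComputableInTime (wmemRepRB N) (realRep d) Choice
      (fun k => 2 ^ (c * (k + 1))) (fun n => q.eval n)) ∧
    ¬ IsApproxFullyPolyTime (wmemRepRB N) (realRep d) Choice :=
  ⟨isFullyPolyTime_choice hd hN, isComputableMV_choice hd hN,
    isApproxComputableInTime_choice hd hN, not_isApproxFullyPolyTime_choice hd hN⟩
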